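/- A \emph{polygon} is a closed region in $\mathbb{R}^2$ (compact or not), with connected interior whose closure is the region, whose boundary is a union of segments, rays or lines (its sides), only finitely many of which meet any bounded set and any two of which meet only in end points. A \emph{polygonal surface} $P$ is a connected, oriented Hausdorff surface, possibly with boundary, assembled from an at most countable family of polygons by identifying full sides by isometries, so that each point of $P$ comes from finitely many points of the polygons. It carries a flat structure: near every interior point $P$ is isometric to a euclidean cone of some cone angle $\theta>0$, and near every boundary point to a euclidean wedge of some angle $\alpha>0$; the points with $\theta\neq 2\pi$, resp. $\alpha\neq\pi$, are singular. The holonomy group $\mathrm{Hol}(P)\subset \mathrm{Iso}(\mathbb{R}^2)$ is obtained by developing $P$ along loops that avoid the singular points, where the boundary acts as a mirror (a loop may be reflected in it); it is defined up to conjugation. The rotational holonomy $\mathrm{Hol}_r(P)\subset O(2)$ is the group of linear parts of $\mathrm{Hol}(P)$. The surface $P$ is \emph{rational} if $\mathrm{Hol}_r(P)$ is finite, and a \emph{translation surface} if $\mathrm{Hol}_r(P)$ is trivial. A \emph{covering} of polygonal surfaces $\varphi:R\to S$ is a continuous surjection compatible with the flat structures, possibly branched: each $y\in S$ has a cone or wedge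 neighbourhood whose preimage is the disjoint union of cone or wedge neighbourhoods of the points of $\varphi^{-1}(y)$, on each of which $\varphi$ is, in suitable polar coordinates $(r,t)$, the map $(r,t)\mapsto(r,t)$ (so cones cover cones, and wedges or cones cover wedges by folding). It is \emph{tame} if $\mathrm{Hol}_r(R)$ has finite index in $\mathrm{Hol}_r(S)$. The \emph{degree} of $\varphi$ is the number of its sheets, i.e. the number of preimages of a nonsingular interior point of $S$ all of whose preimages are nonsingular interior points. \textbf{Corollary 4.} Let $P$ be a rational polygonal surface. There is a tame covering $\varphi_t:S(P)\to P$ by a translation surface $S(P)$ which is minimal: for every tame covering $\varphi:R'\to P$ by a translation surface $R'$ there is a tame covering of translation surfaces $\psi:R'\to S(P)$ with $\varphi=\varphi_t\circ\psi$. The minimal tame covering is unique: for any other minimal tame covering $\varphi':S'\to P$ by a translation surface there is an isomorphism of polygonal surfaces $h:S(P)\to S'$ with $\varphi'\circ h=\varphi_t$. The degree of $\varphi_t$ is $|\mathrm{Hol}_r(P)|$. -/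

import Mathlib

open Set Filter Topology

universe u

/-- `Iso(ℝ²)`, with the plane written as `ℂ`. -/
abbrev PlaneIso : Type := ℂ ≃ᵃⁱ[ℝ] ℂ

/-- `O(2)`. -/
abbrev PlaneRot : Type := ℂ ≃ₗᵢ[ℝ] ℂ

/-- The linear part `Iso(ℝ²) → O(2)` of an isometry. -/
noncomputable def linearPart : PlaneIso →* PlaneRot where
  toFun g := g.linearIsometryEquiv
  map_one' := rfl
  map_mul' _ _ := rfl

/-- The half-plane `Re ζ < c`. By `ζ = log r + i t` it parametrizes the polar coordinates
`0 < r < exp c`, `t ∈ ℝ`; the developing map of these coordinates is `Complex.exp`. -/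
def leftHalf (c : ℝ) : Set ℂ := {ζ | ζ.re < c}

/-- The set covered by a polar chart `q` of radius `exp c` at `x`, with its apex. -/
def polarDisc {X : Type u} (x : X) (c : ℝ) (q : ℂ → X) : Set X := insert x (q '' leftHalf c)

/-! ### Flat surfaces with singularities -/

/-- An atlas of flat charts, defined on open subsets of `X`, whose transition maps are locally
orientation preserving isometries `w ↦ a w + b`, `|a| = 1`. -/
structure FlatAtlas (X : Type u) [TopologicalSpace X] where
  charts : Set (OpenPartialHomeomorph X ℂ)
  compat : ∀ e ∈ charts, ∀ e' ∈ charts, ∀ x ∈ e.source ∩ e'.source,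
    ∃ a b : ℂ, ‖a‖ = 1 ∧ ∀ᶠ y in 𝓝 x, e' y = a * e y + b

namespace FlatAtlas

variable {X : Type u} [TopologicalSpace X] (A : FlatAtlas X)

/-- Near `ζ`, the map `q` is the developing map `exp` of polar coordinates, read in a flat chart
up to an isometry of the plane. -/
def PolarFlatAt (q : ℂ → X) (ζ : ℂ) : Prop :=
  ∃ e ∈ A.charts, ∃ g : PlaneIso, g (Complex.exp ζ) ∈ e.target ∧
    ∀ᶠ ω in 𝓝 ζ, q ω = e.symm (g (Complex.exp ω))

/-- The topological part of the notion of a polar chart at `x`. -/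
def PolarTop (x : X) (c : ℝ) (q : ℂ → X) : Prop :=
  ContinuousOn q (leftHalf c) ∧
  (∀ U : Set ℂ, IsOpen U → U ⊆ leftHalf c → IsOpen (q '' U)) ∧
  x ∉ q '' leftHalf c ∧
  (𝓝 x).HasBasis (fun a : ℝ => a ≤ c) (fun a => polarDisc x a q)

/-- Near `x` the surface is a euclidean cone of cone angle `θ` with apex `x`: in the polar
coordinates `q` two points agree iff their polar angles differ by a multiple of `θ`. -/
def IsConeChart (x : X) (θ c : ℝ) (q : ℂ → X) : Prop :=
  0 < θ ∧ PolarTop x c q ∧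
  (∀ ζ ∈ leftHalf c, ∀ ζ' ∈ leftHalf c,
    q ζ = q ζ' ↔ ∃ n : ℤ, ζ' = ζ + ((n * θ : ℝ) : ℂ) * Complex.I) ∧
  ∀ ζ ∈ leftHalf c, A.PolarFlatAt q ζ

/-- Near `x` the surface is a euclidean wedge of wedge angle `α` with apex `x`. The wedge
`0 ≤ t ≤ α` is written as the quotient of all polar angles `t` by the group generated by the
reflections `t ↦ -t` and `t ↦ 2α - t`; the rays `t ∈ α ℤ` are sent to the boundary. -/
def IsWedgeChart (x : X) (α c : ℝ) (q : ℂ → X) : Prop :=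
  0 < α ∧ PolarTop x c q ∧
  (∀ ζ ∈ leftHalf c, ∀ ζ' ∈ leftHalf c,
    q ζ = q ζ' ↔ ∃ n : ℤ, ζ' = ζ + ((2 * n * α : ℝ) : ℂ) * Complex.I ∨
      ζ' = (starRingEnd ℂ) ζ + ((2 * n * α : ℝ) : ℂ) * Complex.I) ∧
  ∀ ζ ∈ leftHalf c, (∀ n : ℤ, ζ.im ≠ n * α) → A.PolarFlatAt q ζ

/-- A cone chart or a wedge chart at `x`. -/
def IsPolarChart (x : X) (c : ℝ) (q : ℂ → X) : Prop :=
  (∃ θ, A.IsConeChart x θ c q) ∨ (∃ α, A.IsWedgeChart x α c q)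

/-- A regular (nonsingular) interior point: the cone angle is `2π`. -/
def IsFlatPoint (x : X) : Prop := ∃ c q, A.IsConeChart x (2 * Real.pi) c q

/-- Near `z`, the map `p` is an isometric parametrization of a neighbourhood of a regular
interior point. -/
def FlatAt (p : ℂ → X) (z : ℂ) : Prop :=
  ∃ c q, ∃ g : PlaneIso, g 0 = z ∧ A.IsConeChart (p z) (2 * Real.pi) c q ∧
    ∀ ζ ∈ leftHalf c, p (g (Complex.exp ζ)) = q ζ

/-- Near `z`, the map `p` folds the plane, along a line through `z`, onto a neighbourhood of a
regular boundary point (wedge angle `π`). -/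
def FoldAt (p : ℂ → X) (z : ℂ) : Prop :=
  ∃ c q, ∃ g : PlaneIso, g 0 = z ∧ A.IsWedgeChart (p z) Real.pi c q ∧
    ∀ ζ ∈ leftHalf c, p (g (Complex.exp ζ)) = q ζ

end FlatAtlas

/-! ### Polygons and polygonal surfaces -/

/-- The corners on a side: the end points of a segment or a ray. -/
def sideEnds (s : Set ℂ) : Set ℂ := s.extremePoints ℝ

/-- A compact or noncompact polygon `Ω` with its sides: a closed planar region whose boundary is
the union of a locally finite family of segments, rays or lines, two of which meet in end points
only. -/
structure IsPolygon (Ω : Set ℂ) (sides : Set (Set ℂ)) : Prop where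
  closed : IsClosed Ω
  region : Ω = closure (interior Ω)
  connected : IsConnected (interior Ω)
  side : ∀ s ∈ sides, IsClosed s ∧ Convex ℝ s ∧ Collinear ℝ s ∧ s.Nontrivial
  boundary : frontier Ω = ⋃₀ sides
  meet : ∀ s ∈ sides, ∀ t ∈ sides, s ≠ t → s ∩ t ⊆ sideEnds s ∩ sideEnds t
  locallyFinite : ∀ a : ℝ, {s ∈ sides | (s ∩ Metric.closedBall 0 a).Nonempty}.Finite

/-- `f` is the defining mapping of a flat surface `X` assembled from the polygons `Ω i`: the
surface has the quotient topology of the disjoint union, fibres are finite, interiors of polygons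
are embedded isometrically, and all other identifications are those of full sides by isometries,
and of corners with corners. Sides that are not identified form the boundary. -/
structure IsDefiningMap {X : Type u} [TopologicalSpace X] (A : FlatAtlas X) {ι : Type}
    (Ω : ι → Set ℂ) (sides : ι → Set (Set ℂ)) (f : ι → ℂ → X) : Prop where
  polygon : ∀ i, IsPolygon (Ω i) (sides i)
  quotient : IsQuotientMap (fun v : (Σ i, Ω i) => f v.1 v.2)
  finite_fibre : ∀ x, {v : (Σ i, Ω i) | f v.1 v.2 = x}.Finite
  flat : ∀ i, ∀ z ∈ interior (Ω i), A.FlatAt (f i) z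
  interior_inj : ∀ i j, ∀ z ∈ interior (Ω i), ∀ w ∈ Ω j, f i z = f j w →
    (⟨i, z⟩ : Σ _ : ι, ℂ) = ⟨j, w⟩
  corner : ∀ i j, ∀ s ∈ sides i, ∀ z ∈ sideEnds s, ∀ w ∈ Ω j, f i z = f j w →
    ∃ t ∈ sides j, w ∈ sideEnds t
  glue : ∀ i j, ∀ s ∈ sides i, ∀ t ∈ sides j, ∀ z ∈ s \ sideEnds s, ∀ w ∈ t \ sideEnds t,
    f i z = f j w → ∃ g : PlaneIso, g z = w ∧ g '' s = t ∧ ∀ z' ∈ s, f i z' = f j (g z')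

/-- A (connected, oriented, compact or noncompact) polygonal surface: a Hausdorff surface with a
flat structure whose singularities are cone points and (on the boundary) wedge points, assembled
from an at most countable family of polygons. -/
structure PolygonalSurface where
  carrier : Type u
  [top : TopologicalSpace carrier]
  [t2 : T2Space carrier]
  [connected : ConnectedSpace carrier]
  atlas : FlatAtlas carrier
  polar : ∀ x, ∃ c q, atlas.IsPolarChart x c q
  assembled : ∃ (ι : Type) (_ : Countable ι) (Ω : ι → Set ℂ) (sides : ι → Set (Set ℂ))
    (f : ι → ℂ → carrier), IsDefiningMap atlas Ω sides f

namespace PolygonalSurface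

instance : CoeSort PolygonalSurface.{u} (Type u) := ⟨PolygonalSurface.carrier⟩

instance (P : PolygonalSurface.{u}) : TopologicalSpace P := P.top

instance (P : PolygonalSurface.{u}) : T2Space P := P.t2

instance (P : PolygonalSurface.{u}) : ConnectedSpace P := P.connected

/-! ### Holonomy -/

/-- A flat disc: an isometric map of a disc of the plane into the surface that avoids the singular
points. As for orbifolds with mirrors, it may fold along the boundary of the surface. -/
structure FlatDisc (P : PolygonalSurface.{u}) where
  center : ℂ
  radius : ℝ
  radius_pos : 0 < radius
  map : ℂ → P
  regular : ∀ z ∈ Metric.ball center radius, P.atlas.FlatAt map z ∨ P.atlas.FoldAt map z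

variable {P : PolygonalSurface.{u}}

/-- The domain of a flat disc. -/
def FlatDisc.ball (D : P.FlatDisc) : Set ℂ := Metric.ball D.center D.radius

/-- `h` is the change of coordinates from `D` to `E` near some point which both discs cover.
(At a mirror point there are two such `h`: they differ by the reflection.) -/
def FlatDisc.Adj (D E : P.FlatDisc) (h : PlaneIso) : Prop :=
  ∃ z ∈ D.ball, h z ∈ E.ball ∧ ∀ᶠ w in 𝓝 z, D.map w = E.map (h w)

theorem FlatDisc.Adj.symm {D E : P.FlatDisc} {h : PlaneIso} (H : D.Adj E h) : E.Adj D h⁻¹ := by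
  obtain ⟨z, hz, hz', hev⟩ := H
  have hs : ∀ w, h⁻¹ (h w) = w := fun w => h.symm_apply_apply w
  have hs' : ∀ w, h (h⁻¹ w) = w := fun w => h.apply_symm_apply w
  refine ⟨h z, hz', by rwa [hs], ?_⟩
  have ht : Tendsto (fun w => h⁻¹ w) (𝓝 (h z)) (𝓝 z) := by
    have := (h⁻¹).continuous.tendsto (h z)
    rwa [hs] at this
  filter_upwards [ht.eventually hev] with w hw
  rw [hw, hs']

/-- Developing along a chain of flat discs from `D` to `E`, each overlapping the next one, changes
the coordinate by `g`. A regular path is covered by such a chain. -/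
inductive FlatDisc.Develops (D : P.FlatDisc) : P.FlatDisc → PlaneIso → Prop
  | refl : Develops D D 1
  | step {E F : P.FlatDisc} {g h : PlaneIso} :
      Develops D E g → E.Adj F h → Develops D F (h * g)

theorem FlatDisc.Develops.trans {D E F : P.FlatDisc} {g h : PlaneIso}
    (H : D.Develops E g) (K : E.Develops F h) : D.Develops F (h * g) := by
  induction K with
  | refl => simpa using H
  | step _ hadj ih => rw [mul_assoc]; exact ih.step hadj

theorem FlatDisc.Develops.symm {D E : P.FlatDisc} {g : PlaneIso}
    (H : D.Develops E g) : E.Develops D g⁻¹ := by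
  induction H with
  | refl => simpa using (FlatDisc.Develops.refl (D := D))
  | step _ hadj ih =>
    rw [mul_inv_rev]
    have h1 := (FlatDisc.Develops.refl).step hadj.symm
    rw [mul_one] at h1
    exact h1.trans ih

/-- The holonomy group based at the disc `D`: all developments along loops. Another base disc
gives a conjugate subgroup. -/
def FlatDisc.hol (D : P.FlatDisc) : Subgroup PlaneIso where
  carrier := {g | D.Develops D g}
  mul_mem' ha hb := hb.trans ha
  one_mem' := .refl
  inv_mem' h := h.symm

/-- The rotational holonomy: the group of linear parts of the holonomy. -/
noncomputable def FlatDisc.rotHol (D : P.FlatDisc) : Subgroup PlaneRot := D.hol.map linearPart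

/-- The rotational holonomy is finite. -/
def IsRational (P : PolygonalSurface.{u}) : Prop := ∀ D : P.FlatDisc, Finite D.rotHol

/-- The rotational holonomy is trivial. -/
def IsTranslation (P : PolygonalSurface.{u}) : Prop := ∀ D : P.FlatDisc, D.rotHol = ⊥

/-! ### Coverings -/

variable {R S : PolygonalSurface.{u}}

/-- A (branched) covering of polygonal surfaces: a continuous surjection such that every point `y`
of the target has a polar disc whose preimage is the disjoint union of polar discs about the points
of the fibre, on each of which the mapping is the identity in suitable polar coordinates. So cones
cover cones, possibly with branching, and wedges are covered by wedges or by cones, as in the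
doubling of a surface with boundary. -/
def IsCovering (φ : R → S) : Prop :=
  Continuous φ ∧ Function.Surjective φ ∧
  ∀ y : S, ∃ (c : ℝ) (Q : ℂ → S) (q : R → ℂ → R) (t : R → ℝ),
    S.atlas.IsPolarChart y c Q ∧
    (∀ x ∈ φ ⁻¹' {y}, R.atlas.IsPolarChart x c (q x) ∧
      ∀ ζ ∈ leftHalf c, φ (q x ζ) = Q (ζ + (t x : ℂ) * Complex.I)) ∧
    (φ ⁻¹' {y}).PairwiseDisjoint (fun x => polarDisc x c (q x)) ∧
    φ ⁻¹' (polarDisc y c Q) = ⋃ x ∈ φ ⁻¹' {y}, polarDisc x c (q x)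

/-- A covering is tame if the rotational holonomy of `R` has finite index in that of `S`, computed
with a base disc of `R` and its image in `S`. (`relIndex` is `0` for an infinite index.) -/
def IsTameCovering (φ : R → S) : Prop :=
  IsCovering φ ∧ ∀ (D : R.FlatDisc) (E : S.FlatDisc), D.center = E.center →
    D.radius = E.radius → (∀ z ∈ D.ball, φ (D.map z) = E.map z) →
    D.rotHol.relIndex E.rotHol ≠ 0

/-- The covering `φ` has degree `n`: it has `n` sheets over every regular interior point that
is not covered by singular points. -/
def HasDegree (φ : R → S) (n : ℕ) : Prop :=
  ∀ y : S, S.atlas.IsFlatPoint y → (∀ x, φ x = y → R.atlas.IsFlatPoint x) →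
    (φ ⁻¹' {y}).encard = n

/-- `φ : S → P` is a minimal tame covering of `P` by a translation surface: every tame covering of
`P` by a translation surface factors through it by a tame covering. -/
def IsMinimalTranslationCovering (φ : S → P) : Prop :=
  S.IsTranslation ∧ IsTameCovering φ ∧
  ∀ (R' : PolygonalSurface.{u}) (φ' : R' → P), R'.IsTranslation → IsTameCovering φ' →
    ∃ ψ : R' → S, IsTameCovering ψ ∧ ∀ x, φ' x = φ (ψ x)

/-- An isomorphism (isometry) of polygonal surfaces. -/
def IsIsomorphism (h : R ≃ₜ S) : Prop := IsCovering (h : R → S) ∧ IsCovering (h.symm : S → R)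

end PolygonalSurface

/-!
Let `D₀` be a base disc of `P`. The minimal covering consists of the points of `P` together with a
*direction parallel to* `D₀`. To make this work at the singular points as well, directions are
replaced by frames: polar charts up to a rotation or reflection of the polar angle (`IsFrame`). All
frames at a point differ by a lift of a linear isometry to the logarithmic coordinates
`ζ = log r + i t` (`IsFrame.unique`). A frame is aligned if the flat coordinates near its points
arise from `D₀` by developing without rotation (`Aligned`); two aligned frames at a point differ by
an element of the rotational holonomy. The points of the covering `TransCover D₀` are the aligned
frames up to full turns, `t ↦ t + 2πn`.

An aligned frame `F` spreads parallel frames over its disc, and so defines polar coordinates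
`F.lift` on the covering. Two of their values agree iff the points differ by full turns that are
symmetries of the frame. Since the rotational holonomy is finite, the rotation by the cone angle has
finite order, and `F.lift` is a cone chart of angle `2πk` with `k > 0` (`exists_isConeChart`). Thus
wedges are unfolded, and all changes of flat coordinates are translations. The covering is connected
because aligned frames arise from `D₀` by developing along paths.

To see that the covering is a polygonal surface, cover it by a locally finite family of squares in
the quadrants of its cones (`exists_isPatchwork`). All of them have horizontal and vertical sides, so
that the lines traced by their boundaries divide each square into finitely many rectangles. Keeping
in each square the rectangles outside the previous squares gives a tiling (`IsPatchwork.isTiling`);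
its rectangles are polygons whose sides are the boundary segments between neighbouring vertices
(`IsTiling.isDefiningMap`).

The rotational holonomy of `P` acts transitively on the fibres of `proj`, and freely on those over
regular points. This gives the covering property and the degree (`isCovering_proj`,
`hasDegree_proj`). The rotational holonomy of the covering is trivial, since flat discs have a
direction that does not change along developments (`isTranslation_surface`). All coverings of
surfaces with finite rotational holonomy are tame.

Let `φ : R → P` be a covering by a translation surface. The frames of `R` that are aligned with a
base disc of `R` are unique up to full turns, and `φ` maps them to frames of `P`, which are aligned
for a suitable base disc (`IsCovering.exists_base`). So `x ↦` (image of the aligned frame at `x`)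
factors `φ` through `TransCover D₀` (`exists_covering_factor`). This proves minimality. Two minimal
coverings factor through each other; the composition is a surjection of `TransCover D₀` over `P`,
which permutes the finite fibres. Hence the factors are bijective coverings, and these are
isomorphisms (`IsCovering.isIsomorphism`).
-/

/-! ### Isometries of the plane and their lifts to logarithmic coordinates -/

theorem PlaneIso.apply_add (g : PlaneIso) (z w : ℂ) : g (z + w) = g z + linearPart g w := by
  have := g.map_vadd z w
  simp only [vadd_eq_add] at this
  rw [add_comm z w, this, add_comm]; rfl

/-- The isometry `z ↦ ℓ z + v`. -/
noncomputable def planeMap (ℓ : PlaneRot) (v : ℂ) : PlaneIso :=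
  AffineIsometryEquiv.constVAdd ℝ ℂ v * ℓ.toAffineIsometryEquiv

@[simp] theorem planeMap_apply (ℓ : PlaneRot) (v z : ℂ) : planeMap ℓ v z = ℓ z + v := by
  change v +ᵥ ℓ z = _
  rw [vadd_eq_add, add_comm]

@[simp] theorem linearPart_planeMap (ℓ : PlaneRot) (v : ℂ) : linearPart (planeMap ℓ v) = ℓ := by
  ext w
  have := PlaneIso.apply_add (planeMap ℓ v) 0 w
  simp only [planeMap_apply, zero_add, map_zero] at this
  linear_combination -this

theorem PlaneIso.mul_apply (g h : PlaneIso) (z : ℂ) : (g * h) z = g (h z) := rfl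

theorem PlaneIso.inv_apply_self (g : PlaneIso) (z : ℂ) : g⁻¹ (g z) = z := g.symm_apply_apply z

theorem PlaneIso.apply_inv_self (g : PlaneIso) (z : ℂ) : g (g⁻¹ z) = z := g.apply_symm_apply z

theorem PlaneRot.mul_apply (g h : PlaneRot) (z : ℂ) : (g * h) z = g (h z) := rfl

theorem PlaneRot.inv_apply_self (g : PlaneRot) (z : ℂ) : g⁻¹ (g z) = z := g.symm_apply_apply z

theorem PlaneIso.ext_of_linearPart {g h : PlaneIso} (z : ℂ) (hz : g z = h z)
    (hl : linearPart g = linearPart h) : g = h := by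
  ext w
  have h1 := g.apply_add z (w - z)
  have h2 := h.apply_add z (w - z)
  rw [add_sub_cancel] at h1 h2
  rw [h1, h2, hz, hl]

theorem PlaneRot.eq_of_eventuallyEq {ℓ m : PlaneRot} (h : ∀ᶠ u in 𝓝 (0 : ℂ), ℓ u = m u) :
    ℓ = m := by
  obtain ⟨r, hr, hb⟩ := Metric.eventually_nhds_iff_ball.1 h
  ext w
  rcases eq_or_ne w 0 with rfl | hw
  · simp
  have hn : 0 < ‖w‖ := norm_pos_iff.2 hw
  have := hb ((r / 2 / ‖w‖ : ℝ) • w) (by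
    rw [mem_ball_zero_iff, norm_smul, Real.norm_of_nonneg (by positivity)]
    field_simp; linarith)
  rw [map_smul, map_smul] at this
  exact smul_right_injective ℂ (r := (r / 2 / ‖w‖ : ℝ)) (by positivity) this

theorem PlaneIso.eq_of_eventuallyEq {g h : PlaneIso} {z : ℂ} (H : ∀ᶠ w in 𝓝 z, g w = h w) :
    g = h := by
  refine PlaneIso.ext_of_linearPart z H.self_of_nhds (PlaneRot.eq_of_eventuallyEq ?_)
  have ht : Tendsto (fun u : ℂ => z + u) (𝓝 0) (𝓝 z) := by
    have : Continuous (fun u : ℂ => z + u) := by fun_prop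
    simpa using this.tendsto 0
  filter_upwards [ht.eventually H] with u hu
  rw [g.apply_add, h.apply_add, H.self_of_nhds] at hu
  exact add_left_cancel hu

/-- `T` describes the linear isometry `ℓ` in logarithmic coordinates. -/
def IsLift (T : PlaneIso) (ℓ : PlaneRot) : Prop := ∀ ζ, Complex.exp (T ζ) = ℓ (Complex.exp ζ)

/-- The lift `ζ ↦ ζ + i t` of the rotation by `t`. -/
noncomputable def shiftMap (t : ℝ) : PlaneIso := planeMap 1 (t * Complex.I)

/-- The lift `ζ ↦ conj ζ + i t` of a reflection. -/
noncomputable def flipMap (t : ℝ) : PlaneIso := planeMap Complex.conjLIE (t * Complex.I)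

@[simp] theorem shiftMap_apply (t : ℝ) (ζ : ℂ) : shiftMap t ζ = ζ + t * Complex.I := by
  simp [shiftMap]

@[simp] theorem flipMap_apply (t : ℝ) (ζ : ℂ) :
    flipMap t ζ = (starRingEnd ℂ) ζ + t * Complex.I := by
  simp [flipMap]

namespace IsLift

variable {T T' : PlaneIso} {ℓ ℓ' : PlaneRot}

theorem one : IsLift 1 1 := fun _ => rfl

theorem mul (h : IsLift T ℓ) (h' : IsLift T' ℓ') : IsLift (T * T') (ℓ * ℓ') := fun ζ => by
  rw [PlaneIso.mul_apply, h, h', PlaneRot.mul_apply]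

theorem inv (h : IsLift T ℓ) : IsLift T⁻¹ ℓ⁻¹ := fun ζ => by
  have := h (T⁻¹ ζ)
  rw [PlaneIso.apply_inv_self] at this
  rw [this, PlaneRot.inv_apply_self]

theorem re (h : IsLift T ℓ) (ζ : ℂ) : (T ζ).re = ζ.re := by
  have := congrArg norm (h ζ)
  rw [LinearIsometryEquiv.norm_map, Complex.norm_exp, Complex.norm_exp] at this
  exact Real.exp_injective this

theorem mem (h : IsLift T ℓ) {c : ℝ} {ζ : ℂ} : T ζ ∈ leftHalf c ↔ ζ ∈ leftHalf c := by
  simp [leftHalf, h.re]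

end IsLift

theorem isLift_shiftMap (t : ℝ) : IsLift (shiftMap t) (rotation (Circle.exp t)) := fun ζ => by
  rw [shiftMap_apply, Complex.exp_add, rotation_apply, Circle.coe_exp, mul_comm]

theorem isLift_flipMap (t : ℝ) :
    IsLift (flipMap t) (Complex.conjLIE.trans (rotation (Circle.exp t))) := fun ζ => by
  rw [flipMap_apply, Complex.exp_add, LinearIsometryEquiv.trans_apply, rotation_apply,
    Circle.coe_exp, mul_comm, Complex.exp_conj, Complex.conjLIE_apply]

theorem isLift_shiftMap_int (n : ℤ) : IsLift (shiftMap (2 * Real.pi * n)) 1 := fun ζ => by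
  rw [shiftMap_apply]
  refine Complex.exp_eq_exp_iff_exists_int.2 ⟨n, ?_⟩
  push_cast; ring

theorem exists_shift_or_flip (ℓ : PlaneRot) :
    ∃ t, IsLift (shiftMap t) ℓ ∨ IsLift (flipMap t) ℓ := by
  obtain ⟨a, ha⟩ := linear_isometry_complex ℓ
  obtain ⟨t, rfl⟩ := Circle.exp_surjective a
  refine ⟨t, ?_⟩
  rcases ha with rfl | rfl
  · exact Or.inl (isLift_shiftMap t)
  · exact Or.inr (isLift_flipMap t)

/-- Each linear isometry of the plane lifts to logarithmic coordinates. -/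
theorem exists_lift (ℓ : PlaneRot) : ∃ T, IsLift T ℓ := by
  obtain ⟨t, h | h⟩ := exists_shift_or_flip ℓ
  exacts [⟨_, h⟩, ⟨_, h⟩]

/-- The lift can be chosen with a prescribed value over a given point. -/
theorem exists_lift_of_exp_eq {ℓ : PlaneRot} {ζ ζ' : ℂ}
    (h : Complex.exp ζ' = ℓ (Complex.exp ζ)) : ∃ T, IsLift T ℓ ∧ T ζ = ζ' := by
  obtain ⟨T, hT⟩ := exists_lift ℓ
  rw [← hT] at h
  obtain ⟨n, hn⟩ := Complex.exp_eq_exp_iff_exists_int.1 h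
  refine ⟨shiftMap (2 * Real.pi * n) * T, by simpa using (isLift_shiftMap_int n).mul hT, ?_⟩
  rw [PlaneIso.mul_apply, shiftMap_apply, hn]
  push_cast; ring

/-- The fibres of the passage to logarithmic coordinates. -/
theorem IsLift.eq_shiftMap {T : PlaneIso} (h : IsLift T 1) :
    ∃ n : ℤ, T = shiftMap (2 * Real.pi * n) := by
  -- The difference `T ζ - ζ` is continuous with values in the discrete group `2πiℤ`; since `T` is
  -- affine it is enough to bound it near one point.
  obtain ⟨n, hn⟩ := Complex.exp_eq_exp_iff_exists_int.1 (h 0)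
  refine ⟨n, PlaneIso.eq_of_eventuallyEq (z := 0) ?_⟩
  have hc : ContinuousAt (fun ζ => ‖T ζ - ζ - (T 0 - 0)‖) 0 := by
    have := T.continuous
    fun_prop
  have hlt : ∀ᶠ ζ in 𝓝 (0 : ℂ), ‖T ζ - ζ - (T 0 - 0)‖ < 1 := by
    refine hc.eventually_lt continuousAt_const ?_
    simp
  filter_upwards [hlt] with ζ hζ
  obtain ⟨m, hm⟩ := Complex.exp_eq_exp_iff_exists_int.1 (h ζ)
  have hnm : m = n := by
    rw [hm, hn] at hζ
    have h2 : (ζ + ↑m * (2 * ↑Real.pi * Complex.I) - ζ - (0 + ↑n * (2 * ↑Real.pi * Complex.I) - 0))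
        = ((m - n : ℤ) : ℂ) * (2 * ↑Real.pi * Complex.I) := by push_cast; ring
    rw [h2, norm_mul] at hζ
    have h3 : ‖(2 * (Real.pi : ℂ) * Complex.I)‖ = 2 * Real.pi := by
      simp [abs_of_pos Real.pi_pos]
    rw [h3, Complex.norm_intCast] at hζ
    by_contra hne
    have h4 : (1 : ℝ) ≤ |((m - n : ℤ) : ℝ)| := by
      exact_mod_cast Int.one_le_abs (sub_ne_zero.2 hne)
    nlinarith [Real.pi_gt_three]
  rw [hm, hnm, shiftMap_apply]
  push_cast; ring

theorem IsLift.shift_or_flip {T : PlaneIso} {ℓ : PlaneRot} (h : IsLift T ℓ) :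
    ∃ t, T = shiftMap t ∨ T = flipMap t := by
  obtain ⟨t, ht | ht⟩ := exists_shift_or_flip ℓ
  · obtain ⟨n, hn⟩ := IsLift.eq_shiftMap (by simpa using h.mul ht.inv)
    refine ⟨2 * Real.pi * n + t, Or.inl ?_⟩
    rw [← inv_mul_cancel_right T (shiftMap t), mul_assoc, ]
    ext ζ
    rw [← mul_assoc, hn]
    simp [PlaneIso.mul_apply]; ring
  · obtain ⟨n, hn⟩ := IsLift.eq_shiftMap (by simpa using h.mul ht.inv)
    refine ⟨2 * Real.pi * n + t, Or.inr ?_⟩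
    rw [← inv_mul_cancel_right T (flipMap t)]
    ext ζ
    rw [hn]
    simp [PlaneIso.mul_apply]; ring

/-! ### Local logarithms -/

/-- The local inverse of `exp` near `ζ`, in the coordinate `u = exp - exp ζ`. -/
noncomputable def lg (ζ u : ℂ) : ℂ := ζ + Complex.log (1 + u * Complex.exp (-ζ))

@[simp] theorem lg_zero (ζ : ℂ) : lg ζ 0 = ζ := by simp [lg]

theorem one_add_mul_exp_neg (ζ u : ℂ) :
    1 + u * Complex.exp (-ζ) = (Complex.exp ζ + u) * Complex.exp (-ζ) := by
  rw [add_mul, ← Complex.exp_add]; simp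

theorem exp_lg {ζ u : ℂ} (h : Complex.exp ζ + u ≠ 0) :
    Complex.exp (lg ζ u) = Complex.exp ζ + u := by
  rw [lg, Complex.exp_add, one_add_mul_exp_neg,
    Complex.exp_log (mul_ne_zero h (Complex.exp_ne_zero _)), mul_comm, mul_assoc,
    ← Complex.exp_add]
  simp

theorem lg_exp_sub {ζ ω : ℂ} (h : |(ω - ζ).im| < Real.pi) :
    lg ζ (Complex.exp ω - Complex.exp ζ) = ω := by
  have h1 : 1 + (Complex.exp ω - Complex.exp ζ) * Complex.exp (-ζ) = Complex.exp (ω - ζ) := by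
    rw [one_add_mul_exp_neg, add_sub_cancel, ← Complex.exp_add, sub_eq_add_neg]
  rw [lg, h1, Complex.log_exp (abs_lt.1 h).1 (abs_lt.1 h).2.le]
  ring

theorem eventually_ne_neg_exp (ζ : ℂ) : ∀ᶠ u in 𝓝 (0 : ℂ), Complex.exp ζ + u ≠ 0 := by
  have : ContinuousAt (fun u : ℂ => Complex.exp ζ + u) 0 := by fun_prop
  exact this.eventually_ne (by simp)

theorem lg_mem_slit {ζ u : ℂ} (h : ‖u‖ < ‖Complex.exp ζ‖) :
    1 + u * Complex.exp (-ζ) ∈ Complex.slitPlane := by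
  apply Complex.mem_slitPlane_of_norm_lt_one
  rw [norm_mul, Complex.exp_neg, norm_inv, ← div_eq_mul_inv, div_lt_one]
  · exact h
  · exact norm_pos_iff.2 (Complex.exp_ne_zero _)

theorem continuousAt_lg {ζ u : ℂ} (h : 1 + u * Complex.exp (-ζ) ∈ Complex.slitPlane) :
    ContinuousAt (lg ζ) u := by
  unfold lg
  refine continuousAt_const.add (ContinuousAt.clog ?_ h)
  fun_prop

theorem tendsto_lg (ζ : ℂ) : Tendsto (lg ζ) (𝓝 0) (𝓝 ζ) := by
  have := continuousAt_lg (ζ := ζ) (u := 0) (by simp)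
  rwa [ContinuousAt, lg_zero] at this

theorem tendsto_exp_sub (ζ : ℂ) :
    Tendsto (fun ω => Complex.exp ω - Complex.exp ζ) (𝓝 ζ) (𝓝 0) := by
  have : Continuous (fun ω => Complex.exp ω - Complex.exp ζ) := by fun_prop
  simpa using this.tendsto ζ

theorem eventually_lg_exp_sub (ζ : ℂ) :
    ∀ᶠ ω in 𝓝 ζ, lg ζ (Complex.exp ω - Complex.exp ζ) = ω := by
  have : ContinuousAt (fun ω : ℂ => |(ω - ζ).im|) ζ := by fun_prop
  filter_upwards [this.eventually_lt continuousAt_const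
    (show |(ζ - ζ).im| < Real.pi by simp [Real.pi_pos])] with ω hω
  exact lg_exp_sub hω

/-- A property of the points near `ζ` can be tested in the coordinate `u = exp - exp ζ`. -/
theorem eventually_lg_iff {ζ : ℂ} {p : ℂ → Prop} :
    (∀ᶠ u in 𝓝 (0 : ℂ), p (lg ζ u)) ↔ ∀ᶠ ω in 𝓝 ζ, p ω := by
  refine ⟨fun h => ?_, fun h => (tendsto_lg ζ).eventually h⟩
  filter_upwards [(tendsto_exp_sub ζ).eventually h, eventually_lg_exp_sub ζ] with ω h1 h2
  rwa [h2] at h1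

theorem lg_add {ζ u : ℂ} (h : 1 + u * Complex.exp (-ζ) ∈ Complex.slitPlane) :
    ∀ᶠ v in 𝓝 (0 : ℂ), lg ζ (u + v) = lg (lg ζ u) v := by
  have h0 : Complex.exp ζ + u ≠ 0 := by
    intro h0
    rw [one_add_mul_exp_neg, h0, zero_mul] at h
    exact Complex.slitPlane_ne_zero h rfl
  have hc : ContinuousAt (fun v : ℂ => |(lg (lg ζ u) v - ζ).im|) 0 := by
    have := continuousAt_lg (ζ := lg ζ u) (u := 0) (by simp)
    exact (Complex.continuous_im.continuousAt.comp (this.sub continuousAt_const)).abs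
  have hlt : |(lg (lg ζ u) 0 - ζ).im| < Real.pi := by
    rw [lg_zero, lg, add_sub_cancel_left, Complex.log_im]
    rcases (Complex.mem_slitPlane_iff_arg.1 h) with ⟨h1, -⟩
    rw [abs_lt]
    exact ⟨Complex.neg_pi_lt_arg _, lt_of_le_of_ne (Complex.arg_le_pi _) h1⟩
  filter_upwards [hc.eventually_lt continuousAt_const hlt, eventually_ne_neg_exp (lg ζ u)]
    with v hv hne
  have := lg_exp_sub hv
  rw [exp_lg hne, exp_lg h0] at this
  rw [← this]
  congr 1; ring

theorem lg_shift (n : ℤ) (ζ u : ℂ) :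
    lg (shiftMap (2 * Real.pi * n) ζ) u = shiftMap (2 * Real.pi * n) (lg ζ u) := by
  have h : Complex.exp (-shiftMap (2 * Real.pi * n) ζ) = Complex.exp (-ζ) := by
    rw [Complex.exp_neg, isLift_shiftMap_int n ζ, Complex.exp_neg]; rfl
  rw [lg, h, lg, shiftMap_apply, shiftMap_apply]; ring

/-- Lifts act on local logarithms. -/
theorem IsLift.lg {T : PlaneIso} {ℓ : PlaneRot} (h : IsLift T ℓ) (ζ : ℂ) :
    ∀ᶠ u in 𝓝 (0 : ℂ), T (lg ζ u) = lg (T ζ) (ℓ u) := by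
  have ht : Tendsto (fun u => T (_root_.lg ζ u) - T ζ) (𝓝 0) (𝓝 0) := by
    have := ((T.continuous.tendsto ζ).comp (tendsto_lg ζ)).sub_const (T ζ)
    simpa using this
  have hc : ∀ᶠ u in 𝓝 (0 : ℂ), |(T (_root_.lg ζ u) - T ζ).im| < Real.pi := by
    have h1 : ContinuousAt (fun w : ℂ => |w.im|) 0 := by fun_prop
    exact ht.eventually (h1.eventually_lt continuousAt_const (by simp [Real.pi_pos]))
  filter_upwards [hc, eventually_ne_neg_exp ζ] with u hu hne
  have := lg_exp_sub hu
  rw [h, h, exp_lg hne, map_add, add_sub_cancel_left] at this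
  exact this.symm

/-! ### A monodromy principle -/

/-- Local data that propagate to neighbouring points, and that agree everywhere on `s` once they
agree somewhere on `s`, can be chosen constant on a preconnected set. -/
theorem IsPreconnected.forall_of_local {X : Type*} [TopologicalSpace X] {s : Set X}
    (hs : IsPreconnected s) {ι : Type*} {ρ : X → ι → Prop} (hne : ∀ x ∈ s, ∃ i, ρ x i)
    (hopen : ∀ x ∈ s, ∀ i, ρ x i → ∀ᶠ y in 𝓝[s] x, ρ y i)
    (huniq : ∀ x ∈ s, ∀ y ∈ s, ∀ i j, ρ x i → ρ x j → ρ y i → ρ y j)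
    {x : X} (hx : x ∈ s) {i : ι} (hi : ρ x i) : ∀ y ∈ s, ρ y i := by
  intro y hy
  have key := hs.induction₂ (fun x y => ∀ i, ρ x i ↔ ρ y i) (fun x hx => by
    obtain ⟨j, hj⟩ := hne x hx
    filter_upwards [hopen x hx j hj, self_mem_nhdsWithin] with y hy hys i
    exact ⟨fun h => huniq x hx y hys j i hj h hy, fun h => huniq y hys x hx j i hy h hj⟩)
    (fun x y z _ _ _ h h' i => (h i).trans (h' i)) (fun x y _ _ h i => (h i).symm) hx hy
  exact (key i).1 hi

/-! ### Frames: polar charts up to rotation -/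

theorem isOpen_leftHalf (c : ℝ) : IsOpen (leftHalf c) :=
  isOpen_lt Complex.continuous_re continuous_const

theorem leftHalf_mem_nhds {c : ℝ} {ζ : ℂ} (h : ζ ∈ leftHalf c) : leftHalf c ∈ 𝓝 ζ :=
  (isOpen_leftHalf c).mem_nhds h

theorem leftHalf_mono {a c : ℝ} (h : a ≤ c) : leftHalf a ⊆ leftHalf c := fun _ hζ =>
  lt_of_lt_of_le hζ h

theorem convex_leftHalf (c : ℝ) : Convex ℝ (leftHalf c) :=
  (convex_Iio c).linear_preimage Complex.reLm

theorem isPreconnected_leftHalf (c : ℝ) : IsPreconnected (leftHalf c) :=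
  (convex_leftHalf c).isPreconnected

theorem IsLift.image_leftHalf {T : PlaneIso} {ℓ : PlaneRot} (h : IsLift T ℓ) (c : ℝ) :
    T '' leftHalf c = leftHalf c := by
  ext ζ
  refine ⟨?_, fun hζ => ⟨T⁻¹ ζ, h.inv.mem.2 hζ, T.apply_inv_self ζ⟩⟩
  rintro ⟨ω, hω, rfl⟩
  exact h.mem.2 hω

/-- The map `q`, given in logarithmic coordinates, read in the flat coordinate `u = exp - exp ζ`
near `ζ`. -/
noncomputable def germ {X : Type*} (q : ℂ → X) (ζ u : ℂ) : X := q (lg ζ u)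

@[simp] theorem germ_zero {X : Type*} (q : ℂ → X) (ζ : ℂ) : germ q ζ 0 = q ζ := by simp [germ]

theorem germ_add {X : Type*} (q : ℂ → X) {ζ u : ℂ} (h : 1 + u * Complex.exp (-ζ) ∈ Complex.slitPlane) :
    ∀ᶠ v in 𝓝 (0 : ℂ), germ q ζ (u + v) = germ q (lg ζ u) v := by
  filter_upwards [lg_add h] with v hv
  rw [germ, hv, germ]

theorem germ_comp_lift {X : Type*} (q : ℂ → X) {T : PlaneIso} {ℓ : PlaneRot} (h : IsLift T ℓ)
    (ζ : ℂ) : ∀ᶠ u in 𝓝 (0 : ℂ), germ (fun ω => q (T ω)) ζ u = germ q (T ζ) (ℓ u) := by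
  filter_upwards [h.lg ζ] with u hu
  rw [germ, hu, germ]

theorem germ_congr {X : Type*} {q q' : ℂ → X} {ζ : ℂ} (h : ∀ᶠ ω in 𝓝 ζ, q ω = q' ω) :
    ∀ᶠ u in 𝓝 (0 : ℂ), germ q ζ u = germ q' ζ u :=
  (tendsto_lg ζ).eventually h

theorem germ_congr_iff {X : Type*} {q q' : ℂ → X} {ζ : ℂ} :
    (∀ᶠ u in 𝓝 (0 : ℂ), germ q ζ u = germ q' ζ u) ↔ ∀ᶠ ω in 𝓝 ζ, q ω = q' ω :=
  eventually_lg_iff (p := fun ω => q ω = q' ω)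

theorem PlaneRot.tendsto_zero (ℓ : PlaneRot) : Tendsto ℓ (𝓝 0) (𝓝 0) := by
  simpa using ℓ.continuous.tendsto 0

namespace FlatAtlas

variable {X : Type u}

theorem polarDisc_comp_lift {T : PlaneIso} {ℓ : PlaneRot} (h : IsLift T ℓ) (x : X) (c : ℝ)
    (q : ℂ → X) : polarDisc x c (fun ζ => q (T ζ)) = polarDisc x c q := by
  rw [polarDisc, polarDisc, show (fun ζ => q (T ζ)) '' leftHalf c = q '' (T '' leftHalf c) by
    rw [image_image], h.image_leftHalf]

theorem polarDisc_congr {x : X} {c : ℝ} {q q' : ℂ → X} (h : ∀ ζ ∈ leftHalf c, q ζ = q' ζ) :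
    polarDisc x c q = polarDisc x c q' := by
  rw [polarDisc, polarDisc, image_congr h]

theorem polarDisc_mono {x : X} {a c : ℝ} {q : ℂ → X} (h : a ≤ c) :
    polarDisc x a q ⊆ polarDisc x c q :=
  insert_subset_insert (image_mono (leftHalf_mono h))

/-- A lift of a linear isometry under which the frame `q` is invariant. -/
def IsSym (c : ℝ) (q : ℂ → X) (T : PlaneIso) : Prop :=
  (∃ ℓ, IsLift T ℓ) ∧ ∀ ζ ∈ leftHalf c, q (T ζ) = q ζ

theorem IsSym.mul {c : ℝ} {q : ℂ → X} {T T' : PlaneIso} (h : IsSym c q T) (h' : IsSym c q T') :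
    IsSym c q (T * T') := by
  obtain ⟨⟨ℓ, hℓ⟩, h2⟩ := h
  obtain ⟨⟨m, hm⟩, h4⟩ := h'
  exact ⟨⟨_, hℓ.mul hm⟩, fun ζ hζ => by
    rw [PlaneIso.mul_apply, h2 _ (hm.mem.2 hζ), h4 ζ hζ]⟩

theorem IsSym.inv {c : ℝ} {q : ℂ → X} {T : PlaneIso} (h : IsSym c q T) : IsSym c q T⁻¹ := by
  obtain ⟨⟨ℓ, hℓ⟩, h2⟩ := h
  exact ⟨⟨_, hℓ.inv⟩, fun ζ hζ => by
    rw [← h2 _ (hℓ.inv.mem.2 hζ), PlaneIso.apply_inv_self]⟩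

variable [TopologicalSpace X] {A : FlatAtlas X} {x : X} {c : ℝ} {q : ℂ → X}

theorem PolarTop.comp_lift {T : PlaneIso} {ℓ : PlaneRot} (h : IsLift T ℓ) (H : PolarTop x c q) :
    PolarTop x c (fun ζ => q (T ζ)) := by
  obtain ⟨h1, h2, h3, h4⟩ := H
  refine ⟨h1.comp T.continuous.continuousOn fun ζ hζ => h.mem.2 hζ, fun U hU hUc => ?_, ?_, ?_⟩
  · rw [show (fun ζ => q (T ζ)) '' U = q '' (T '' U) by rw [image_image]]
    refine h2 _ (T.toHomeomorph.isOpenMap U hU) ?_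
    rintro _ ⟨ζ, hζ, rfl⟩
    exact h.mem.2 (hUc hζ)
  · rw [show (fun ζ => q (T ζ)) '' leftHalf c = q '' (T '' leftHalf c) by rw [image_image],
      h.image_leftHalf]
    exact h3
  · simpa only [polarDisc_comp_lift h] using h4

theorem PolarTop.mono (H : PolarTop x c q) {a : ℝ} (h : a ≤ c) : PolarTop x a q := by
  obtain ⟨h1, h2, h3, h4⟩ := H
  refine ⟨h1.mono (leftHalf_mono h), fun U hU hUa => h2 U hU (hUa.trans (leftHalf_mono h)),
    fun hx => h3 (image_mono (leftHalf_mono h) hx), ?_⟩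
  refine h4.to_hasBasis (fun b hb => ⟨min a b, min_le_left _ _, polarDisc_mono (min_le_right _ _)⟩)
    fun b hb => ⟨b, hb.trans h, Subset.rfl⟩

theorem PolarTop.congr {q' : ℂ → X} (H : PolarTop x c q) (h : ∀ ζ ∈ leftHalf c, q' ζ = q ζ) :
    PolarTop x c q' := by
  obtain ⟨h1, h2, h3, h4⟩ := H
  refine ⟨h1.congr h, fun U hU hUa => ?_, ?_, ?_⟩
  · rw [image_congr fun ζ hζ => h ζ (hUa hζ)]; exact h2 U hU hUa
  · rwa [image_congr h]
  · refine h4.to_hasBasis (fun b hb => ⟨b, hb, ?_⟩) fun b hb => ⟨b, hb, ?_⟩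
    · rw [polarDisc_congr fun ζ hζ => h ζ (leftHalf_mono hb hζ)]
    · rw [polarDisc_congr fun ζ hζ => h ζ (leftHalf_mono hb hζ)]

theorem PolarTop.map_nhds (H : PolarTop x c q) {ζ : ℂ} (hζ : ζ ∈ leftHalf c) :
    map q (𝓝 ζ) = 𝓝 (q ζ) := by
  refine le_antisymm (H.1.continuousAt (leftHalf_mem_nhds hζ)) fun s hs => ?_
  obtain ⟨U, hU, hUo, hζU⟩ := mem_nhds_iff.1 (inter_mem (mem_map.1 hs) (leftHalf_mem_nhds hζ))
  exact mem_of_superset ((H.2.1 U hUo fun z hz => (hU hz).2).mem_nhds ⟨ζ, hζU, rfl⟩)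
    (image_subset_iff.2 fun z hz => (hU hz).1)

theorem PolarTop.continuousAt (H : PolarTop x c q) {ζ : ℂ} (hζ : ζ ∈ leftHalf c) :
    ContinuousAt q ζ := H.1.continuousAt (leftHalf_mem_nhds hζ)

theorem PolarTop.disc_mem (H : PolarTop x c q) {a : ℝ} (h : a ≤ c) : polarDisc x a q ∈ 𝓝 x :=
  H.2.2.2.mem_of_mem h

theorem PolarTop.ne (H : PolarTop x c q) {ζ : ℂ} (hζ : ζ ∈ leftHalf c) : q ζ ≠ x := fun h =>
  H.2.2.1 ⟨ζ, hζ, h⟩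

theorem PolarFlatAt.congr {q' : ℂ → X} {ζ : ℂ} (H : A.PolarFlatAt q ζ)
    (h : ∀ᶠ ω in 𝓝 ζ, q' ω = q ω) : A.PolarFlatAt q' ζ := by
  obtain ⟨e, he, g, hg, hev⟩ := H
  exact ⟨e, he, g, hg, by filter_upwards [hev, h] with ω h1 h2; rw [h2, h1]⟩

theorem PolarFlatAt.comp_lift {T : PlaneIso} {ℓ : PlaneRot} (h : IsLift T ℓ) {ζ : ℂ}
    (H : A.PolarFlatAt q (T ζ)) : A.PolarFlatAt (fun ω => q (T ω)) ζ := by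
  obtain ⟨e, he, g, hg, hev⟩ := H
  have key : ∀ ω, (g * planeMap ℓ 0) (Complex.exp ω) = g (Complex.exp (T ω)) := fun ω => by
    rw [PlaneIso.mul_apply, planeMap_apply, add_zero, h]
  refine ⟨e, he, g * planeMap ℓ 0, by rwa [key], ?_⟩
  filter_upwards [(T.continuous.tendsto ζ).eventually hev] with ω hω
  rw [hω, key]

theorem PolarFlatAt.eventually {ζ : ℂ} (H : A.PolarFlatAt q ζ) :
    ∀ᶠ ω in 𝓝 ζ, A.PolarFlatAt q ω := by
  obtain ⟨e, he, g, hg, hev⟩ := H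
  have hc : ContinuousAt (fun ω => g (Complex.exp ω)) ζ :=
    g.continuous.continuousAt.comp Complex.continuous_exp.continuousAt
  filter_upwards [hev.eventually_nhds, hc.eventually (e.open_target.mem_nhds hg)] with ω h1 h2
  exact ⟨e, he, g, h2, h1⟩

theorem PolarFlatAt.mem_source {ζ : ℂ} (H : A.PolarFlatAt q ζ) : ∃ e ∈ A.charts, q ζ ∈ e.source := by
  obtain ⟨e, he, g, hg, hev⟩ := H
  exact ⟨e, he, by rw [hev.self_of_nhds]; exact e.map_target hg⟩

variable (A) in
/-- A polar chart, up to a rotation of the polar angle: for wedge charts the mirrors are the rays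
with angles in `β + α ℤ`. -/
def IsFrame (x : X) (c : ℝ) (q : ℂ → X) : Prop :=
  PolarTop x c q ∧
  ((∃ θ : ℝ, 0 < θ ∧ (∀ ζ ∈ leftHalf c, ∀ ζ' ∈ leftHalf c,
      q ζ = q ζ' ↔ ∃ n : ℤ, ζ' = shiftMap (n * θ) ζ) ∧
      ∀ ζ ∈ leftHalf c, A.PolarFlatAt q ζ) ∨
   (∃ α β : ℝ, 0 < α ∧ (∀ ζ ∈ leftHalf c, ∀ ζ' ∈ leftHalf c,
      q ζ = q ζ' ↔ ∃ n : ℤ, ζ' = shiftMap (2 * n * α) ζ ∨ ζ' = flipMap (2 * n * α + 2 * β) ζ) ∧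
      ∀ ζ ∈ leftHalf c, (∀ n : ℤ, ζ.im ≠ n * α + β) → A.PolarFlatAt q ζ))

theorem IsConeChart.isFrame {θ : ℝ} (H : A.IsConeChart x θ c q) : A.IsFrame x c q := by
  obtain ⟨h1, h2, h3, h4⟩ := H
  refine ⟨h2, Or.inl ⟨θ, h1, fun ζ hζ ζ' hζ' => ?_, h4⟩⟩
  simp only [h3 ζ hζ ζ' hζ', shiftMap_apply]

theorem IsWedgeChart.isFrame {α : ℝ} (H : A.IsWedgeChart x α c q) : A.IsFrame x c q := by
  obtain ⟨h1, h2, h3, h4⟩ := H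
  refine ⟨h2, Or.inr ⟨α, 0, h1, fun ζ hζ ζ' hζ' => ?_, by simpa using h4⟩⟩
  simp only [h3 ζ hζ ζ' hζ', shiftMap_apply, flipMap_apply, mul_zero, add_zero]

theorem IsPolarChart.isFrame (H : A.IsPolarChart x c q) : A.IsFrame x c q := by
  obtain ⟨θ, h⟩ | ⟨α, h⟩ := H
  exacts [h.isFrame, h.isFrame]

theorem IsFrame.mono (H : A.IsFrame x c q) {a : ℝ} (h : a ≤ c) : A.IsFrame x a q := by
  have hm := leftHalf_mono h
  refine ⟨H.1.mono h, ?_⟩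
  obtain ⟨θ, h1, h2, h3⟩ | ⟨α, β, h1, h2, h3⟩ := H.2
  · exact Or.inl ⟨θ, h1, fun ζ hζ ζ' hζ' => h2 ζ (hm hζ) ζ' (hm hζ'), fun ζ hζ => h3 ζ (hm hζ)⟩
  · exact Or.inr ⟨α, β, h1, fun ζ hζ ζ' hζ' => h2 ζ (hm hζ) ζ' (hm hζ'), fun ζ hζ => h3 ζ (hm hζ)⟩

theorem IsFrame.congr {q' : ℂ → X} (H : A.IsFrame x c q) (h : ∀ ζ ∈ leftHalf c, q' ζ = q ζ) :
    A.IsFrame x c q' := by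
  have hev : ∀ ζ ∈ leftHalf c, ∀ᶠ ω in 𝓝 ζ, q' ω = q ω := fun ζ hζ => by
    filter_upwards [leftHalf_mem_nhds hζ] with ω hω using h ω hω
  refine ⟨H.1.congr h, ?_⟩
  obtain ⟨θ, h1, h2, h3⟩ | ⟨α, β, h1, h2, h3⟩ := H.2
  · refine Or.inl ⟨θ, h1, fun ζ hζ ζ' hζ' => ?_, fun ζ hζ => (h3 ζ hζ).congr (hev ζ hζ)⟩
    rw [h ζ hζ, h ζ' hζ', h2 ζ hζ ζ' hζ']
  · refine Or.inr ⟨α, β, h1, fun ζ hζ ζ' hζ' => ?_, fun ζ hζ hn => (h3 ζ hζ hn).congr (hev ζ hζ)⟩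
    rw [h ζ hζ, h ζ' hζ', h2 ζ hζ ζ' hζ']

/-- Frames, unlike polar charts, may be turned and reflected: the mirrors of a wedge need not
contain the ray of angle `0`. -/
theorem IsFrame.comp_lift (H : A.IsFrame x c q) {T : PlaneIso} {ℓ : PlaneRot} (h : IsLift T ℓ) :
    A.IsFrame x c (fun ζ => q (T ζ)) := by
  refine ⟨H.1.comp_lift h, ?_⟩
  obtain ⟨θ, h1, h2, h3⟩ | ⟨α, β, h1, h2, h3⟩ := H.2
  · refine Or.inl ⟨θ, h1, fun ζ hζ ζ' hζ' => ?_, fun ζ hζ => (h3 _ (h.mem.2 hζ)).comp_lift h⟩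
    rw [h2 _ (h.mem.2 hζ) _ (h.mem.2 hζ')]
    obtain ⟨t, rfl | rfl⟩ := h.shift_or_flip
    · refine exists_congr fun n => ?_
      simp only [shiftMap_apply]
      constructor <;> intro h <;> linear_combination h
    · refine (Equiv.neg ℤ).exists_congr fun n => ?_
      simp only [shiftMap_apply, flipMap_apply, Equiv.neg_apply]
      rw [← (starRingEnd ℂ).injective.eq_iff (a := ζ')]
      simp only [map_add, map_mul, Complex.conj_I, Complex.conj_ofReal]
      push_cast
      constructor <;> intro h <;> linear_combination h
  · obtain ⟨t, rfl | rfl⟩ := h.shift_or_flip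
    · refine Or.inr ⟨α, β - t, h1, fun ζ hζ ζ' hζ' => ?_, fun ζ hζ hn => ?_⟩
      · rw [h2 _ (h.mem.2 hζ) _ (h.mem.2 hζ')]
        refine exists_congr fun n => or_congr ?_ ?_
        · simp only [shiftMap_apply]
          constructor <;> intro h <;> linear_combination h
        · simp only [shiftMap_apply, flipMap_apply, map_add, map_mul, Complex.conj_I,
            Complex.conj_ofReal]
          push_cast
          constructor <;> intro h <;> linear_combination h
      · refine (h3 _ (h.mem.2 hζ) fun n hn' => hn n ?_).comp_lift h
        simp at hn'
        linarith
    · refine Or.inr ⟨α, t - β, h1, fun ζ hζ ζ' hζ' => ?_, fun ζ hζ hn => ?_⟩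
      · rw [h2 _ (h.mem.2 hζ) _ (h.mem.2 hζ')]
        refine (Equiv.neg ℤ).exists_congr fun n => or_congr ?_ ?_
        · simp only [shiftMap_apply, flipMap_apply, Equiv.neg_apply]
          rw [← (starRingEnd ℂ).injective.eq_iff (a := ζ')]
          simp only [map_add, map_mul, Complex.conj_I, Complex.conj_ofReal]
          push_cast
          constructor <;> intro h <;> linear_combination h
        · simp only [flipMap_apply, map_add, map_mul, Complex.conj_I,
            Complex.conj_ofReal, Equiv.neg_apply]
          rw [← (starRingEnd ℂ).injective.eq_iff (a := ζ')]
          simp only [map_add, map_mul, Complex.conj_conj, Complex.conj_I, Complex.conj_ofReal]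
          push_cast
          constructor <;> intro h <;> linear_combination h
      · refine (h3 _ (h.mem.2 hζ) fun n hn' => hn (-n) ?_).comp_lift h
        simp at hn' ⊢
        linarith

/-- Two points of the half-plane with the same image differ by a symmetry of the frame: a rotation
or, for wedges, a reflection. -/
theorem IsFrame.exists_sym (H : A.IsFrame x c q) {ζ ζ' : ℂ} (hζ : ζ ∈ leftHalf c)
    (hζ' : ζ' ∈ leftHalf c) (h : q ζ = q ζ') : ∃ T, IsSym c q T ∧ ζ' = T ζ := by
  obtain ⟨-, ⟨θ, h1, h2, h3⟩ | ⟨α, β, h1, h2, h3⟩⟩ := H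
  · obtain ⟨n, rfl⟩ := (h2 ζ hζ ζ' hζ').1 h
    have hl := isLift_shiftMap (n * θ)
    exact ⟨_, ⟨⟨_, hl⟩, fun ω hω => ((h2 ω hω _ (hl.mem.2 hω)).2 ⟨n, rfl⟩).symm⟩, rfl⟩
  · obtain ⟨n, rfl | rfl⟩ := (h2 ζ hζ ζ' hζ').1 h
    · have hl := isLift_shiftMap (2 * n * α)
      exact ⟨_, ⟨⟨_, hl⟩, fun ω hω => ((h2 ω hω _ (hl.mem.2 hω)).2 ⟨n, Or.inl rfl⟩).symm⟩, rfl⟩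
    · have hl := isLift_flipMap (2 * n * α + 2 * β)
      exact ⟨_, ⟨⟨_, hl⟩, fun ω hω => ((h2 ω hω _ (hl.mem.2 hω)).2 ⟨n, Or.inr rfl⟩).symm⟩, rfl⟩

/-- The rotation subgroup of the symmetries of a frame is infinite cyclic. -/
theorem IsFrame.exists_rotation (H : A.IsFrame x c q) : ∃ θ : ℝ, 0 < θ ∧
    (∀ n : ℤ, IsSym c q (shiftMap (n * θ))) ∧
    ∀ t, IsSym c q (shiftMap t) → ∃ n : ℤ, t = n * θ := by
  have hz : ((c - 1 : ℝ) : ℂ) ∈ leftHalf c := by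
    simp [leftHalf]
  obtain ⟨-, ⟨θ, h1, h2, h3⟩ | ⟨α, β, h1, h2, h3⟩⟩ := H
  · refine ⟨θ, h1, fun n => ?_, fun t ht => ?_⟩
    · have hl := isLift_shiftMap (n * θ)
      exact ⟨⟨_, hl⟩, fun ω hω => ((h2 ω hω _ (hl.mem.2 hω)).2 ⟨n, rfl⟩).symm⟩
    · obtain ⟨n, hn⟩ := (h2 _ hz _ ((isLift_shiftMap t).mem.2 hz)).1 (ht.2 _ hz).symm
      refine ⟨n, ?_⟩
      have := congrArg Complex.im hn
      simpa using this
  · refine ⟨2 * α, by positivity, fun n => ?_, fun t ht => ?_⟩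
    · have hl := isLift_shiftMap (n * (2 * α))
      exact ⟨⟨_, hl⟩, fun ω hω => ((h2 ω hω _ (hl.mem.2 hω)).2
        ⟨n, Or.inl (by rw [show (n : ℝ) * (2 * α) = 2 * n * α by ring])⟩).symm⟩
    · -- A generic point excludes the reflections.
      have hw : ∀ s : ℝ, ((c - 1 : ℝ) : ℂ) + s * Complex.I ∈ leftHalf c := fun s => by
        simp [leftHalf]
      by_contra hcon
      have key : ∀ s : ℝ, ∃ n : ℤ, t = 2 * n * α + 2 * β - 2 * s := fun s => by
        obtain ⟨n, hn | hn⟩ := (h2 _ (hw s) _ ((isLift_shiftMap t).mem.2 (hw s))).1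
          (ht.2 _ (hw s)).symm
        · refine absurd ⟨n, ?_⟩ hcon
          have := congrArg Complex.im hn
          simp at this
          linarith
        · refine ⟨n, ?_⟩
          have := congrArg Complex.im hn
          simp at this
          linarith
      obtain ⟨n, hn⟩ := key 0
      obtain ⟨m, hm⟩ := key (α / 2)
      have h5 : (2 * (m - n) : ℝ) * α = 1 * α := by linarith
      have h6 := mul_right_cancel₀ h1.ne' h5
      have h7 : 2 * (m - n) = (1 : ℤ) := by exact_mod_cast h6
      omega

/-- The local structure of a frame: near `ζ` it is either a flat coordinate or, on a mirror, the
folding along the horizontal line through `ζ`. -/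
theorem IsFrame.local_structure (H : A.IsFrame x c q) {ζ : ℂ} (hζ : ζ ∈ leftHalf c) :
    ∃ δ > 0, δ < Real.pi ∧ Metric.ball ζ δ ⊆ leftHalf c ∧
      ((A.PolarFlatAt q ζ ∧ InjOn q (Metric.ball ζ δ)) ∨
      (IsSym c q (flipMap (2 * ζ.im)) ∧
        (∀ ω ∈ Metric.ball ζ δ, ω.im ≠ ζ.im → A.PolarFlatAt q ω) ∧
        ∀ ω ∈ Metric.ball ζ δ, ∀ ω' ∈ Metric.ball ζ δ, q ω = q ω' →
          ω' = ω ∨ ω' = flipMap (2 * ζ.im) ω)) := by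
  obtain ⟨δ₀, hδ₀, hb⟩ := Metric.isOpen_iff.1 (isOpen_leftHalf c) ζ hζ
  have himd : ∀ {δ : ℝ} {ω : ℂ}, ω ∈ Metric.ball ζ δ → |ω.im - ζ.im| < δ := fun {δ ω} h => by
    rw [← Complex.sub_im]
    exact (Complex.abs_im_le_norm _).trans_lt (by simpa [dist_eq_norm] using h)
  have hpi := Real.pi_pos
  -- on a disc of radius `θ / 2` a cone chart is injective
  obtain ⟨-, ⟨θ, h1, h2, h3⟩ | ⟨α, β, h1, h2, h3⟩⟩ := H
  · refine ⟨min (min δ₀ (θ / 2)) (Real.pi / 2), by positivity,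
      (min_le_right _ _).trans_lt (by linarith),
      (Metric.ball_subset_ball ((min_le_left _ _).trans (min_le_left _ _))).trans hb, Or.inl
      ⟨h3 ζ hζ, fun ω hω ω' hω' h => ?_⟩⟩
    have hsub : Metric.ball ζ (min (min δ₀ (θ / 2)) (Real.pi / 2)) ⊆ Metric.ball ζ (θ / 2) :=
      Metric.ball_subset_ball ((min_le_left _ _).trans (min_le_right _ _))
    have hsub' : Metric.ball ζ (min (min δ₀ (θ / 2)) (Real.pi / 2)) ⊆ leftHalf c :=
      (Metric.ball_subset_ball ((min_le_left _ _).trans (min_le_left _ _))).trans hb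
    obtain ⟨n, rfl⟩ := (h2 ω (hsub' hω) ω' (hsub' hω')).1 h
    have i1 := abs_lt.1 (himd (hsub hω))
    have i2 := abs_lt.1 (himd (hsub hω'))
    simp at i2
    have hn1 : (n : ℝ) < 1 := by
      by_contra hcon; push Not at hcon
      nlinarith
    have hn2 : (-1 : ℝ) < n := by
      by_contra hcon; push Not at hcon
      nlinarith
    have : n = 0 := by
      have a : n < 1 := by exact_mod_cast hn1
      have b : -1 < n := by exact_mod_cast hn2
      omega
    simp [this]
  -- the last mirror ray below or through `ζ`
  · set k : ℤ := ⌊(ζ.im - β) / α⌋ with hk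
    have hk1 : k * α + β ≤ ζ.im := by
      have := Int.floor_le ((ζ.im - β) / α)
      rw [le_div_iff₀ h1] at this; linarith
    have hk2 : ζ.im < (k + 1) * α + β := by
      have := Int.lt_floor_add_one ((ζ.im - β) / α)
      rw [div_lt_iff₀ h1] at this; linarith
    have hshift : ∀ {δ : ℝ} {n : ℤ} {ω : ℂ}, δ ≤ α → ω ∈ Metric.ball ζ δ →
        shiftMap (2 * n * α) ω ∈ Metric.ball ζ δ → n = 0 := fun {δ n ω} hδ hω hω' => by
      have i1 := abs_lt.1 (himd hω)
      have i2 := abs_lt.1 (himd hω')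
      simp at i2
      have hn1 : (n : ℝ) < 1 := by
        by_contra hcon; push Not at hcon
        nlinarith
      have hn2 : (-1 : ℝ) < n := by
        by_contra hcon; push Not at hcon
        nlinarith
      have a : n < 1 := by exact_mod_cast hn1
      have b : -1 < n := by exact_mod_cast hn2
      omega
    rcases hk1.eq_or_lt with he | hlt
    · -- the mirror case
      have hdiv : ∀ n : ℤ, |(n : ℝ) - k| < 1 → n = k := fun n hn => by
        have a := abs_lt.1 hn
        have b1 : n - k < 1 := by exact_mod_cast a.2
        have b2 : -1 < n - k := by exact_mod_cast a.1
        omega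
      have hl := isLift_flipMap (2 * ζ.im)
      refine ⟨min (min δ₀ (α / 2)) (Real.pi / 2), by positivity,
        (min_le_right _ _).trans_lt (by linarith),
        (Metric.ball_subset_ball ((min_le_left _ _).trans (min_le_left _ _))).trans hb, Or.inr
        ⟨⟨⟨_, hl⟩, fun ω hω => ((h2 ω hω _ (hl.mem.2 hω)).2 ⟨k, Or.inr ?_⟩).symm⟩, ?_, ?_⟩⟩
      · rw [← he]; congr 2; ring
      · intro ω hω hne
        have i1 := himd (Metric.ball_subset_ball ((min_le_left _ _).trans (min_le_right _ _)) hω)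
        refine h3 ω (hb (Metric.ball_subset_ball ((min_le_left _ _).trans (min_le_left _ _)) hω))
          fun n hn => ?_
        have : n = k := hdiv n (by
          rw [hn, ← he] at i1
          have h9 : (n * α + β - (k * α + β)) = (n - k) * α := by ring
          rw [h9, abs_mul, abs_of_pos h1] at i1
          by_contra hcon; push Not at hcon
          nlinarith)
        exact hne (by rw [hn, this, he])
      · intro ω hω ω' hω' h
        have hsub : Metric.ball ζ (min (min δ₀ (α / 2)) (Real.pi / 2)) ⊆ Metric.ball ζ (α / 2) :=
          Metric.ball_subset_ball ((min_le_left _ _).trans (min_le_right _ _))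
        have hsub' : Metric.ball ζ (min (min δ₀ (α / 2)) (Real.pi / 2)) ⊆ leftHalf c :=
          (Metric.ball_subset_ball ((min_le_left _ _).trans (min_le_left _ _))).trans hb
        obtain ⟨n, hn | hn⟩ := (h2 ω (hsub' hω) ω' (hsub' hω')).1 h
        · left
          have := hshift (n := n) (by linarith) (hsub hω) (hn ▸ hsub hω')
          rw [hn, this]; simp
        · right
          have i1 := abs_lt.1 (himd (hsub hω))
          have i2 := abs_lt.1 (himd (hsub hω'))
          rw [hn] at i2
          simp at i2
          have : n = k := hdiv n (by
            rw [abs_lt]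
            constructor <;> by_contra hcon <;> push Not at hcon <;> nlinarith)
          rw [hn, this, ← he]; congr 2; ring
    -- between two mirror rays a disc that meets neither of them is embedded
    · have hreg : ∀ n : ℤ, ζ.im ≠ n * α + β := fun n hn => by
        rw [hn] at hlt hk2
        have a1 : (k : ℝ) < n := by
          by_contra hcon; push Not at hcon
          nlinarith
        have a2 : (n : ℝ) < k + 1 := by
          by_contra hcon; push Not at hcon
          nlinarith
        have b1 : k < n := by exact_mod_cast a1
        have b2 : n < k + 1 := by exact_mod_cast a2
        omega
      set δ := min (min δ₀ (α / 2)) (min (Real.pi / 2) (min (ζ.im - (k * α + β)) ((k + 1) * α + β - ζ.im)))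
        with hδ
      have d1 : δ ≤ δ₀ := (min_le_left _ _).trans (min_le_left _ _)
      have d2 : δ ≤ α / 2 := (min_le_left _ _).trans (min_le_right _ _)
      have d3 : δ ≤ Real.pi / 2 := (min_le_right _ _).trans (min_le_left _ _)
      have d4 : δ ≤ ζ.im - (k * α + β) :=
        (min_le_right _ _).trans ((min_le_right _ _).trans (min_le_left _ _))
      have d5 : δ ≤ (k + 1) * α + β - ζ.im :=
        (min_le_right _ _).trans ((min_le_right _ _).trans (min_le_right _ _))
      have d0 : 0 < δ := by
        refine lt_min (lt_min hδ₀ (by positivity)) (lt_min (by positivity) (lt_min ?_ ?_)) <;>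
          linarith
      refine ⟨δ, d0, by linarith, (Metric.ball_subset_ball d1).trans hb, Or.inl
        ⟨h3 ζ hζ hreg, fun ω hω ω' hω' h => ?_⟩⟩
      obtain ⟨n, hn | hn⟩ := (h2 ω (hb (Metric.ball_subset_ball d1 hω)) ω'
        (hb (Metric.ball_subset_ball d1 hω'))).1 h
      · have := hshift (n := n) (by linarith) hω (hn ▸ hω')
        rw [hn, this]; simp
      · exfalso
        have i1 := abs_lt.1 (himd hω)
        have i2 := abs_lt.1 (himd hω')
        rw [hn] at i2
        simp at i2
        have a1 : (k : ℝ) < n := by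
          by_contra hcon; push Not at hcon
          nlinarith
        have a2 : (n : ℝ) < k + 1 := by
          by_contra hcon; push Not at hcon
          nlinarith
        have b1 : k < n := by exact_mod_cast a1
        have b2 : n < k + 1 := by exact_mod_cast a2
        omega

end FlatAtlas

/-! ### Frames centred at regular points -/

namespace FlatAtlas

theorem mem_leftHalf_log_iff {r : ℝ} (hr : 0 < r) {ω : ℂ} :
    ω ∈ leftHalf (Real.log r) ↔ Complex.exp ω ∈ Metric.ball (0 : ℂ) r := by
  rw [mem_ball_zero_iff, Complex.norm_exp, ← Real.lt_log_iff_exp_lt hr]; rfl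

theorem image_exp_leftHalf (a : ℝ) :
    insert 0 (Complex.exp '' leftHalf a) = Metric.ball (0 : ℂ) (Real.exp a) := by
  ext u
  rcases eq_or_ne u 0 with rfl | hu
  · simp [Real.exp_pos]
  rw [mem_insert_iff, or_iff_right hu]
  constructor
  · rintro ⟨ω, hω, rfl⟩
    rwa [← mem_leftHalf_log_iff (Real.exp_pos a), Real.log_exp]
  · intro h
    refine ⟨Complex.log u, ?_, Complex.exp_log hu⟩
    rw [← Real.log_exp a, mem_leftHalf_log_iff (Real.exp_pos a), Complex.exp_log hu]
    exact h

theorem polarDisc_germ {X : Type u} (p : ℂ → X) (a : ℝ) :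
    polarDisc (p 0) a (fun ω => p (Complex.exp ω)) = p '' Metric.ball 0 (Real.exp a) := by
  rw [← image_exp_leftHalf, image_insert_eq, image_image, polarDisc]

variable {X : Type u} [TopologicalSpace X] {A : FlatAtlas X} {x : X} {c : ℝ} {q : ℂ → X}

/-! ### Recentring frames -/

theorem IsConeChart.mono {θ : ℝ} (H : A.IsConeChart x θ c q) {a : ℝ} (h : a ≤ c) :
    A.IsConeChart x θ a q := by
  have hm := leftHalf_mono h
  obtain ⟨h1, h2, h3, h4⟩ := H
  exact ⟨h1, h2.mono h, fun ζ hζ ζ' hζ' => h3 ζ (hm hζ) ζ' (hm hζ'), fun ζ hζ => h4 ζ (hm hζ)⟩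

theorem IsWedgeChart.mono {α : ℝ} (H : A.IsWedgeChart x α c q) {a : ℝ} (h : a ≤ c) :
    A.IsWedgeChart x α a q := by
  have hm := leftHalf_mono h
  obtain ⟨h1, h2, h3, h4⟩ := H
  exact ⟨h1, h2.mono h, fun ζ hζ ζ' hζ' => h3 ζ (hm hζ) ζ' (hm hζ'), fun ζ hζ => h4 ζ (hm hζ)⟩

variable (A) in
/-- Near `z`, the map `p` is a flat coordinate or a folding along the boundary. -/
def RegAt (p : ℂ → X) (z : ℂ) : Prop := A.FlatAt p z ∨ A.FoldAt p z

theorem RegAt.congr {p p' : ℂ → X} {z z' : ℂ} (H : A.RegAt p z)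
    (h : ∀ᶠ v in 𝓝 (0 : ℂ), p' (z' + v) = p (z + v)) : A.RegAt p' z' := by
  obtain ⟨r, hr, hb⟩ := Metric.eventually_nhds_iff_ball.1 h
  have h0 : p' z' = p z := by simpa using h.self_of_nhds
  have key : ∀ g : PlaneIso, g 0 = z → ∀ ζ ∈ leftHalf (Real.log r),
      p' (planeMap (linearPart g) z' (Complex.exp ζ)) = p (g (Complex.exp ζ)) := by
    intro g hg ζ hζ
    have h1 := g.apply_add 0 (Complex.exp ζ)
    rw [zero_add, hg] at h1
    rw [planeMap_apply, add_comm, h1]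
    refine hb _ ?_
    rw [mem_ball_zero_iff, LinearIsometryEquiv.norm_map, Complex.norm_exp, ← Real.lt_log_iff_exp_lt hr]
    exact hζ
  obtain ⟨c, q, g, hg, hc, hq⟩ | ⟨c, q, g, hg, hc, hq⟩ := H
  · refine Or.inl ⟨min c (Real.log r), q, planeMap (linearPart g) z', by simp,
      h0 ▸ hc.mono (min_le_left _ _), fun ζ hζ => ?_⟩
    rw [key g hg ζ (leftHalf_mono (min_le_right _ _) hζ), hq ζ (leftHalf_mono (min_le_left _ _) hζ)]
  · refine Or.inr ⟨min c (Real.log r), q, planeMap (linearPart g) z', by simp,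
      h0 ▸ hc.mono (min_le_left _ _), fun ζ hζ => ?_⟩
    rw [key g hg ζ (leftHalf_mono (min_le_right _ _) hζ), hq ζ (leftHalf_mono (min_le_left _ _) hζ)]

theorem RegAt.comp {p : ℂ → X} {z : ℂ} (h : PlaneIso) (H : A.RegAt p (h z)) :
    A.RegAt (fun w => p (h w)) z := by
  have key : ∀ g : PlaneIso, g 0 = h z → (h⁻¹ * g) 0 = z := fun g hg => by
    rw [PlaneIso.mul_apply, hg, PlaneIso.inv_apply_self]
  obtain ⟨c, q, g, hg, hc, hq⟩ | ⟨c, q, g, hg, hc, hq⟩ := H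
  · refine Or.inl ⟨c, q, h⁻¹ * g, key g hg, hc, fun ζ hζ => ?_⟩
    simp only [PlaneIso.mul_apply, PlaneIso.apply_inv_self, hq ζ hζ]
  · refine Or.inr ⟨c, q, h⁻¹ * g, key g hg, hc, fun ζ hζ => ?_⟩
    simp only [PlaneIso.mul_apply, PlaneIso.apply_inv_self, hq ζ hζ]

theorem RegAt.isFrame {p : ℂ → X} {z : ℂ} (H : A.RegAt p z) :
    ∃ b, A.IsFrame (p z) b (fun ω => p (z + Complex.exp ω)) := by
  have key : ∀ (g : PlaneIso) (T : PlaneIso), g 0 = z → IsLift T (linearPart g) → ∀ ζ,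
      z + Complex.exp ζ = g (Complex.exp (T⁻¹ ζ)) := fun g T hg hT ζ => by
    have h1 := g.apply_add 0 (Complex.exp (T⁻¹ ζ))
    rw [zero_add, hg, ← hT, PlaneIso.apply_inv_self] at h1
    exact h1.symm
  obtain ⟨c, q, g, hg, hc, hq⟩ | ⟨c, q, g, hg, hc, hq⟩ := H
  all_goals
    obtain ⟨T, hT⟩ := exists_lift (linearPart g)
    refine ⟨c, (hc.isFrame.comp_lift hT.inv).congr fun ζ hζ => ?_⟩
    rw [key g T hg hT, hq _ (hT.inv.mem.2 hζ)]

theorem image_lg_eq {ζ : ℂ} {V : Set ℂ} (h : ∀ v ∈ V, ‖v‖ < ‖Complex.exp ζ‖) :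
    lg ζ '' V = {ω | |(ω - ζ).im| < Real.pi ∧ Complex.exp ω - Complex.exp ζ ∈ V} := by
  ext ω
  constructor
  · rintro ⟨v, hv, rfl⟩
    have hs := lg_mem_slit (h v hv)
    refine ⟨?_, ?_⟩
    · rw [lg, add_sub_cancel_left, Complex.log_im, abs_lt]
      exact ⟨Complex.neg_pi_lt_arg _, lt_of_le_of_ne (Complex.arg_le_pi _)
        (Complex.mem_slitPlane_iff_arg.1 hs).1⟩
    · rw [exp_lg, add_sub_cancel_left]
      · exact hv
      · intro h0
        have := h v hv
        rw [← norm_neg v, ← eq_neg_of_add_eq_zero_left h0] at this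
        exact this.false
  · rintro ⟨h1, h2⟩
    exact ⟨_, h2, lg_exp_sub h1⟩

theorem isOpen_image_lg {ζ : ℂ} {V : Set ℂ} (hV : IsOpen V) (h : ∀ v ∈ V, ‖v‖ < ‖Complex.exp ζ‖) :
    IsOpen (lg ζ '' V) := by
  rw [image_lg_eq h]
  exact IsOpen.inter (isOpen_lt (Complex.continuous_im.comp (continuous_id.sub
    continuous_const)).abs continuous_const)
    (hV.preimage (Complex.continuous_exp.sub continuous_const))

theorem map_lg_nhds (ζ : ℂ) : map (lg ζ) (𝓝 0) = 𝓝 ζ := by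
  refine le_antisymm (tendsto_lg ζ) fun s hs => ?_
  have := (eventually_lg_iff (p := fun ω => ω ∈ s)).1 hs
  exact this

theorem PolarTop.map_germ (H : PolarTop x c q) {ζ : ℂ} (hζ : ζ ∈ leftHalf c) :
    map (germ q ζ) (𝓝 0) = 𝓝 (q ζ) := by
  rw [← H.map_nhds hζ, ← map_lg_nhds ζ, Filter.map_map]; rfl

theorem hasBasis_ball_exp (c : ℝ) :
    (𝓝 (0 : ℂ)).HasBasis (fun a : ℝ => a ≤ c) (fun a => Metric.ball 0 (Real.exp a)) := by
  refine Metric.nhds_basis_ball.to_hasBasis (fun r hr => ⟨min c (Real.log r), min_le_left _ _, ?_⟩)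
    fun a _ => ⟨Real.exp a, Real.exp_pos a, Subset.rfl⟩
  refine Metric.ball_subset_ball ?_
  calc Real.exp (min c (Real.log r)) ≤ Real.exp (Real.log r) := Real.exp_le_exp.2 (min_le_right _ _)
    _ = r := Real.exp_log hr

/-- Polar coordinates about another point `q ζ` of a frame, in the flat coordinate `u`. -/
theorem PolarTop.recenter (H : PolarTop x c q) {ζ : ℂ} (hζ : ζ ∈ leftHalf c) {r : ℝ} (hr : 0 < r)
    (hr' : r ≤ ‖Complex.exp ζ‖) (hsub : ∀ u ∈ Metric.ball (0 : ℂ) r, lg ζ u ∈ leftHalf c)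
    (hne : ∀ u ∈ Metric.ball (0 : ℂ) r, u ≠ 0 → germ q ζ u ≠ q ζ) :
    PolarTop (q ζ) (Real.log r) (fun ω => germ q ζ (Complex.exp ω)) := by
  have hnorm : ∀ u ∈ Metric.ball (0 : ℂ) r, ‖u‖ < ‖Complex.exp ζ‖ := fun u hu =>
    (mem_ball_zero_iff.1 hu).trans_le hr'
  refine ⟨?_, fun U hU hUr => ?_, ?_, ?_⟩
  · intro ω hω
    have hω' := (mem_leftHalf_log_iff hr).1 hω
    have h1 : ContinuousAt (lg ζ) (Complex.exp ω) := continuousAt_lg (lg_mem_slit (hnorm _ hω'))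
    have h2 : ContinuousAt q (lg ζ (Complex.exp ω)) := H.continuousAt (hsub _ hω')
    exact ((h2.comp h1).comp (f := Complex.exp)
      Complex.continuous_exp.continuousAt).continuousWithinAt
  · have hV : ∀ v ∈ Complex.exp '' U, v ∈ Metric.ball (0 : ℂ) r := by
      rintro _ ⟨ω, hω, rfl⟩
      exact (mem_leftHalf_log_iff hr).1 (hUr hω)
    have : (fun ω => germ q ζ (Complex.exp ω)) '' U = q '' (lg ζ '' (Complex.exp '' U)) := by
      simp only [image_image, germ]
    rw [this]
    refine H.2.1 _ (isOpen_image_lg (Complex.isOpenMap_exp U hU) fun v hv => hnorm v (hV v hv)) ?_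
    rintro _ ⟨v, hv, rfl⟩
    exact hsub v (hV v hv)
  · rintro ⟨ω, hω, h⟩
    exact hne _ ((mem_leftHalf_log_iff hr).1 hω) (Complex.exp_ne_zero _) h
  · rw [← H.map_germ hζ]
    have := (hasBasis_ball_exp (Real.log r)).map (germ q ζ)
    refine this.congr (fun _ => Iff.rfl) fun a _ => ?_
    rw [← polarDisc_germ, germ_zero]

/-- The points near a point of a frame are regular: in the coordinate `u = exp - exp ζ` the frame is
a flat coordinate or the folding along a mirror. -/
theorem IsFrame.regAt (H : A.IsFrame x c q) {ζ : ℂ} (hζ : ζ ∈ leftHalf c) :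
    A.RegAt (germ q ζ) 0 := by
  obtain ⟨δ, hδ, hδpi, hball, hcase⟩ := H.local_structure hζ
  have hl := isLift_flipMap (2 * ζ.im)
  obtain ⟨ℓ, hℓ⟩ : ∃ ℓ, IsLift (flipMap (2 * ζ.im)) ℓ := ⟨_, hl⟩
  have hfix : flipMap (2 * ζ.im) ζ = ζ := by
    apply Complex.ext <;> simp; ring
  have hlg : ∀ᶠ u in 𝓝 (0 : ℂ), lg ζ u ∈ Metric.ball ζ δ :=
    (tendsto_lg ζ).eventually (Metric.ball_mem_nhds ζ hδ)
  have hflat : ∀ᶠ u in 𝓝 (0 : ℂ), A.PolarFlatAt q ζ → A.PolarFlatAt q (lg ζ u) := by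
    by_cases h : A.PolarFlatAt q ζ
    · filter_upwards [(tendsto_lg ζ).eventually h.eventually] with u hu _ using hu
    · simp [h]
  have hslit : ∀ᶠ u in 𝓝 (0 : ℂ), 1 + u * Complex.exp (-ζ) ∈ Complex.slitPlane := by
    have : ContinuousAt (fun u : ℂ => 1 + u * Complex.exp (-ζ)) 0 := by fun_prop
    exact this.eventually (Complex.isOpen_slitPlane.mem_nhds (by simp))
  have hne := eventually_ne_neg_exp ζ
  have hflip := hℓ.lg ζ
  rw [hfix] at hflip
  obtain ⟨r₀, hr₀, hb⟩ := Metric.eventually_nhds_iff_ball.1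
    (hlg.and (hslit.and (hne.and (hflip.and hflat))))
  have hexp : 0 < ‖Complex.exp ζ‖ := norm_pos_iff.2 (Complex.exp_ne_zero ζ)
  set r := min r₀ ‖Complex.exp ζ‖ with hrdef
  have hr : 0 < r := lt_min hr₀ hexp
  have hsub : Metric.ball (0 : ℂ) r ⊆ Metric.ball 0 r₀ := Metric.ball_subset_ball (min_le_left _ _)
  have hlginj : ∀ u ∈ Metric.ball (0 : ℂ) r, ∀ u' ∈ Metric.ball (0 : ℂ) r, lg ζ u = lg ζ u' →
      u = u' := fun u hu u' hu' h => by
    have := congrArg Complex.exp h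
    rwa [exp_lg (hb u (hsub hu)).2.2.1, exp_lg (hb u' (hsub hu')).2.2.1, add_right_inj] at this
  have hℓb : ∀ u ∈ Metric.ball (0 : ℂ) r, ℓ u ∈ Metric.ball (0 : ℂ) r := fun u hu => by
    rwa [mem_ball_zero_iff, LinearIsometryEquiv.norm_map, ← mem_ball_zero_iff]
  have h0 : (0 : ℂ) ∈ Metric.ball (0 : ℂ) r := by simpa using hr
  have hshift : ∀ {ω ω' : ℂ}, Complex.exp ω' = Complex.exp ω ↔
      ∃ n : ℤ, ω' = ω + ((n * (2 * Real.pi) : ℝ) : ℂ) * Complex.I := fun {ω ω'} => by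
    rw [Complex.exp_eq_exp_iff_exists_int]
    refine exists_congr fun n => ?_
    push_cast
    rw [show (n : ℂ) * (2 * Real.pi) * Complex.I = n * (2 * Real.pi * Complex.I) by ring]
  -- at a flat point `u` is an injective coordinate, so that the cone angle is `2π`; at a mirror
  -- `u` and its reflection are identified, which gives a wedge of angle `π`
  rcases hcase with ⟨hpf, hinj⟩ | ⟨hsym, hpf, hinj⟩
  · have hgi : ∀ u ∈ Metric.ball (0 : ℂ) r, ∀ u' ∈ Metric.ball (0 : ℂ) r,
        germ q ζ u = germ q ζ u' → u = u' := fun u hu u' hu' h =>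
      hlginj u hu u' hu' (hinj (hb u (hsub hu)).1 (hb u' (hsub hu')).1 h)
    have htop := H.1.recenter hζ hr (min_le_right _ _) (fun u hu => hball (hb u (hsub hu)).1)
      (fun u hu hu0 h => hu0 (hgi u hu 0 h0 (by rw [h, germ_zero])))
    refine Or.inl ⟨Real.log r, fun ω => germ q ζ (Complex.exp ω), 1, rfl, ?_, fun _ _ => rfl⟩
    rw [germ_zero]
    refine ⟨by positivity, htop, fun ω hω ω' hω' => ?_, fun ω hω => ?_⟩
    · rw [mem_leftHalf_log_iff hr] at hω hω'
      rw [← hshift]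
      exact ⟨fun h => (hgi _ hω _ hω' h).symm, fun h => congrArg (germ q ζ) h.symm⟩
    · rw [mem_leftHalf_log_iff hr] at hω
      obtain ⟨-, hs, hne', -, hp⟩ := hb _ (hsub hω)
      obtain ⟨e, he, g, hg, hev⟩ := hp hpf
      have key : ∀ᶠ u in 𝓝 (Complex.exp ω), Complex.exp (lg ζ u) = Complex.exp ζ + u := by
        have : ContinuousAt (fun u => Complex.exp ζ + u) (Complex.exp ω) := by fun_prop
        filter_upwards [this.eventually_ne hne'] with u hu using exp_lg hu
      refine ⟨e, he, g * planeMap 1 (Complex.exp ζ), ?_, ?_⟩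
      · rw [exp_lg hne'] at hg
        rw [PlaneIso.mul_apply, planeMap_apply, add_comm]
        exact hg
      · filter_upwards [Complex.continuous_exp.continuousAt.eventually key,
          Complex.continuous_exp.continuousAt.eventually ((continuousAt_lg hs).eventually hev)]
          with η h1 h2
        rw [germ, h2, h1, PlaneIso.mul_apply, planeMap_apply, add_comm]; rfl
  · have hgi : ∀ u ∈ Metric.ball (0 : ℂ) r, ∀ u' ∈ Metric.ball (0 : ℂ) r,
        (germ q ζ u = germ q ζ u' ↔ u' = u ∨ u' = ℓ u) := fun u hu u' hu' => by
      constructor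
      · intro h
        rcases hinj _ (hb u (hsub hu)).1 _ (hb u' (hsub hu')).1 h with h1 | h1
        · exact Or.inl (hlginj _ hu' _ hu h1)
        · rw [(hb u (hsub hu)).2.2.2.1] at h1
          exact Or.inr (hlginj _ hu' _ (hℓb _ hu) h1)
      · rintro (rfl | rfl)
        · rfl
        · rw [germ, germ, ← (hb u (hsub hu)).2.2.2.1, hsym.2 _ (hball (hb u (hsub hu)).1)]
    have hgf : ∀ ω ∈ leftHalf (Real.log r), ∀ ω' ∈ leftHalf (Real.log r),
        (germ q ζ (Complex.exp ω) = germ q ζ (Complex.exp ω') ↔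
          ∃ n : ℤ, ω' = ω + ((n * (2 * Real.pi) : ℝ) : ℂ) * Complex.I ∨
            ω' = flipMap (2 * ζ.im) ω + ((n * (2 * Real.pi) : ℝ) : ℂ) * Complex.I) := by
      intro ω hω ω' hω'
      rw [mem_leftHalf_log_iff hr] at hω hω'
      rw [hgi _ hω _ hω', ← hℓ, hshift, hshift, exists_or]
    have htop := H.1.recenter hζ hr (min_le_right _ _) (fun u hu => hball (hb u (hsub hu)).1)
      (fun u hu hu0 h => hu0 (by
        rcases (hgi 0 h0 u hu).1 (by rw [h, germ_zero]) with h1 | h1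
        · exact h1
        · simpa using h1))
    have hrot := isLift_shiftMap ζ.im
    refine Or.inr ⟨Real.log r, fun ω => germ q ζ (Complex.exp (shiftMap ζ.im ω)),
      planeMap (rotation (Circle.exp ζ.im)) 0, by simp, ?_, fun ω _ => ?_⟩
    · rw [germ_zero]
      refine ⟨Real.pi_pos, htop.comp_lift hrot, fun ω hω ω' hω' => ?_, fun ω hω hn => ?_⟩
      · simp only [hgf _ (hrot.mem.2 hω) _ (hrot.mem.2 hω')]
        refine exists_congr fun n => or_congr ?_ ?_
        · simp only [shiftMap_apply]
          push_cast
          constructor <;> intro h <;> linear_combination h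
        · simp only [shiftMap_apply, flipMap_apply, map_add, map_mul, Complex.conj_I,
            Complex.conj_ofReal]
          push_cast
          constructor <;> intro h <;> linear_combination h
      · refine PolarFlatAt.comp_lift (q := fun η => germ q ζ (Complex.exp η)) hrot ?_
        have hω2 := hrot.mem.2 hω
        set η := shiftMap ζ.im ω with hη
        have hω3 := (mem_leftHalf_log_iff hr).1 hω2
        obtain ⟨hin, hs, hne', hfl, -⟩ := hb _ (hsub hω3)
        have him : (lg ζ (Complex.exp η)).im ≠ ζ.im := fun him => by
          have h1 : flipMap (2 * ζ.im) (lg ζ (Complex.exp η)) = lg ζ (Complex.exp η) := by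
            apply Complex.ext <;> simp [him]; ring
          rw [hfl] at h1
          have h2 := hlginj _ (hℓb _ hω3) _ hω3 h1
          rw [← hℓ, hshift] at h2
          obtain ⟨n, hn'⟩ := h2
          apply hn (-n)
          have := congrArg Complex.im hn'
          simp [hη] at this
          push_cast
          linarith
        obtain ⟨e, he, g, hg, hev⟩ := hpf _ hin him
        have key : ∀ᶠ u in 𝓝 (Complex.exp η), Complex.exp (lg ζ u) = Complex.exp ζ + u := by
          have : ContinuousAt (fun u => Complex.exp ζ + u) (Complex.exp η) := by fun_prop
          filter_upwards [this.eventually_ne hne'] with u hu using exp_lg hu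
        refine ⟨e, he, g * planeMap 1 (Complex.exp ζ), ?_, ?_⟩
        · rw [exp_lg hne'] at hg
          rw [PlaneIso.mul_apply, planeMap_apply, add_comm]
          exact hg
        · filter_upwards [Complex.continuous_exp.continuousAt.eventually key,
            Complex.continuous_exp.continuousAt.eventually ((continuousAt_lg hs).eventually hev)]
            with η h1 h2
          rw [germ, h2, h1, PlaneIso.mul_apply, planeMap_apply, add_comm]; rfl
    · simp only [planeMap_apply, add_zero]
      rw [hrot]

/-- A frame induces a frame at each of its other points. -/
theorem IsFrame.recenter (H : A.IsFrame x c q) {ζ : ℂ} (hζ : ζ ∈ leftHalf c) :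
    ∃ b, A.IsFrame (q ζ) b (fun ω => germ q ζ (Complex.exp ω)) := by
  simpa using (H.regAt hζ).isFrame

end FlatAtlas

/-! ### Comparison of frames -/

namespace FlatAtlas

theorem IsSym.germ_eq {X : Type u} {c : ℝ} {q : ℂ → X} {γ : PlaneIso}
    {m : PlaneRot} (h : IsSym c q γ) (hm : IsLift γ m) {ζ : ℂ} (hζ : ζ ∈ leftHalf c) : ∀ᶠ u in 𝓝 (0 : ℂ), germ q (γ ζ) (m u) = germ q ζ u := by
  filter_upwards [germ_comp_lift q hm ζ, (tendsto_lg ζ).eventually (leftHalf_mem_nhds hζ)]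
    with u h1 h2
  rw [← h1, germ, h.2 _ h2, germ]

variable {X : Type u} [TopologicalSpace X] {A : FlatAtlas X} {x : X} {c : ℝ} {q : ℂ → X}

theorem PolarFlatAt.germ_form {ζ : ℂ} (H : A.PolarFlatAt q ζ) :
    ∃ e ∈ A.charts, ∃ g : PlaneIso, g 0 ∈ e.target ∧
      ∀ᶠ u in 𝓝 (0 : ℂ), germ q ζ u = e.symm (g u) := by
  obtain ⟨e, he, g, hg, hev⟩ := H
  refine ⟨e, he, g * planeMap 1 (Complex.exp ζ), ?_, ?_⟩
  · rw [PlaneIso.mul_apply, planeMap_apply, map_zero, zero_add]; exact hg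
  · filter_upwards [(tendsto_lg ζ).eventually hev, eventually_ne_neg_exp ζ] with u h1 h2
    rw [germ, h1, exp_lg h2, PlaneIso.mul_apply, planeMap_apply, add_comm]; rfl

theorem eventually_mem_target {e : OpenPartialHomeomorph X ℂ} {g : PlaneIso} (h : g 0 ∈ e.target) :
    ∀ᶠ u in 𝓝 (0 : ℂ), g u ∈ e.target :=
  g.continuous.continuousAt.eventually (e.open_target.mem_nhds h)

theorem PolarFlatAt.germ_injOn {ζ : ℂ} (H : A.PolarFlatAt q ζ) :
    ∃ r > 0, InjOn (germ q ζ) (Metric.ball 0 r) := by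
  obtain ⟨e, he, g, hg, hev⟩ := H.germ_form
  obtain ⟨r, hr, hb⟩ := Metric.eventually_nhds_iff_ball.1 (hev.and (eventually_mem_target hg))
  refine ⟨r, hr, fun u hu v hv h => ?_⟩
  rw [(hb u hu).1, (hb v hv).1] at h
  exact g.injective (e.symm.injOn (by simpa using (hb u hu).2) (by simpa using (hb v hv).2) h)

theorem PolarFlatAt.eq_of_germ_eq {ζ : ℂ} (H : A.PolarFlatAt q ζ) {ℓ m : PlaneRot}
    (h : ∀ᶠ u in 𝓝 (0 : ℂ), germ q ζ (ℓ u) = germ q ζ (m u)) : ℓ = m := by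
  obtain ⟨r, hr, hinj⟩ := H.germ_injOn
  refine PlaneRot.eq_of_eventuallyEq ?_
  filter_upwards [h, ℓ.tendsto_zero (Metric.ball_mem_nhds 0 hr),
    m.tendsto_zero (Metric.ball_mem_nhds 0 hr)] with u h1 h2 h3
  exact hinj h2 h3 h1

theorem PolarFlatAt.injOn {ζ : ℂ} (H : A.PolarFlatAt q ζ) :
    ∃ s ∈ 𝓝 ζ, InjOn q s := by
  obtain ⟨r, hr, hinj⟩ := H.germ_injOn
  refine ⟨_, inter_mem (tendsto_exp_sub ζ (Metric.ball_mem_nhds 0 hr)) (eventually_lg_exp_sub ζ),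
    fun ω hω ω' hω' h => ?_⟩
  have h1 := hinj hω.1 hω'.1 (by rw [germ, germ, hω.2, hω'.2, h])
  rw [← hω.2, ← hω'.2]
  exact congrArg (lg ζ) h1

theorem exists_planeIso (a b : ℂ) (ha : ‖a‖ = 1) : ∃ g : PlaneIso, ∀ z, g z = a * z + b := by
  refine ⟨planeMap (rotation (Circle.exp a.arg)) b, fun z => ?_⟩
  have h := Complex.norm_mul_exp_arg_mul_I a
  rw [ha, Complex.ofReal_one, one_mul] at h
  rw [planeMap_apply, rotation_apply, Circle.coe_exp, h]

/-- Two flat polar coordinates of the same point differ by a linear isometry, since the transition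
maps of the atlas are isometries. -/
theorem PolarFlatAt.compare {q' : ℂ → X} {ζ ζ' : ℂ} (H : A.PolarFlatAt q ζ)
    (H' : A.PolarFlatAt q' ζ') (h : q ζ = q' ζ') :
    ∃ ℓ : PlaneRot, ∀ᶠ u in 𝓝 (0 : ℂ), germ q' ζ' u = germ q ζ (ℓ u) := by
  obtain ⟨e, he, g, hg, hev⟩ := H.germ_form
  obtain ⟨e', he', g', hg', hev'⟩ := H'.germ_form
  have h1 := hev.self_of_nhds
  have h2 := hev'.self_of_nhds
  rw [germ_zero] at h1 h2
  have hx : q ζ ∈ e.source ∩ e'.source := by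
    refine ⟨by rw [h1]; exact e.map_target hg, by rw [h, h2]; exact e'.map_target hg'⟩
  obtain ⟨a, b, ha, hab⟩ := A.compat e' he' e he (q ζ) ⟨hx.2, hx.1⟩
  obtain ⟨k, hk⟩ := exists_planeIso a b ha
  have hk0 : k (g' 0) = g 0 := by
    have := hab.self_of_nhds
    rw [← hk] at this
    nth_rw 2 [h] at this
    rw [h2, h1, e.right_inv hg, e'.right_inv hg'] at this
    exact this.symm
  have hlin : ∀ u, k (g' u) = g (linearPart (g⁻¹ * k * g') u) := fun u => by
    have h3 : (g⁻¹ * k * g') u = linearPart (g⁻¹ * k * g') u := by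
      have := (g⁻¹ * k * g').apply_add 0 u
      rw [zero_add] at this
      rw [this, show (g⁻¹ * k * g') 0 = g⁻¹ (k (g' 0)) from rfl, hk0, g.inv_apply_self, zero_add]
    rw [← h3]
    exact (g.apply_inv_self _).symm
  refine ⟨linearPart (g⁻¹ * k * g'), ?_⟩
  have hc : Tendsto (fun u => e'.symm (g' u)) (𝓝 0) (𝓝 (q ζ)) := by
    rw [h, h2]
    exact (e'.symm.continuousAt (by simpa using hg')).tendsto.comp (g'.continuous.tendsto 0)
  have htz := (linearPart (g⁻¹ * k * g')).tendsto_zero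
  filter_upwards [hev', htz.eventually hev, eventually_mem_target hg', hc.eventually hab,
    hc.eventually (e.open_source.mem_nhds hx.1)] with u u1 u2 u3 u4 u5
  rw [u1, u2, ← hlin, ← hk, e'.right_inv u3] at *
  rw [← u4, e.left_inv u5]

/-- Mirror points lie in no flat chart. -/
theorem IsFrame.polarFlatAt_of_mem_source (H : A.IsFrame x c q) {ζ : ℂ} (hζ : ζ ∈ leftHalf c)
    {e : OpenPartialHomeomorph X ℂ} (he : e ∈ A.charts) (hx : q ζ ∈ e.source) :
    A.PolarFlatAt q ζ := by
  obtain ⟨δ₀, hδ₀, hδpi, hball, ⟨h, -⟩ | ⟨hsym, hpf, -⟩⟩ := H.local_structure hζ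
  · exact h
  exfalso
  obtain ⟨δ₁, hδ₁, hb⟩ := Metric.mem_nhds_iff.1
    (H.1.continuousAt hζ (e.open_source.mem_nhds hx))
  set δ := min δ₀ δ₁ with hδdef
  have hδ : 0 < δ := lt_min hδ₀ hδ₁
  have hs0 : Metric.ball ζ δ ⊆ Metric.ball ζ δ₀ := Metric.ball_subset_ball (min_le_left _ _)
  have hs1 : Metric.ball ζ δ ⊆ q ⁻¹' e.source :=
    (Metric.ball_subset_ball (min_le_right _ _)).trans hb
  set F : ℂ → ℂ := fun ω => e (q ω) with hF
  have hFc : ∀ ω ∈ Metric.ball ζ δ, ContinuousAt F ω := fun ω hω =>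
    ContinuousAt.comp (e.continuousAt (hs1 hω)) (H.1.continuousAt (hball (hs0 hω)))
  -- On the upper half of a small disc the chart is an isometry in the coordinate `exp`.
  set s := Metric.ball ζ δ ∩ {ω | ζ.im < ω.im} with hs
  have hspre : IsPreconnected s :=
    ((convex_ball ζ δ).inter ((convex_Ioi ζ.im).linear_preimage Complex.imLm)).isPreconnected
  have huniq : ∀ (ω : ℂ) (g h : PlaneIso),
      (∀ᶠ η in 𝓝 ω, g (Complex.exp η) = h (Complex.exp η)) → g = h := fun ω g h hgh => by
    refine PlaneIso.eq_of_eventuallyEq (z := Complex.exp ω) ?_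
    have : 𝓝 (Complex.exp ω) ≤ map Complex.exp (𝓝 ω) := Complex.isOpenMap_exp.nhds_le ω
    exact this hgh
  have hex : ∀ ω ∈ s, ∃ g : PlaneIso, ∀ᶠ η in 𝓝 ω, F η = g (Complex.exp η) := by
    rintro ω ⟨hω, him⟩
    obtain ⟨e', he', g, hg, hev⟩ := hpf ω (hs0 hω) (ne_of_gt him)
    have hqs : q ω ∈ e'.source := by rw [hev.self_of_nhds]; exact e'.map_target hg
    obtain ⟨a, b, ha, hab⟩ := A.compat e' he' e he (q ω) ⟨hqs, hs1 hω⟩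
    obtain ⟨k, hk⟩ := exists_planeIso a b ha
    refine ⟨k * g, ?_⟩
    have hcg : ContinuousAt (fun η => g (Complex.exp η)) ω :=
      g.continuous.continuousAt.comp Complex.continuous_exp.continuousAt
    filter_upwards [hev, (H.1.continuousAt (hball (hs0 hω))).eventually hab,
      hcg.eventually (e'.open_target.mem_nhds hg)] with η h1 h2 h3
    rw [hF, PlaneIso.mul_apply, hk]
    simp only
    rw [h2, h1, e'.right_inv h3]
  have hmid : ζ + ((δ / 2 : ℝ) : ℂ) * Complex.I ∈ s := by
    refine ⟨?_, ?_⟩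
    · rw [mem_ball_iff_norm, add_sub_cancel_left, norm_mul, Complex.norm_I, Complex.norm_real,
        Real.norm_of_nonneg (by positivity)]
      linarith
    · simp [hδ]
  obtain ⟨g, hg⟩ := hex _ hmid
  have hall := hspre.forall_of_local (ρ := fun ω (g : PlaneIso) => ∀ᶠ η in 𝓝 ω, F η = g (Complex.exp η))
    hex (fun ω _ g h => mem_nhdsWithin_of_mem_nhds h.eventually_nhds)
    (fun ω _ ω' _ g h h1 h2 h3 => by
      have : g = h := huniq ω g h (by filter_upwards [h1, h2] with η e1 e2; rw [← e1, e2])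
      rwa [← this]) hmid hg
  have hcl : ∀ ω ∈ Metric.ball ζ δ, ζ.im ≤ ω.im → F ω = g (Complex.exp ω) := by
    intro ω hω him
    have ht : Tendsto (fun t : ℝ => ω + (t : ℂ) * Complex.I) (𝓝[>] 0) (𝓝 ω) := by
      have : Continuous (fun t : ℝ => ω + (t : ℂ) * Complex.I) := by fun_prop
      have := this.tendsto 0
      simp only [Complex.ofReal_zero, zero_mul, add_zero] at this
      exact this.mono_left nhdsWithin_le_nhds
    have hev : ∀ᶠ t : ℝ in 𝓝[>] 0, F (ω + (t : ℂ) * Complex.I) =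
        g (Complex.exp (ω + (t : ℂ) * Complex.I)) := by
      filter_upwards [ht.eventually (Metric.isOpen_ball.mem_nhds hω), self_mem_nhdsWithin]
        with t h1 h2
      refine (hall _ ⟨h1, ?_⟩).self_of_nhds
      have h2' : 0 < t := h2
      simp only [mem_ofPred_eq, Complex.add_im, Complex.mul_im, Complex.ofReal_re, Complex.I_im,
        Complex.ofReal_im, Complex.I_re]
      linarith
    refine tendsto_nhds_unique (((hFc ω hω).tendsto.comp ht).congr' hev) ?_
    exact (g.continuous.continuousAt.comp Complex.continuous_exp.continuousAt).tendsto.comp ht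
  -- The image of the disc is a neighbourhood, so it contains images of points below the mirror.
  have hopen : F '' Metric.ball ζ δ ∈ 𝓝 (F ζ) := by
    have h1 : IsOpen (q '' Metric.ball ζ δ) := H.1.2.1 _ Metric.isOpen_ball (hs0.trans hball)
    have h2 := e.isOpen_image_of_subset_source h1 (image_subset_iff.2 hs1)
    rw [image_image] at h2
    exact h2.mem_nhds ⟨ζ, Metric.mem_ball_self hδ, rfl⟩
  have hζb : ζ ∈ Metric.ball ζ δ := Metric.mem_ball_self hδ
  have ht : Tendsto (fun t : ℝ => g (Complex.exp (ζ - (t : ℂ) * Complex.I))) (𝓝[>] 0) (𝓝 (F ζ)) := by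
    rw [hcl ζ hζb le_rfl]
    have hc : Continuous (fun t : ℝ => g (Complex.exp (ζ - (t : ℂ) * Complex.I))) :=
      g.continuous.comp (by fun_prop)
    have := hc.tendsto 0
    simp only [Complex.ofReal_zero, zero_mul, sub_zero] at this
    exact this.mono_left nhdsWithin_le_nhds
  obtain ⟨t, ⟨ω, hω, hωt⟩, ht0, ht1⟩ := ((ht.eventually hopen).and
    (Ioo_mem_nhdsGT Real.pi_pos)).exists
  obtain ⟨η, hη, hηim, hqη⟩ : ∃ η ∈ Metric.ball ζ δ, ζ.im ≤ η.im ∧ q η = q ω := by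
    rcases le_total ζ.im ω.im with h | h
    · exact ⟨ω, hω, h, rfl⟩
    · refine ⟨flipMap (2 * ζ.im) ω, ?_, ?_, hsym.2 _ (hball (hs0 hω))⟩
      · have hfix : flipMap (2 * ζ.im) ζ = ζ := by
          apply Complex.ext <;> simp; ring
        rw [Metric.mem_ball] at hω ⊢
        nth_rw 2 [← hfix]
        rwa [AffineIsometryEquiv.dist_map]
      · simp; linarith
  -- `exp` maps `ζ - t I` and `η` to the same point, but the imaginary parts differ by a number
  -- between `0` and `2π`
  have h1 : g (Complex.exp (ζ - (t : ℂ) * Complex.I)) = g (Complex.exp η) := by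
    rw [← hcl η hη hηim, ← hωt, hF]; simp only; rw [hqη]
  obtain ⟨n, hn⟩ := Complex.exp_eq_exp_iff_exists_int.1 (g.injective h1)
  have h2 := congrArg Complex.im hn
  simp at h2
  have h3 : |η.im - ζ.im| < Real.pi := by
    rw [← Complex.sub_im]
    refine (Complex.abs_im_le_norm _).trans_lt ?_
    rw [← dist_eq_norm]
    exact (Metric.mem_ball.1 (hs0 hη)).trans hδpi
  have h4 := abs_lt.1 h3
  have n1 : (n : ℝ) < 0 := by
    by_contra hcon; push Not at hcon
    nlinarith
  have n2 : (-1 : ℝ) < n := by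
    by_contra hcon; push Not at hcon
    nlinarith
  have a : n < 0 := by exact_mod_cast n1
  have b : -1 < n := by exact_mod_cast n2
  omega

/-- Each open property at a point of a frame holds at some flat point nearby. -/
theorem IsFrame.exists_regular_near (H : A.IsFrame x c q) {ω : ℂ} (hω : ω ∈ leftHalf c)
    {p : ℂ → Prop} (h : ∀ᶠ η in 𝓝 ω, p η) :
    ∃ η ∈ leftHalf c, A.PolarFlatAt q η ∧ ∀ᶠ ξ in 𝓝 η, p ξ := by
  obtain ⟨δ, hδ, hδpi, hball, ⟨hf, -⟩ | ⟨hsym, hpf, -⟩⟩ := H.local_structure hω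
  · exact ⟨ω, hω, hf, h⟩
  have ht : Tendsto (fun t : ℝ => ω + (t : ℂ) * Complex.I) (𝓝[>] 0) (𝓝 ω) := by
    have : Continuous (fun t : ℝ => ω + (t : ℂ) * Complex.I) := by fun_prop
    have := this.tendsto 0
    simp only [Complex.ofReal_zero, zero_mul, add_zero] at this
    exact this.mono_left nhdsWithin_le_nhds
  obtain ⟨t, ⟨h1, h2⟩, h3⟩ := ((ht.eventually (h.eventually_nhds.and
    (Metric.ball_mem_nhds ω hδ))).and self_mem_nhdsWithin).exists
  have h3' : 0 < t := h3
  exact ⟨_, hball h2, hpf _ h2 (by simp [h3'.ne']), h1⟩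

/-- A lift that preserves the frame locally preserves it globally. -/
theorem IsFrame.isSym_of_eventuallyEq (H : A.IsFrame x c q) {T : PlaneIso} {ℓ : PlaneRot}
    (hT : IsLift T ℓ) {ω : ℂ} (hω : ω ∈ leftHalf c) (h : ∀ᶠ η in 𝓝 ω, q (T η) = q η) :
    IsSym c q T := by
  obtain ⟨η, hη, hflat, hev⟩ := H.exists_regular_near hω h
  obtain ⟨γ, hγ, hTγ⟩ := H.exists_sym hη (hT.mem.2 hη) hev.self_of_nhds.symm
  obtain ⟨s, hs, hinj⟩ := hflat.injOn
  suffices T = γ by rwa [this]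
  have h1 : γ⁻¹ * T = 1 := by
    refine PlaneIso.eq_of_eventuallyEq (z := η) ?_
    have hfix : (γ⁻¹ * T) η = η := by rw [PlaneIso.mul_apply, hTγ, PlaneIso.inv_apply_self]
    have ht : Tendsto (γ⁻¹ * T : PlaneIso) (𝓝 η) (𝓝 η) := by
      have := (γ⁻¹ * T : PlaneIso).continuous.tendsto η
      rwa [hfix] at this
    filter_upwards [ht hs, hs, hev, leftHalf_mem_nhds hη] with ξ h1 h2 h3 h4
    refine hinj h1 h2 ?_
    rw [PlaneIso.mul_apply, hγ.inv.2 _ (hT.mem.2 h4), h3]; rfl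
  exact (inv_mul_eq_one.1 h1).symm

/-- Identity principle: if two turned copies of a frame agree near one point, then they agree. -/
theorem IsFrame.comp_eq (H : A.IsFrame x c q) {T T' : PlaneIso} {ℓ ℓ' : PlaneRot}
    (hT : IsLift T ℓ) (hT' : IsLift T' ℓ') {ω : ℂ} (hω : ω ∈ leftHalf c)
    (h : ∀ᶠ η in 𝓝 ω, q (T η) = q (T' η)) : ∀ ζ ∈ leftHalf c, q (T ζ) = q (T' ζ) := by
  have hs : IsSym c q (T * T'⁻¹) := by
    refine H.isSym_of_eventuallyEq (hT.mul hT'.inv) (hT'.mem.2 hω) ?_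
    have ht : Tendsto (T'⁻¹ : PlaneIso) (𝓝 (T' ω)) (𝓝 ω) := by
      have := (T'⁻¹ : PlaneIso).continuous.tendsto (T' ω)
      rwa [PlaneIso.inv_apply_self] at this
    filter_upwards [ht.eventually h] with η hη
    rw [PlaneIso.mul_apply, hη, PlaneIso.apply_inv_self]
  intro ζ hζ
  have := hs.2 _ (hT'.mem.2 hζ)
  rwa [PlaneIso.mul_apply, PlaneIso.inv_apply_self] at this

end FlatAtlas

namespace FlatAtlas

variable {X : Type u} [TopologicalSpace X] {A : FlatAtlas X} {x : X} {c c' : ℝ} {q q' : ℂ → X}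

/-! ### Uniqueness of frames -/

/-- Local comparison of `q'` near `ζ'` with `q` near `ζ`: the transition is `ℓ` in the coordinates
`u = exp - exp ζ`, `u' = exp - exp ζ'`. -/
structure Compare (A : FlatAtlas X) (c : ℝ) (q q' : ℂ → X) (ζ' ζ : ℂ) (ℓ : PlaneRot) : Prop where
  mem : ζ ∈ leftHalf c
  flat : A.PolarFlatAt q ζ
  germ : ∀ᶠ u in 𝓝 (0 : ℂ), germ q' ζ' u = germ q ζ (ℓ u)

theorem Compare.eq {ζ ζ' : ℂ} {ℓ : PlaneRot} (h : Compare A c q q' ζ' ζ ℓ) : q' ζ' = q ζ := by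
  simpa using h.germ.self_of_nhds

/-- A comparison at one point extends to the points nearby, with the same rotation and the same
offset between the two apices. -/
theorem Compare.eventually {ζ ζ' : ℂ} {ℓ : PlaneRot} (h : Compare A c q q' ζ' ζ ℓ) :
    ∀ᶠ u in 𝓝 (0 : ℂ), Compare A c q q' (lg ζ' u) (lg ζ (ℓ u)) ℓ ∧
      Complex.exp (lg ζ (ℓ u)) - ℓ (Complex.exp (lg ζ' u)) =
        Complex.exp ζ - ℓ (Complex.exp ζ') := by
  have hsl : ∀ ζ : ℂ, ∀ᶠ u in 𝓝 (0 : ℂ), 1 + u * Complex.exp (-ζ) ∈ Complex.slitPlane := fun ζ => by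
    have : ContinuousAt (fun u : ℂ => 1 + u * Complex.exp (-ζ)) 0 := by fun_prop
    exact this.eventually (Complex.isOpen_slitPlane.mem_nhds (by simp))
  have hz := ℓ.tendsto_zero
  filter_upwards [hsl ζ', hz.eventually (hsl ζ),
    hz.eventually ((tendsto_lg ζ).eventually (leftHalf_mem_nhds h.mem)),
    hz.eventually ((tendsto_lg ζ).eventually h.flat.eventually), h.germ.eventually_nhds,
    eventually_ne_neg_exp ζ', hz.eventually (eventually_ne_neg_exp ζ)] with u h1 h2 h3 h4 h5 h6 h7
  refine ⟨⟨h3, h4, ?_⟩, ?_⟩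
  · have ht : Tendsto (fun v => u + v) (𝓝 0) (𝓝 u) := by
      have : Continuous (fun v : ℂ => u + v) := by fun_prop
      simpa using this.tendsto 0
    filter_upwards [germ_add q' h1, hz.eventually (germ_add q h2), ht.eventually h5]
      with v h8 h9 h10
    rw [← h8, ← h9, h10, map_add]
  · rw [exp_lg h6, exp_lg h7, map_add]; ring

/-- The distance of the apices does not depend on the choice of the point over `q' ζ'`. -/
theorem Compare.norm_eq (H : A.IsFrame x c q) {ζ' ζ₁ ζ₂ : ℂ} {ℓ₁ ℓ₂ : PlaneRot}
    (h₁ : Compare A c q q' ζ' ζ₁ ℓ₁) (h₂ : Compare A c q q' ζ' ζ₂ ℓ₂) :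
    ‖Complex.exp ζ₁ - ℓ₁ (Complex.exp ζ')‖ = ‖Complex.exp ζ₂ - ℓ₂ (Complex.exp ζ')‖ := by
  obtain ⟨γ, hγ, rfl⟩ := H.exists_sym h₁.mem h₂.mem (by rw [← h₁.eq, ← h₂.eq])
  obtain ⟨m, hm⟩ := hγ.1
  have : m * ℓ₁ = ℓ₂ := by
    refine h₂.flat.eq_of_germ_eq ?_
    filter_upwards [h₁.germ, h₂.germ, ℓ₁.tendsto_zero.eventually (hγ.germ_eq hm h₁.mem)]
      with u h1 h2 h3
    rw [PlaneRot.mul_apply, h3, ← h1, h2]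
  rw [← this, hm, PlaneRot.mul_apply, ← map_sub, LinearIsometryEquiv.norm_map]

theorem IsFrame.re_eq (H : A.IsFrame x c q) {ζ ζ' : ℂ} (hζ : ζ ∈ leftHalf c)
    (hζ' : ζ' ∈ leftHalf c) (h : q ζ = q ζ') : ζ'.re = ζ.re := by
  obtain ⟨T, ⟨⟨ℓ, hℓ⟩, -⟩, rfl⟩ := H.exists_sym hζ hζ' h
  exact hℓ.re ζ

theorem _root_.IsLift.mul_flipMap {T : PlaneIso} {ℓ : PlaneRot} (h : IsLift T ℓ) (ω ζ : ℂ) :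
    T (flipMap (2 * ω.im) ζ) = flipMap (2 * (T ω).im) (T ζ) := by
  obtain ⟨t, rfl | rfl⟩ := h.shift_or_flip
  · simp; ring
  · simp [Complex.conj_ofNat]; ring

/-- On a mirror a frame is invariant under the reflection. -/
theorem IsFrame.isSym_flip (H : A.IsFrame x c q) {ζ : ℂ} (hζ : ζ ∈ leftHalf c)
    (h : ∀ e ∈ A.charts, q ζ ∉ e.source) : IsSym c q (flipMap (2 * ζ.im)) := by
  obtain ⟨δ, -, -, -, ⟨hf, -⟩ | ⟨hsym, -⟩⟩ := H.local_structure hζ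
  · obtain ⟨e, he, hm⟩ := hf.mem_source
    exact absurd hm (h e he)
  · exact hsym

/-- Conversely a point that lies on the axis of a reflection symmetry is a mirror point. -/
theorem IsFrame.not_mem_source_of_isSym_flip (H : A.IsFrame x c q) {ζ : ℂ} (hζ : ζ ∈ leftHalf c)
    (h : IsSym c q (flipMap (2 * ζ.im))) : ∀ e ∈ A.charts, q ζ ∉ e.source := by
  intro e he hm
  obtain ⟨s, hs, hinj⟩ := (H.polarFlatAt_of_mem_source hζ he hm).injOn
  have hfix : flipMap (2 * ζ.im) ζ = ζ := by
    apply Complex.ext <;> simp; ring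
  have ht : Tendsto (flipMap (2 * ζ.im)) (𝓝 ζ) (𝓝 ζ) := by
    have := (flipMap (2 * ζ.im)).continuous.tendsto ζ
    rwa [hfix] at this
  have h1 : flipMap (2 * ζ.im) = 1 := by
    refine PlaneIso.eq_of_eventuallyEq (z := ζ) ?_
    filter_upwards [hs, ht hs, leftHalf_mem_nhds hζ] with ω h1 h2 h3
    exact hinj h2 h1 (h.2 ω h3)
  have h2 := congrArg (fun T : PlaneIso => (T Complex.I).im - (T 0).im) h1
  simp [flipMap_apply] at h2
  norm_num at h2

/-- A linear isometry that agrees at each small vector with one of two others equals one of them,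
because a vector space is not a union of two proper subspaces. -/
theorem _root_.PlaneRot.eq_or_eq_of_eventually {ℓ m n : PlaneRot}
    (h : ∀ᶠ u in 𝓝 (0 : ℂ), ℓ u = m u ∨ ℓ u = n u) : ℓ = m ∨ ℓ = n := by
  have hall : ∀ w, ℓ w = m w ∨ ℓ w = n w := fun w => by
    have ht : Tendsto (fun t : ℝ => t • w) (𝓝[>] 0) (𝓝 0) := by
      have : Continuous (fun t : ℝ => t • w) := by fun_prop
      have := this.tendsto 0
      rw [zero_smul] at this
      exact this.mono_left nhdsWithin_le_nhds
    obtain ⟨t, h1, h2⟩ := ((ht.eventually h).and self_mem_nhdsWithin).exists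
    have h2' : t ≠ 0 := ne_of_gt h2
    simp only [map_smul] at h1
    exact h1.imp (fun h => smul_right_injective ℂ h2' h) fun h => smul_right_injective ℂ h2' h
  by_contra! hcon
  obtain ⟨x, hx⟩ : ∃ x, ℓ x ≠ m x := by
    by_contra! h1
    exact hcon.1 (by ext w; exact h1 w)
  obtain ⟨y, hy⟩ : ∃ y, ℓ y ≠ n y := by
    by_contra! h1
    exact hcon.2 (by ext w; exact h1 w)
  have hx' := (hall x).resolve_left hx
  have hy' := (hall y).resolve_right hy
  rcases hall (x + y) with h1 | h1
  · rw [map_add, map_add, hy'] at h1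
    exact hx (add_right_cancel h1)
  · rw [map_add, map_add, hx'] at h1
    exact hy (add_left_cancel h1)

/-- A linear isometry preserving the germ of a frame at a point comes from a symmetry of the frame
fixing that point. -/
theorem IsFrame.exists_sym_of_germ_eq (H : A.IsFrame x c q) {ζ : ℂ} (hζ : ζ ∈ leftHalf c)
    {ℓ : PlaneRot} (h : ∀ᶠ u in 𝓝 (0 : ℂ), germ q ζ (ℓ u) = germ q ζ u) :
    ∃ S, IsSym c q S ∧ IsLift S ℓ ∧ S ζ = ζ := by
  obtain ⟨δ, hδ, hδpi, hball, ⟨hf, -⟩ | ⟨hsym, -, hinj⟩⟩ := H.local_structure hζ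
  · have : ℓ = 1 := hf.eq_of_germ_eq h
    exact ⟨1, ⟨⟨1, IsLift.one⟩, fun _ _ => rfl⟩, this ▸ IsLift.one, rfl⟩
  obtain ⟨m, hm⟩ := hsym.1
  have hfix : flipMap (2 * ζ.im) ζ = ζ := by
    apply Complex.ext <;> simp; ring
  have hlg : ∀ᶠ u in 𝓝 (0 : ℂ), lg ζ u ∈ Metric.ball ζ δ :=
    (tendsto_lg ζ).eventually (Metric.ball_mem_nhds ζ hδ)
  have hmlg := hm.lg ζ
  rw [hfix] at hmlg
  have hcase : ∀ᶠ u in 𝓝 (0 : ℂ), ℓ u = (1 : PlaneRot) u ∨ ℓ u = m u := by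
    filter_upwards [h, hlg, ℓ.tendsto_zero.eventually hlg, hmlg, eventually_ne_neg_exp ζ,
      ℓ.tendsto_zero.eventually (eventually_ne_neg_exp ζ),
      m.tendsto_zero.eventually (eventually_ne_neg_exp ζ)] with u h1 h2 h3 h4 h5 h6 h7
    refine (hinj _ h2 _ h3 h1.symm).imp (fun e => ?_) fun e => ?_
    · have := congrArg Complex.exp e
      rw [exp_lg h6, exp_lg h5] at this
      exact add_left_cancel this
    · rw [h4] at e
      have := congrArg Complex.exp e
      rw [exp_lg h6, exp_lg h7] at this
      exact add_left_cancel this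
  rcases PlaneRot.eq_or_eq_of_eventually hcase with rfl | rfl
  · exact ⟨1, ⟨⟨1, IsLift.one⟩, fun _ _ => rfl⟩, IsLift.one, rfl⟩
  · exact ⟨_, hsym, hm, hfix⟩

/-- If `q` and its composition with a lift have the same germ at points `ω'`, `ω`, then the two
frames differ by full turns only. -/
theorem IsFrame.shift_of_germ_eq (H : A.IsFrame x c q) {T : PlaneIso} {ℓ : PlaneRot}
    (hT : IsLift T ℓ) {ω ω' : ℂ} (hω : ω ∈ leftHalf c) (hω' : ω' ∈ leftHalf c)
    (h : ∀ᶠ u in 𝓝 (0 : ℂ), germ (fun ζ => q (T ζ)) ω' u = germ q ω u) :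
    ∃ n : ℤ, shiftMap (2 * Real.pi * n) ω' = ω ∧
      ∀ ζ ∈ leftHalf c, q (T ζ) = q (shiftMap (2 * Real.pi * n) ζ) := by
  obtain ⟨γ, hγ, hγω⟩ := H.exists_sym (hT.mem.2 hω') hω (by simpa using h.self_of_nhds)
  obtain ⟨m, hm⟩ := hγ.1
  have hgerm : ∀ᶠ u in 𝓝 (0 : ℂ), germ q ω ((m * ℓ) u) = germ q ω u := by
    filter_upwards [h, germ_comp_lift q hT ω',
      ℓ.tendsto_zero.eventually (hγ.germ_eq hm (hT.mem.2 hω'))] with u h1 h2 h3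
    rw [PlaneRot.mul_apply, ← h1, h2, ← h3, hγω]
  obtain ⟨S, hS, hSl, hfix⟩ := H.exists_sym_of_germ_eq hω hgerm
  obtain ⟨n, hn⟩ := IsLift.eq_shiftMap (T := S⁻¹ * (γ * T))
    (by simpa using hSl.inv.mul (hm.mul hT))
  refine ⟨n, ?_, fun ζ hζ => ?_⟩
  · rw [← hn, PlaneIso.mul_apply, PlaneIso.mul_apply, ← hγω]
    nth_rw 1 [← hfix]
    rw [PlaneIso.inv_apply_self]
  · rw [← hn, PlaneIso.mul_apply, hS.inv.2 _ ((hm.mul hT).mem.2 hζ), PlaneIso.mul_apply,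
      hγ.2 _ (hT.mem.2 hζ)]

/-- Uniqueness of frames at `x`, away from the mirrors. -/
theorem IsFrame.exists_lift_on (H : A.IsFrame x c q) (H' : A.IsFrame x c' q') {a : ℝ}
    (hac : a ≤ c) (hac' : a ≤ c') (hsub : polarDisc x a q' ⊆ polarDisc x c q) {s : Set ℂ}
    (hs : s ⊆ leftHalf a) (hpre : IsPreconnected s) (hne : s.Nonempty)
    (hflat : ∀ ζ ∈ s, A.PolarFlatAt q' ζ) (hray : ∀ ζ ∈ s, ∀ t : ℝ, 0 ≤ t → ζ - t ∈ s) :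
    ∃ T ℓ, IsLift T ℓ ∧ ∀ ω ∈ s, q' ω = q (T ω) := by
  have hex : ∀ ζ' ∈ s, ∃ ζ ℓ, Compare A c q q' ζ' ζ ℓ := by
    intro ζ' hζ'
    have h1 : q' ζ' ∈ polarDisc x c q := hsub (mem_insert_of_mem _ ⟨ζ', hs hζ', rfl⟩)
    rcases h1 with h1 | ⟨ζ, hζ, h1⟩
    · exact absurd h1 (H'.1.ne (leftHalf_mono hac' (hs hζ')))
    · obtain ⟨e, he, hm⟩ := (hflat ζ' hζ').mem_source
      have hf := H.polarFlatAt_of_mem_source hζ he (h1 ▸ hm)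
      obtain ⟨ℓ, hℓ⟩ := hf.compare (hflat ζ' hζ') h1
      exact ⟨ζ, ℓ, hζ, hf, hℓ⟩
  have hlocal : ∀ {ζ' ζ ℓ}, Compare A c q q' ζ' ζ ℓ → ∀ᶠ ω in 𝓝 ζ', ∃ η, Compare A c q q' ω η ℓ ∧
      Complex.exp η - ℓ (Complex.exp ω) = Complex.exp ζ - ℓ (Complex.exp ζ') := fun {ζ' ζ ℓ} h => by
    rw [← eventually_lg_iff]
    filter_upwards [h.eventually] with u hu using ⟨_, hu⟩
  -- The distance of the apices is locally constant, and it tends to zero along rays.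
  have hzero : ∀ {ζ' ζ ℓ}, ζ' ∈ s → Compare A c q q' ζ' ζ ℓ →
      Complex.exp ζ = ℓ (Complex.exp ζ') := by
    intro ζ₀ ζ₁ ℓ₁ h0 h1
    have hconst := hpre.forall_of_local (ρ := fun ζ' (r : ℝ) => ∃ ζ ℓ, Compare A c q q' ζ' ζ ℓ ∧
        ‖Complex.exp ζ - ℓ (Complex.exp ζ')‖ = r)
      (fun ζ' hζ' => by
        obtain ⟨ζ, ℓ, h⟩ := hex ζ' hζ'
        exact ⟨_, ζ, ℓ, h, rfl⟩)
      (fun ζ' _ r ⟨ζ, ℓ, h, hr⟩ => mem_nhdsWithin_of_mem_nhds (by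
        filter_upwards [hlocal h] with ω ⟨η, h2, h3⟩
        exact ⟨η, ℓ, h2, by rw [h3, hr]⟩))
      (fun ζ' _ ω _ r r' ⟨ζ, ℓ, h, hr⟩ ⟨η, m, h', hr'⟩ h2 => by
        have : r = r' := by rw [← hr, ← hr', h.norm_eq H h']
        rwa [← this]) h0 (i := ‖Complex.exp ζ₁ - ℓ₁ (Complex.exp ζ₀)‖) ⟨ζ₁, ℓ₁, h1, rfl⟩
    rw [← sub_eq_zero, ← norm_le_zero_iff]
    refine le_of_forall_pos_le_add fun ε hε => ?_
    rw [zero_add]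
    set b := min c (Real.log (ε / 2))
    obtain ⟨a', ha', hsub'⟩ := H'.1.2.2.2.mem_iff.1 (H.1.disc_mem (min_le_left c (Real.log (ε / 2))))
    set d := min a' b
    set t : ℝ := max 0 (ζ₀.re - d + 1)
    have htmem := hray ζ₀ h0 t (le_max_left _ _)
    have htd : ζ₀ - t ∈ leftHalf d := by
      change (ζ₀ - t).re < d
      simp only [Complex.sub_re, Complex.ofReal_re]
      have := le_max_right 0 (ζ₀.re - d + 1)
      linarith
    obtain ⟨ζ, ℓ, h2, h3⟩ := hconst _ htmem
    have h4 : q' (ζ₀ - t) ∈ polarDisc x b q :=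
      hsub' (mem_insert_of_mem _ ⟨_, leftHalf_mono (min_le_left _ _) htd, rfl⟩)
    rcases h4 with h4 | ⟨η, hη, h4⟩
    · exact absurd h4 (H'.1.ne (leftHalf_mono hac' (hs htmem)))
    have h5 : η.re = ζ.re := H.re_eq h2.mem (leftHalf_mono (min_le_left _ _) hη) (by
      rw [h4, h2.eq])
    have h6 : ∀ {ω : ℂ}, ω ∈ leftHalf b → ‖Complex.exp ω‖ ≤ ε / 2 := fun {ω} hω => by
      have := leftHalf_mono (min_le_right _ _) hω
      rw [mem_leftHalf_log_iff (by positivity), mem_ball_zero_iff] at this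
      exact this.le
    rw [← h3]
    refine (norm_sub_le _ _).trans ?_
    rw [LinearIsometryEquiv.norm_map, Complex.norm_exp ζ, ← h5, ← Complex.norm_exp]
    linarith [h6 hη, h6 (leftHalf_mono (min_le_right _ _) htd)]
  -- now the comparison is a linear isometry between polar coordinates with a common apex, hence a
  -- lift in logarithmic coordinates; lifts are unique, so that they agree along `s`
  have hex2 : ∀ ζ' ∈ s, ∃ T : PlaneIso, (∃ ℓ, IsLift T ℓ) ∧ ∀ᶠ ω in 𝓝 ζ', q' ω = q (T ω) := by
    intro ζ' hζ'
    obtain ⟨ζ, ℓ, h⟩ := hex ζ' hζ'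
    obtain ⟨T, hT, rfl⟩ := exists_lift_of_exp_eq (hzero hζ' h)
    refine ⟨T, ⟨ℓ, hT⟩, germ_congr_iff.1 ?_⟩
    filter_upwards [h.germ, germ_comp_lift q hT ζ'] with u h1 h2
    rw [h1, h2]
  obtain ⟨ω₀, hω₀⟩ := hne
  obtain ⟨T, ⟨ℓ, hT⟩, hev⟩ := hex2 ω₀ hω₀
  refine ⟨T, ℓ, hT, fun ω hω => ?_⟩
  refine (hpre.forall_of_local (ρ := fun ζ' (T : PlaneIso) => (∃ ℓ, IsLift T ℓ) ∧
      ∀ᶠ ω in 𝓝 ζ', q' ω = q (T ω)) hex2 (fun ζ' _ T ⟨h1, h2⟩ => mem_nhdsWithin_of_mem_nhds (by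
        filter_upwards [h2.eventually_nhds] with η hη using ⟨h1, hη⟩))
      ?_ hω₀ ⟨⟨ℓ, hT⟩, hev⟩ ω hω).2.self_of_nhds
  rintro ζ hζ η hη T₁ T₂ ⟨⟨ℓ₁, h1⟩, h2⟩ ⟨⟨ℓ₂, h3⟩, h4⟩ ⟨-, h5⟩
  have := H.comp_eq h1 h3 (leftHalf_mono hac (hs hζ)) (by
    filter_upwards [h2, h4] with ξ e1 e2; rw [← e1, e2])
  refine ⟨⟨ℓ₂, h3⟩, ?_⟩
  filter_upwards [h5, leftHalf_mem_nhds (leftHalf_mono hac (hs hη))] with ξ e1 e2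
  rw [e1, this ξ e2]

variable [T2Space X]

/-- Two frames at a point differ by an isometry fixing the apex. -/
theorem IsFrame.unique (H : A.IsFrame x c q) (H' : A.IsFrame x c' q') :
    ∃ T ℓ, IsLift T ℓ ∧ ∃ a, a ≤ c ∧ a ≤ c' ∧ ∀ ω ∈ leftHalf a, q' ω = q (T ω) := by
  obtain ⟨a', ha', hsub'⟩ := H'.1.2.2.2.mem_iff.1 (H.1.disc_mem le_rfl)
  set a := min a' c
  have hac : a ≤ c := min_le_right _ _
  have hac' : a ≤ c' := (min_le_left _ _).trans ha'
  have hsub : polarDisc x a q' ⊆ polarDisc x c q :=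
    (polarDisc_mono (min_le_left _ _)).trans hsub'
  have hray : ∀ ζ ∈ leftHalf a, ∀ t : ℝ, 0 ≤ t → ζ - t ∈ leftHalf a := fun ζ hζ t ht => by
    have h : ζ.re < a := hζ
    change (ζ - t).re < a
    simp only [Complex.sub_re, Complex.ofReal_re]
    linarith
  obtain ⟨-, ⟨θ, h1, h2, h3⟩ | ⟨α, β, h1, h2, h3⟩⟩ := id H'
  · obtain ⟨T, ℓ, hT, hq⟩ := H.exists_lift_on H' hac hac' hsub Subset.rfl
      (isPreconnected_leftHalf a) ⟨((a - 1 : ℝ) : ℂ), by simp [leftHalf]⟩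
      (fun ζ hζ => h3 ζ (leftHalf_mono hac' hζ)) hray
    exact ⟨T, ℓ, hT, a, hac, hac', hq⟩
  -- for a wedge, compare on an open sector between two mirrors first
  set s : Set ℂ := leftHalf a ∩ {ω | ω.im ∈ Ioo β (β + α)} with hs
  have hspre : IsPreconnected s :=
    ((convex_leftHalf a).inter ((convex_Ioo β (β + α)).linear_preimage Complex.imLm)).isPreconnected
  obtain ⟨T, ℓ, hT, hq⟩ := H.exists_lift_on H' hac hac' hsub (s := s) inter_subset_left hspre
    ⟨⟨a - 1, β + α / 2⟩, by
      refine ⟨?_, ?_, ?_⟩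
      · change a - 1 < a
        linarith
      · change β < β + α / 2
        linarith
      · change β + α / 2 < β + α
        linarith⟩
    (fun ζ hζ => h3 ζ (leftHalf_mono hac' hζ.1) fun n hn => by
      obtain ⟨i1, i2⟩ := hζ.2
      rw [hn] at i1 i2
      have a1 : (0 : ℝ) < n := by
        by_contra hcon; push Not at hcon
        nlinarith
      have a2 : (n : ℝ) < 1 := by
        by_contra hcon; push Not at hcon
        nlinarith
      have b1 : 0 < n := by exact_mod_cast a1
      have b2 : n < 1 := by exact_mod_cast a2
      omega)
    (fun ζ hζ t ht => ⟨hray ζ hζ.1 t ht, by simpa using hζ.2⟩)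
  refine ⟨T, ℓ, hT, a, hac, hac', ?_⟩
  have hqc : ∀ ω ∈ leftHalf a, ContinuousAt q' ω ∧ ContinuousAt (fun ω => q (T ω)) ω :=
    fun ω hω => ⟨H'.1.continuousAt (leftHalf_mono hac' hω),
      (H.1.comp_lift hT).continuousAt (leftHalf_mono hac hω)⟩
  -- by continuity the comparison holds on the closed sector
  have hclosed : ∀ ω ∈ leftHalf a, ω.im ∈ Icc β (β + α) → q' ω = q (T ω) := by
    intro ω hω him
    have htI : ∀ m : ℝ, Tendsto (fun t : ℝ => ω + ((t * m : ℝ) : ℂ) * Complex.I) (𝓝[>] 0) (𝓝 ω) := by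
      intro m
      have : Continuous (fun t : ℝ => ω + ((t * m : ℝ) : ℂ) * Complex.I) := by fun_prop
      have := this.tendsto 0
      simp only [zero_mul, Complex.ofReal_zero, add_zero] at this
      exact this.mono_left nhdsWithin_le_nhds
    set m := β + α / 2 - ω.im
    have hev : ∀ᶠ t : ℝ in 𝓝[>] 0, q' (ω + ((t * m : ℝ) : ℂ) * Complex.I) =
        q (T (ω + ((t * m : ℝ) : ℂ) * Complex.I)) := by
      filter_upwards [(htI m).eventually (leftHalf_mem_nhds hω), Ioo_mem_nhdsGT one_pos] with t e1 e2
      refine hq _ ⟨e1, ?_⟩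
      have e3 : (ω + ((t * m : ℝ) : ℂ) * Complex.I).im = ω.im + t * m := by simp
      obtain ⟨e4, e5⟩ := e2
      obtain ⟨i1, i2⟩ := him
      rw [mem_ofPred_eq, e3]
      have hm : m = β + α / 2 - ω.im := rfl
      rw [hm]
      constructor <;> nlinarith [mul_nonneg (sub_nonneg.2 e5.le) (sub_nonneg.2 i1),
        mul_nonneg (sub_nonneg.2 e5.le) (sub_nonneg.2 i2), mul_pos e4 h1]
    exact tendsto_nhds_unique (((hqc ω hω).1.tendsto.comp (htI m)).congr' hev)
      ((hqc ω hω).2.tendsto.comp (htI m))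
  -- the mirrors of `q'` are mirrors of `q`, so that the comparison can be reflected in them
  have hflip : ∀ ω : ℂ, (ω.im = β ∨ ω.im = β + α) → ω ∈ leftHalf a → ∀ ζ ∈ leftHalf a,
      q' ζ = q (T ζ) → q' (flipMap (2 * ω.im) ζ) = q (T (flipMap (2 * ω.im) ζ)) := by
    intro ω him hω ζ hζ hqζ
    have hsym' : IsSym c' q' (flipMap (2 * ω.im)) := by
      have hl := isLift_flipMap (2 * ω.im)
      refine ⟨⟨_, hl⟩, fun ξ hξ => ((h2 ξ hξ _ (hl.mem.2 hξ)).2 ?_).symm⟩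
      rcases him with him | him
      · exact ⟨0, Or.inr (by rw [him]; simp)⟩
      · exact ⟨1, Or.inr (by rw [him]; congr 2; push_cast; ring)⟩
    have h4 := H'.not_mem_source_of_isSym_flip (leftHalf_mono hac' hω) hsym'
    rw [hclosed ω hω (by rcases him with him | him <;> rw [him] <;> constructor <;> linarith)] at h4
    have hsym := H.isSym_flip (hT.mem.2 (leftHalf_mono hac hω)) h4
    rw [hsym'.2 _ (leftHalf_mono hac' hζ), hT.mul_flipMap,
      hsym.2 _ (hT.mem.2 (leftHalf_mono hac hζ)), hqζ]
  have hflip' : ∀ γ : ℝ, (γ = β ∨ γ = β + α) → ∀ ζ ∈ leftHalf a,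
      q' ζ = q (T ζ) → q' (flipMap (2 * γ) ζ) = q (T (flipMap (2 * γ) ζ)) :=
    fun γ hγ => hflip ⟨a - 1, γ⟩ hγ (by change a - 1 < a; linarith)
  have hmem : ∀ {t : ℝ} {ζ : ℂ}, ζ ∈ leftHalf a → flipMap t ζ ∈ leftHalf a := fun {t ζ} hζ =>
    (isLift_flipMap t).mem.2 hζ
  have hmem' : ∀ {t : ℝ} {ζ : ℂ}, ζ ∈ leftHalf a → shiftMap t ζ ∈ leftHalf a := fun {t ζ} hζ =>
    (isLift_shiftMap t).mem.2 hζ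
  have hshift : ∀ n : ℤ, ∀ ζ ∈ leftHalf a, q' ζ = q (T ζ) →
      q' (shiftMap (n * (2 * α)) ζ) = q (T (shiftMap (n * (2 * α)) ζ)) := by
    intro n
    induction n with
    | zero => intro ζ _ h; simpa using h
    | succ n ih =>
      intro ζ hζ h
      have h5 := hflip' (β + α) (Or.inr rfl) _ (hmem (hmem' hζ))
        (hflip' β (Or.inl rfl) _ (hmem' hζ) (ih ζ hζ h))
      have h6 : flipMap (2 * (β + α)) (flipMap (2 * β) (shiftMap (((n : ℤ) : ℝ) * (2 * α)) ζ)) =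
          shiftMap (((n + 1 : ℤ) : ℝ) * (2 * α)) ζ := by
        simp [Complex.conj_ofNat]; ring
      rwa [h6] at h5
    | pred n ih =>
      intro ζ hζ h
      have h5 := hflip' β (Or.inl rfl) _ (hmem (hmem' hζ))
        (hflip' (β + α) (Or.inr rfl) _ (hmem' hζ) (ih ζ hζ h))
      have h6 : flipMap (2 * β) (flipMap (2 * (β + α)) (shiftMap (((-n : ℤ) : ℝ) * (2 * α)) ζ)) =
          shiftMap (((-n - 1 : ℤ) : ℝ) * (2 * α)) ζ := by
        simp [Complex.conj_ofNat]; ring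
      rwa [h6] at h5
  intro ω hω
  -- reflections bring each point into the sector
  set n : ℤ := ⌊(ω.im - β) / (2 * α)⌋
  have hn1 : n * (2 * α) ≤ ω.im - β := by
    have := Int.floor_le ((ω.im - β) / (2 * α))
    rwa [le_div_iff₀ (by positivity)] at this
  have hn2 : ω.im - β < (n + 1) * (2 * α) := by
    have := Int.lt_floor_add_one ((ω.im - β) / (2 * α))
    rwa [div_lt_iff₀ (by positivity)] at this
  set ω₁ := shiftMap (-(n * (2 * α))) ω with hω₁
  have him1 : ω₁.im = ω.im - n * (2 * α) := by simp [hω₁]; ring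
  have hback : shiftMap (n * (2 * α)) ω₁ = ω := by simp [hω₁]
  have h6 : q' ω₁ = q (T ω₁) := by
    rcases le_total ω₁.im (β + α) with h | h
    · exact hclosed _ (hmem' hω) ⟨by linarith, h⟩
    · have h7 := hflip' (β + α) (Or.inr rfl) _ (hmem (t := 2 * (β + α)) (hmem' hω))
        (hclosed (flipMap (2 * (β + α)) ω₁) (hmem (hmem' hω)) (by
          have : (flipMap (2 * (β + α)) ω₁).im = 2 * (β + α) - ω₁.im := by simp; ring
          rw [this]
          constructor <;> linarith))
      have h8 : flipMap (2 * (β + α)) (flipMap (2 * (β + α)) ω₁) = ω₁ := by simp [Complex.conj_ofNat]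
      rwa [h8] at h7
  have := hshift n ω₁ (hmem' hω) h6
  rwa [hback] at this

end FlatAtlas

/-! ### Parallel frames -/

theorem eventually_slit (ζ : ℂ) :
    ∀ᶠ u in 𝓝 (0 : ℂ), 1 + u * Complex.exp (-ζ) ∈ Complex.slitPlane := by
  have : ContinuousAt (fun u : ℂ => 1 + u * Complex.exp (-ζ)) 0 := by fun_prop
  exact this.eventually (Complex.isOpen_slitPlane.mem_nhds (by simp))

theorem germ_recenter {X : Type*} (q : ℂ → X) {ζ ω : ℂ}
    (h : 1 + Complex.exp ω * Complex.exp (-ζ) ∈ Complex.slitPlane) :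
    ∀ᶠ v in 𝓝 (0 : ℂ), germ (fun η => germ q ζ (Complex.exp η)) ω v =
      germ q (lg ζ (Complex.exp ω)) v := by
  filter_upwards [germ_add q h, eventually_ne_neg_exp ω] with v h1 h2
  rw [← h1, ← exp_lg h2, germ]

theorem tendsto_add_zero (z : ℂ) : Tendsto (fun u : ℂ => z + u) (𝓝 0) (𝓝 z) := by
  have : Continuous (fun u : ℂ => z + u) := by fun_prop
  simpa using this.tendsto 0

/-- A property that holds near `0` holds at all points `exp ω` with small real part of `ω`. -/
theorem exists_leftHalf_of_eventually {p : ℂ → Prop} (h : ∀ᶠ u in 𝓝 (0 : ℂ), p u) :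
    ∃ a : ℝ, ∀ ω ∈ leftHalf a, p (Complex.exp ω) := by
  obtain ⟨r, hr, hb⟩ := Metric.eventually_nhds_iff_ball.1 h
  exact ⟨Real.log r, fun ω hω => hb _ ((FlatAtlas.mem_leftHalf_log_iff hr).1 hω)⟩

theorem real_mem_leftHalf {a b : ℝ} (h : a < b) : (a : ℂ) ∈ leftHalf b := by
  simpa [leftHalf] using h

namespace PolygonalSurface

variable {P : PolygonalSurface.{u}}

open FlatAtlas

/-- The disc `D` in another isometric coordinate. -/
noncomputable def FlatDisc.comp (D : P.FlatDisc) (g : PlaneIso) : P.FlatDisc where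
  center := g⁻¹ D.center
  radius := D.radius
  radius_pos := D.radius_pos
  map w := D.map (g w)
  regular w hw := RegAt.comp g (D.regular _ (by
    rw [Metric.mem_ball] at hw ⊢
    rwa [← g.apply_inv_self D.center, AffineIsometryEquiv.dist_map]))

theorem FlatDisc.mem_ball_comp {D : P.FlatDisc} {g : PlaneIso} {w : ℂ} :
    w ∈ (D.comp g).ball ↔ g w ∈ D.ball := by
  change w ∈ Metric.ball (g⁻¹ D.center) D.radius ↔ g w ∈ Metric.ball D.center D.radius
  rw [Metric.mem_ball, Metric.mem_ball]
  nth_rw 2 [← g.apply_inv_self D.center]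
  rw [AffineIsometryEquiv.dist_map]

theorem FlatDisc.center_mem (D : P.FlatDisc) : D.center ∈ D.ball := Metric.mem_ball_self D.radius_pos

theorem FlatDisc.isOpen_ball (D : P.FlatDisc) : IsOpen D.ball := Metric.isOpen_ball

theorem FlatDisc.Develops.comp {D E : P.FlatDisc} {g : PlaneIso} (h : D.Develops E g) :
    D.Develops (E.comp g) 1 := by
  have hadj : E.Adj (E.comp g) g⁻¹ := by
    refine ⟨E.center, E.center_mem, ?_, Eventually.of_forall fun w => ?_⟩
    · rw [FlatDisc.mem_ball_comp, g.apply_inv_self]; exact E.center_mem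
    · exact congrArg E.map (g.apply_inv_self w).symm
  simpa using h.step hadj

theorem FlatDisc.regAt (D : P.FlatDisc) {z : ℂ} (hz : z ∈ D.ball) : P.atlas.RegAt D.map z :=
  D.regular z hz

/-- A frame gives a flat disc about each of its points. -/
theorem exists_disc_of_isFrame {x : P} {c : ℝ} {q : ℂ → P} (H : P.atlas.IsFrame x c q) {ζ : ℂ}
    (hζ : ζ ∈ leftHalf c) : ∃ D : P.FlatDisc, D.center = 0 ∧ D.map = germ q ζ := by
  obtain ⟨r, hr, hb⟩ := Metric.eventually_nhds_iff_ball.1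
    ((eventually_slit ζ).and ((tendsto_lg ζ).eventually (leftHalf_mem_nhds hζ)))
  refine ⟨⟨0, r, hr, germ q ζ, fun u hu => ?_⟩, rfl, rfl⟩
  refine RegAt.congr (H.regAt (hb u hu).2) ?_
  filter_upwards [germ_add q (hb u hu).1] with v hv
  rw [hv, zero_add]

/-- The flat coordinate `p` near `0` is parallel to the base disc `D₀`: it is obtained from `D₀` by
developing along some path without rotation. -/
def AlGerm (D₀ : P.FlatDisc) (p : ℂ → P) : Prop :=
  ∃ (E : P.FlatDisc) (z : ℂ), D₀.Develops E 1 ∧ z ∈ E.ball ∧ ∀ᶠ u in 𝓝 (0 : ℂ), p u = E.map (z + u)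

variable {D₀ : P.FlatDisc}

theorem AlGerm.congr {p p' : ℂ → P} (H : AlGerm D₀ p) (h : ∀ᶠ u in 𝓝 (0 : ℂ), p' u = p u) :
    AlGerm D₀ p' := by
  obtain ⟨E, z, h1, h2, h3⟩ := H
  exact ⟨E, z, h1, h2, by filter_upwards [h, h3] with u e1 e2; rw [e1, e2]⟩

/-- Parallelism spreads over a flat disc. -/
theorem AlGerm.of_disc {E : P.FlatDisc} {z z' : ℂ} (hz : z ∈ E.ball) (hz' : z' ∈ E.ball)
    (H : AlGerm D₀ (fun u => E.map (z + u))) : AlGerm D₀ (fun u => E.map (z' + u)) := by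
  obtain ⟨F, w, h1, h2, h3⟩ := H
  have hadj : F.Adj E (planeMap 1 (z - w)) := by
    refine ⟨w, h2, ?_, ?_⟩
    · rw [planeMap_apply]
      change w + (z - w) ∈ E.ball
      rwa [add_sub_cancel]
    · have ht : Tendsto (fun η : ℂ => η - w) (𝓝 w) (𝓝 0) := by
        have : Continuous (fun η : ℂ => η - w) := by fun_prop
        simpa using this.tendsto w
      filter_upwards [ht.eventually h3] with η hη
      rw [planeMap_apply]
      rw [add_sub_cancel] at hη
      rw [← hη]
      congr 1
      change z + (η - w) = η + (z - w)
      ring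
  have h4 := (h1.step hadj).comp
  refine ⟨_, z' - (z - w), h4, ?_, Eventually.of_forall fun u => ?_⟩
  · rw [FlatDisc.mem_ball_comp, mul_one, planeMap_apply]
    change z' - (z - w) + (z - w) ∈ E.ball
    rwa [sub_add_cancel]
  · change E.map (z' + u) = E.map ((planeMap 1 (z - w) * 1) (z' - (z - w) + u))
    rw [mul_one, planeMap_apply]
    congr 1
    change z' + u = z' - (z - w) + u + (z - w)
    ring

/-- The frame `q` is parallel to the base disc. -/
def Aligned (D₀ : P.FlatDisc) (c : ℝ) (q : ℂ → P) : Prop :=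
  ∃ ζ ∈ leftHalf c, AlGerm D₀ (germ q ζ)

/-- A frame that is parallel to the base disc at one of its points is so at all of them. -/
theorem Aligned.all {x : P} {c : ℝ} {q : ℂ → P} (H : P.atlas.IsFrame x c q) (h : Aligned D₀ c q) :
    ∀ ζ ∈ leftHalf c, AlGerm D₀ (germ q ζ) := by
  obtain ⟨ζ₀, hζ₀, h0⟩ := h
  intro ζ hζ
  refine ((isPreconnected_leftHalf c).induction₂
    (fun ζ ω => AlGerm D₀ (germ q ζ) ↔ AlGerm D₀ (germ q ω)) (fun ζ hζ => ?_)
    (fun _ _ _ _ _ _ h h' => h.trans h') (fun _ _ _ _ h => h.symm) hζ₀ hζ).1 h0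
  obtain ⟨D, hD0, hDm⟩ := exists_disc_of_isFrame H hζ
  refine mem_nhdsWithin_of_mem_nhds (eventually_lg_iff.1 ?_)
  have h0 : (0 : ℂ) ∈ D.ball := hD0 ▸ D.center_mem
  filter_upwards [D.isOpen_ball.mem_nhds h0, eventually_slit ζ] with u h1 h2
  have h3 : AlGerm D₀ (germ q ζ) ↔ AlGerm D₀ (fun u => D.map (0 + u)) := by simp [hDm]
  have h4 : AlGerm D₀ (germ q (lg ζ u)) ↔ AlGerm D₀ (fun v => D.map (u + v)) := by
    rw [hDm]
    constructor <;> intro h <;> refine h.congr ?_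
    · filter_upwards [germ_add q h2] with v hv using hv
    · filter_upwards [germ_add q h2] with v hv using hv.symm
  rw [h3, h4]
  exact ⟨fun h => h.of_disc h0 h1, fun h => h.of_disc h1 h0⟩

theorem Aligned.congr {x : P} {a c c' : ℝ} {q q' : ℂ → P} (H : P.atlas.IsFrame x c q)
    (h : Aligned D₀ c q) (hc : a ≤ c) (hc' : a ≤ c') (hq : ∀ ζ ∈ leftHalf a, q' ζ = q ζ) :
    Aligned D₀ c' q' := by
  have ha : ((a - 1 : ℝ) : ℂ) ∈ leftHalf a := real_mem_leftHalf (by linarith)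
  refine ⟨_, leftHalf_mono hc' ha, (h.all H _ (leftHalf_mono hc ha)).congr (germ_congr ?_)⟩
  filter_upwards [leftHalf_mem_nhds ha] with ω hω using hq ω hω

/-- A frame is aligned iff the frame it induces at another point is. -/
theorem Aligned.recenter_iff {x : P} {c b : ℝ} {q : ℂ → P} (H : P.atlas.IsFrame x c q) {ζ : ℂ}
    (hζ : ζ ∈ leftHalf c) (H' : P.atlas.IsFrame (q ζ) b (fun ω => germ q ζ (Complex.exp ω))) :
    Aligned D₀ b (fun ω => germ q ζ (Complex.exp ω)) ↔ Aligned D₀ c q := by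
  obtain ⟨a, ha⟩ := exists_leftHalf_of_eventually
    ((eventually_slit ζ).and ((tendsto_lg ζ).eventually (leftHalf_mem_nhds hζ)))
  have hω : ((min a b - 1 : ℝ) : ℂ) ∈ leftHalf (min a b) := real_mem_leftHalf (by linarith)
  set ω := ((min a b - 1 : ℝ) : ℂ)
  obtain ⟨h1, h2⟩ := ha ω (leftHalf_mono (min_le_left _ _) hω)
  have h3 := germ_recenter q h1
  constructor
  · intro h
    refine ⟨_, h2, (h.all H' ω (leftHalf_mono (min_le_right _ _) hω)).congr ?_⟩
    filter_upwards [h3] with v hv using hv.symm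
  · intro h
    exact ⟨ω, leftHalf_mono (min_le_right _ _) hω, (h.all H _ h2).congr h3⟩

/-- Two parallel coordinates at a point differ by an element of the rotational holonomy: develop
along one path and back along the other. -/
theorem AlGerm.mem_rotHol {p : ℂ → P} {ℓ : PlaneRot} (h : AlGerm D₀ p)
    (h' : AlGerm D₀ (fun u => p (ℓ u))) : ℓ ∈ D₀.rotHol := by
  obtain ⟨E, z, h1, h2, h3⟩ := h
  obtain ⟨F, w, h4, h5, h6⟩ := h'
  have hadj : F.Adj E (planeMap ℓ (z - ℓ w)) := by
    refine ⟨w, h5, ?_, ?_⟩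
    · rwa [planeMap_apply, add_sub_cancel]
    · have ht : Tendsto (fun η : ℂ => η - w) (𝓝 w) (𝓝 0) := by
        have : Continuous (fun η : ℂ => η - w) := by fun_prop
        simpa using this.tendsto w
      filter_upwards [ht.eventually h6, (ℓ.tendsto_zero.comp ht).eventually h3] with η e1 e2
      rw [add_sub_cancel] at e1
      rw [← e1, planeMap_apply]
      simp only [Function.comp_apply] at e2
      rw [e2, map_sub]
      congr 1; ring
  have h7 : D₀.Develops D₀ _ := (h4.step hadj).trans h1.symm
  refine ⟨_, h7, ?_⟩
  simp

/-- Turning a parallel coordinate by the rotational holonomy gives a parallel coordinate: develop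
along a loop first. -/
theorem AlGerm.of_mem_rotHol {p : ℂ → P} {ℓ : PlaneRot} (h : AlGerm D₀ p)
    (hℓ : ℓ ∈ D₀.rotHol) : AlGerm D₀ (fun u => p (ℓ u)) := by
  obtain ⟨E, z, h1, h2, h3⟩ := h
  obtain ⟨g, hg, rfl⟩ := hℓ
  have hg' : D₀.Develops D₀ g := hg
  have h4 := (hg'.trans h1).comp
  rw [one_mul] at h4
  refine ⟨_, g⁻¹ z, h4, ?_, ?_⟩
  · rwa [FlatDisc.mem_ball_comp, g.apply_inv_self]
  · filter_upwards [(linearPart g).tendsto_zero.eventually h3] with u hu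
    rw [hu]
    change _ = E.map (g _)
    rw [g.apply_add, g.apply_inv_self]

theorem Aligned.mem_rotHol {x : P} {c : ℝ} {q : ℂ → P} (H : P.atlas.IsFrame x c q)
    (h : Aligned D₀ c q) {T : PlaneIso} {ℓ : PlaneRot} (hT : IsLift T ℓ)
    (h' : Aligned D₀ c (fun ζ => q (T ζ))) : ℓ ∈ D₀.rotHol := by
  obtain ⟨ζ, hζ, h1⟩ := h'
  refine (h.all H _ (hT.mem.2 hζ)).mem_rotHol (h1.congr ?_)
  filter_upwards [germ_comp_lift q hT ζ] with u hu using hu.symm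

theorem Aligned.of_mem_rotHol {x : P} {c : ℝ} {q : ℂ → P} (H : P.atlas.IsFrame x c q)
    (h : Aligned D₀ c q) {T : PlaneIso} {ℓ : PlaneRot} (hT : IsLift T ℓ)
    (hℓ : ℓ ∈ D₀.rotHol) : Aligned D₀ c (fun ζ => q (T ζ)) := by
  have hζ : ((c - 1 : ℝ) : ℂ) ∈ leftHalf c := real_mem_leftHalf (by linarith)
  exact ⟨_, hζ, ((h.all H _ (hT.mem.2 hζ)).of_mem_rotHol hℓ).congr (germ_comp_lift q hT _)⟩

theorem exists_frame (x : P) : ∃ c q, P.atlas.IsFrame x c q := by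
  obtain ⟨c, q, h⟩ := P.polar x
  exact ⟨c, q, h.isFrame⟩

/-- If some point near `x` has an aligned frame, then each frame at `x` can be rotated so that it is
aligned. -/
theorem exists_aligned_of_recenter {x : P} {c : ℝ} {q : ℂ → P} (H : P.atlas.IsFrame x c q) {ζ : ℂ}
    (hζ : ζ ∈ leftHalf c) {c' : ℝ} {q' : ℂ → P} (H' : P.atlas.IsFrame (q ζ) c' q')
    (h' : Aligned D₀ c' q') : ∃ T ℓ, IsLift T ℓ ∧ Aligned D₀ c (fun ω => q (T ω)) := by
  obtain ⟨b, hb⟩ := H.recenter hζ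
  obtain ⟨T, ℓ, hT, a, ha, ha', hq⟩ := hb.unique H'
  obtain ⟨a₂, hs⟩ := exists_leftHalf_of_eventually
    ((eventually_slit ζ).and ((tendsto_lg ζ).eventually (leftHalf_mem_nhds hζ)))
  have hω : ((min a a₂ - 1 : ℝ) : ℂ) ∈ leftHalf (min a a₂) := real_mem_leftHalf (by linarith)
  set ω := ((min a a₂ - 1 : ℝ) : ℂ)
  have hωa := leftHalf_mono (min_le_left _ _) hω
  obtain ⟨h1, h2⟩ := hs _ (hT.mem.2 (leftHalf_mono (min_le_right _ _) hω))
  obtain ⟨S, hS⟩ := exists_lift ℓ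
  refine ⟨S, ℓ, hS, S⁻¹ (lg ζ (Complex.exp (T ω))), hS.inv.mem.2 h2,
    (h'.all H' ω (leftHalf_mono ha' hωa)).congr ?_⟩
  have h3 : ∀ᶠ η in 𝓝 ω, q' η = (fun ω => germ q ζ (Complex.exp (T ω))) η := by
    filter_upwards [leftHalf_mem_nhds hωa] with η hη using hq η hη
  filter_upwards [germ_comp_lift q hS (S⁻¹ (lg ζ (Complex.exp (T ω)))), germ_congr h3,
    germ_comp_lift (fun ω => germ q ζ (Complex.exp ω)) hT ω,
    ℓ.tendsto_zero.eventually (germ_recenter q h1)] with u e1 e2 e3 e4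
  rw [e1, e2, e3, e4, PlaneIso.apply_inv_self]

theorem exists_aligned_rotation {x : P} {c c' : ℝ} {q q' : ℂ → P} (H : P.atlas.IsFrame x c q)
    (H' : P.atlas.IsFrame x c' q') (h' : Aligned D₀ c' q') :
    ∃ T ℓ, IsLift T ℓ ∧ Aligned D₀ c (fun ω => q (T ω)) := by
  obtain ⟨T, ℓ, hT, a, ha, ha', hq⟩ := H.unique H'
  exact ⟨T, ℓ, hT, h'.congr H' ha' ha fun ζ hζ => (hq ζ hζ).symm⟩

variable (D₀) in
/-- Each point has an aligned frame, by connectedness. -/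
theorem exists_aligned (x : P) : ∃ c q, P.atlas.IsFrame x c q ∧ Aligned D₀ c q := by
  set p : P → Prop := fun x => ∃ c q, P.atlas.IsFrame x c q ∧ Aligned D₀ c q
  have hp : ∀ x y, p x ↔ p y := fun x y => by
    refine isPreconnected_univ.induction₂ (fun x y => p x ↔ p y) (fun x _ => ?_)
      (fun _ _ _ _ _ _ h h' => h.trans h') (fun _ _ _ _ h => h.symm) (mem_univ x) (mem_univ y)
    rw [nhdsWithin_univ]
    obtain ⟨c, q, H⟩ := exists_frame x
    filter_upwards [H.1.disc_mem le_rfl] with y hy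
    rcases hy with rfl | ⟨ζ, hζ, rfl⟩
    · exact Iff.rfl
    constructor
    · rintro ⟨c', q', H', h'⟩
      obtain ⟨T, ℓ, hT, h⟩ := exists_aligned_rotation H H' h'
      have hT' := H.comp_lift hT
      obtain ⟨b, hb⟩ := hT'.recenter (hT.inv.mem.2 hζ)
      refine ⟨b, _, by simpa only [PlaneIso.apply_inv_self] using hb, ?_⟩
      exact (Aligned.recenter_iff hT' (hT.inv.mem.2 hζ) hb).2 h
    · rintro ⟨c', q', H', h'⟩
      obtain ⟨T, ℓ, hT, h⟩ := exists_aligned_of_recenter H hζ H' h'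
      exact ⟨c, _, H.comp_lift hT, h⟩
  obtain ⟨b, hb⟩ := (D₀.regAt D₀.center_mem).isFrame
  refine (hp (D₀.map D₀.center) x).1 ⟨b, _, hb, ?_⟩
  obtain ⟨a, ha⟩ := exists_leftHalf_of_eventually
    ((tendsto_add_zero D₀.center).eventually (D₀.isOpen_ball.mem_nhds D₀.center_mem))
  have hω : ((min a b - 1 : ℝ) : ℂ) ∈ leftHalf (min a b) := real_mem_leftHalf (by linarith)
  refine ⟨_, leftHalf_mono (min_le_right _ _) hω, D₀, _, .refl,
    ha _ (leftHalf_mono (min_le_left _ _) hω), ?_⟩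
  filter_upwards [eventually_ne_neg_exp ((min a b - 1 : ℝ) : ℂ)] with u hu
  rw [germ, exp_lg hu, add_assoc]

variable (D₀) in
theorem exists_aligned_of_isFrame {x : P} {c : ℝ} {q : ℂ → P} (H : P.atlas.IsFrame x c q) :
    ∃ T ℓ, IsLift T ℓ ∧ Aligned D₀ c (fun ω => q (T ω)) := by
  obtain ⟨c', q', H', h'⟩ := exists_aligned D₀ x
  exact exists_aligned_rotation H H' h'

/-- A disc of a frame, used as base disc, is aligned with this frame. -/
theorem exists_base_disc {x : P} {c : ℝ} {q : ℂ → P} (H : P.atlas.IsFrame x c q) :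
    ∃ D : P.FlatDisc, Aligned D c q := by
  have hζ : ((c - 1 : ℝ) : ℂ) ∈ leftHalf c := real_mem_leftHalf (by linarith)
  obtain ⟨D, hD, hm⟩ := exists_disc_of_isFrame H hζ
  exact ⟨D, _, hζ, D, 0, .refl, hD ▸ D.center_mem, by simp [hm]⟩

variable (P) in
theorem nonempty_flatDisc : Nonempty P.FlatDisc := by
  obtain ⟨x⟩ : Nonempty P := inferInstance
  obtain ⟨c, q, h⟩ := exists_frame x
  exact ⟨(exists_base_disc h).choose⟩

/-- Any two discs are connected by a development. -/
theorem exists_develops (D₀ D : P.FlatDisc) : ∃ g, D₀.Develops D g := by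
  obtain ⟨b, hb⟩ := (D.regAt D.center_mem).isFrame
  obtain ⟨T, ℓ, hT, h⟩ := exists_aligned_of_isFrame D₀ hb
  obtain ⟨a, ha⟩ := exists_leftHalf_of_eventually
    ((tendsto_add_zero D.center).eventually (D.isOpen_ball.mem_nhds D.center_mem))
  have hω : ((min a b - 1 : ℝ) : ℂ) ∈ leftHalf (min a b) := real_mem_leftHalf (by linarith)
  set ω := ((min a b - 1 : ℝ) : ℂ)
  obtain ⟨E, z, h1, h2, h3⟩ := h.all (hb.comp_lift hT) ω (leftHalf_mono (min_le_right _ _) hω)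
  refine ⟨_, h1.step (h := planeMap ℓ (D.center + Complex.exp (T ω) - ℓ z)) ⟨z, h2, ?_, ?_⟩⟩
  · rw [planeMap_apply, add_sub_cancel]
    exact ha _ (hT.mem.2 (leftHalf_mono (min_le_left _ _) hω))
  · have ht : Tendsto (fun η : ℂ => η - z) (𝓝 z) (𝓝 0) := by
      have : Continuous (fun η : ℂ => η - z) := by fun_prop
      simpa using this.tendsto z
    filter_upwards [ht.eventually h3, ht.eventually (eventually_ne_neg_exp ω)] with η e1 e2
    rw [add_sub_cancel] at e1
    rw [← e1, planeMap_apply, germ, hT, exp_lg e2, hT, map_add, map_sub]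
    congr 1; ring

/-- The rotational holonomy groups of two base discs are conjugate. -/
theorem card_rotHol (D₀ D : P.FlatDisc) : Nat.card D.rotHol = Nat.card D₀.rotHol := by
  obtain ⟨g, hg⟩ := exists_develops D₀ D
  set m := linearPart g
  have key : ∀ {D E : P.FlatDisc} {g : PlaneIso}, D.Develops E g → ∀ ℓ ∈ E.rotHol,
      (linearPart g)⁻¹ * ℓ * linearPart g ∈ D.rotHol := by
    rintro D E g hg _ ⟨k, hk, rfl⟩
    have hk' : E.Develops E k := hk
    refine ⟨g⁻¹ * (k * g), (hg.trans hk').trans hg.symm, ?_⟩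
    simp [mul_assoc]
  refine Nat.card_congr ⟨fun ℓ => ⟨_, key hg ℓ ℓ.2⟩, fun ℓ => ⟨_, key hg.symm ℓ ℓ.2⟩, ?_, ?_⟩
  · intro ℓ
    ext1
    simp [mul_assoc]
  · intro ℓ
    ext1
    simp [mul_assoc]

end PolygonalSurface

/-! ### The minimal translation covering -/

theorem eventually_of_leftHalf {p : ℂ → Prop} {a : ℝ} (h0 : p 0)
    (h : ∀ ω ∈ leftHalf a, p (Complex.exp ω)) : ∀ᶠ u in 𝓝 (0 : ℂ), p u := by
  filter_upwards [Metric.ball_mem_nhds (0 : ℂ) (Real.exp_pos a)] with u hu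
  rw [← FlatAtlas.image_exp_leftHalf] at hu
  rcases hu with rfl | ⟨ω, hω, rfl⟩
  exacts [h0, h ω hω]

theorem exists_leftHalf_lg {ζ : ℂ} {s : Set ℂ} (hs : s ∈ 𝓝 ζ) : ∃ a : ℝ, ∀ ω ∈ leftHalf a,
    lg ζ (Complex.exp ω) ∈ s ∧
      1 + Complex.exp ω * Complex.exp (-ζ) ∈ Complex.slitPlane :=
  exists_leftHalf_of_eventually (p := fun u => lg ζ u ∈ s ∧
    1 + u * Complex.exp (-ζ) ∈ Complex.slitPlane) (((tendsto_lg ζ).eventually hs).and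
      (eventually_slit ζ))

theorem germ_shift {X : Type*} (q : ℂ → X) (n : ℤ) (ζ u : ℂ) :
    germ q (shiftMap (2 * Real.pi * n) ζ) u = germ (fun ω => q (shiftMap (2 * Real.pi * n) ω)) ζ u := by
  rw [germ, germ, lg_shift]

namespace PolygonalSurface

open FlatAtlas

variable {P : PolygonalSurface.{u}}

/-- A frame of `P` which is parallel to the base disc. -/
structure AlignedFrame (D₀ : P.FlatDisc) where ofFrame ::
  pt : P
  c : ℝ
  q : ℂ → P
  frame : P.atlas.IsFrame pt c q
  aligned : Aligned D₀ c q

variable {D₀ : P.FlatDisc}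

/-- Two aligned frames at a point are identified if they differ by full turns. -/
instance AlignedFrame.setoid (D₀ : P.FlatDisc) : Setoid (AlignedFrame D₀) where
  r F G := F.pt = G.pt ∧ ∃ a : ℝ, ∃ n : ℤ, ∀ ω ∈ leftHalf a, G.q ω = F.q (shiftMap (2 * Real.pi * n) ω)
  iseqv := by
    refine ⟨fun F => ⟨rfl, 0, 0, fun ω _ => by simp⟩, ?_, ?_⟩
    · rintro F G ⟨h, a, n, hn⟩
      refine ⟨h.symm, a, -n, fun ω hω => ?_⟩
      rw [hn _ ((isLift_shiftMap _).mem.2 hω)]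
      congr 1
      simp
    · rintro F G H ⟨h, a, n, hn⟩ ⟨h', a', n', hn'⟩
      refine ⟨h.trans h', min a a', n + n', fun ω hω => ?_⟩
      rw [hn' _ (leftHalf_mono (min_le_right _ _) hω),
        hn _ ((isLift_shiftMap _).mem.2 (leftHalf_mono (min_le_left _ _) hω))]
      congr 1
      simp; ring

/-- The points of the minimal translation covering: points of `P` with an aligned frame, up to full
turns. Over a regular point these are the directions that are parallel to the base disc. -/
def TransCover (D₀ : P.FlatDisc) : Type u := Quotient (AlignedFrame.setoid D₀)

namespace AlignedFrame

/-- The point of the covering that is given by a frame. -/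
def mk (F : AlignedFrame D₀) : TransCover D₀ := Quotient.mk _ F

theorem mk_eq_mk {F G : AlignedFrame D₀} : F.mk = G.mk ↔ F.pt = G.pt ∧ ∃ a : ℝ, ∃ n : ℤ,
    ∀ ω ∈ leftHalf a, G.q ω = F.q (shiftMap (2 * Real.pi * n) ω) := Quotient.eq

theorem exists_mk (s : TransCover D₀) : ∃ F : AlignedFrame D₀, F.mk = s := Quotient.exists_rep s

/-- The parallel frame at another point of a frame. -/
noncomputable def recenter (F : AlignedFrame D₀) {ζ : ℂ} (hζ : ζ ∈ leftHalf F.c) :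
    AlignedFrame D₀ where
  pt := F.q ζ
  c := (F.frame.recenter hζ).choose
  q ω := germ F.q ζ (Complex.exp ω)
  frame := (F.frame.recenter hζ).choose_spec
  aligned := (Aligned.recenter_iff F.frame hζ (F.frame.recenter hζ).choose_spec).2 F.aligned

open Classical in
/-- The lift of the frame `F` to the covering. -/
noncomputable def lift (F : AlignedFrame D₀) (ζ : ℂ) : TransCover D₀ :=
  if h : ζ ∈ leftHalf F.c then (F.recenter h).mk else F.mk

theorem lift_eq (F : AlignedFrame D₀) {ζ : ℂ} (hζ : ζ ∈ leftHalf F.c) :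
    F.lift ζ = (F.recenter hζ).mk := dif_pos hζ

theorem lift_eq_mk {F G : AlignedFrame D₀} {ζ : ℂ} (hζ : ζ ∈ leftHalf F.c) :
    F.lift ζ = G.mk ↔ F.q ζ = G.pt ∧
      ∃ a : ℝ, ∀ ω ∈ leftHalf a, G.q ω = germ F.q ζ (Complex.exp ω) := by
  rw [F.lift_eq hζ, mk_eq_mk]
  refine and_congr Iff.rfl ⟨?_, ?_⟩
  · rintro ⟨a, n, h⟩
    refine ⟨a, fun ω hω => ?_⟩
    rw [h ω hω]
    change germ F.q ζ (Complex.exp _) = _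
    rw [isLift_shiftMap_int n]; rfl
  · rintro ⟨a, h⟩
    exact ⟨a, 0, fun ω hω => by rw [h ω hω]; simp [recenter]⟩

theorem lift_eq_lift {F G : AlignedFrame D₀} {ζ ω : ℂ} (hζ : ζ ∈ leftHalf F.c)
    (hω : ω ∈ leftHalf G.c) :
    F.lift ζ = G.lift ω ↔ ∀ᶠ u in 𝓝 (0 : ℂ), germ F.q ζ u = germ G.q ω u := by
  rw [G.lift_eq hω, lift_eq_mk hζ]
  constructor
  · rintro ⟨h0, a, h⟩
    refine eventually_of_leftHalf (by rw [germ_zero, germ_zero]; exact h0)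
      fun ω hω => (h ω hω).symm
  · intro h
    refine ⟨by simpa [recenter] using h.self_of_nhds, ?_⟩
    obtain ⟨a, ha⟩ := exists_leftHalf_of_eventually h
    exact ⟨a, fun ω hω => (ha ω hω).symm⟩

theorem lift_eq_lift_of_mk_eq {F G : AlignedFrame D₀} (h : F.mk = G.mk) : ∃ a : ℝ, ∃ n : ℤ,
    a ≤ F.c ∧ a ≤ G.c ∧ ∀ ω ∈ leftHalf a, G.lift ω = F.lift (shiftMap (2 * Real.pi * n) ω) := by
  obtain ⟨-, a, n, ha⟩ := mk_eq_mk.1 h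
  refine ⟨min a (min F.c G.c), n, (min_le_right _ _).trans (min_le_left _ _),
    (min_le_right _ _).trans (min_le_right _ _), fun ω hω => ?_⟩
  rw [lift_eq_lift (leftHalf_mono ((min_le_right _ _).trans (min_le_right _ _)) hω)
    ((isLift_shiftMap _).mem.2 (leftHalf_mono ((min_le_right _ _).trans (min_le_left _ _)) hω))]
  simp only [germ_shift]
  refine germ_congr ?_
  filter_upwards [leftHalf_mem_nhds (leftHalf_mono (min_le_left _ _) hω)] with η hη using ha η hη

/-- If the lift of `F` at `ζ` is the apex of `G`, then near the apex the lift of `G` is that of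
`F` in polar coordinates about `ζ`. -/
theorem lift_of_mk_eq_lift {F G : AlignedFrame D₀} {ζ : ℂ} (hζ : ζ ∈ leftHalf F.c)
    (h : F.lift ζ = G.mk) {s : Set ℂ} (hs : s ∈ 𝓝 ζ) : ∃ a : ℝ, a ≤ G.c ∧ ∀ ω ∈ leftHalf a,
      lg ζ (Complex.exp ω) ∈ s ∧ lg ζ (Complex.exp ω) ∈ leftHalf F.c ∧
      G.lift ω = F.lift (lg ζ (Complex.exp ω)) := by
  obtain ⟨-, a, ha⟩ := (lift_eq_mk hζ).1 h
  obtain ⟨b, hb⟩ := exists_leftHalf_lg (inter_mem hs (leftHalf_mem_nhds hζ))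
  refine ⟨min (min a b) G.c, min_le_right _ _, fun ω hω => ?_⟩
  have h1 := leftHalf_mono ((min_le_left _ _).trans (min_le_left _ _)) hω
  have h2 := leftHalf_mono ((min_le_left _ _).trans (min_le_right _ _)) hω
  have h3 := leftHalf_mono (min_le_right _ _) hω
  obtain ⟨⟨h4, h5⟩, h6⟩ := hb ω h2
  refine ⟨h4, h5, ?_⟩
  rw [lift_eq_lift h3 h5]
  have h7 : ∀ᶠ η in 𝓝 ω, G.q η = germ F.q ζ (Complex.exp η) := by
    filter_upwards [leftHalf_mem_nhds h1] with η hη using ha η hη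
  filter_upwards [germ_congr h7, germ_recenter F.q h6] with u e1 e2
  rw [e1, e2]

end AlignedFrame

namespace TransCover

open AlignedFrame

/-- The covering map. -/
def proj (s : TransCover D₀) : P :=
  Quotient.lift AlignedFrame.pt (fun F G (h : (AlignedFrame.setoid D₀).r F G) => h.1) s

theorem proj_mk (F : AlignedFrame D₀) : proj F.mk = F.pt := rfl

theorem proj_lift (F : AlignedFrame D₀) {ζ : ℂ} (hζ : ζ ∈ leftHalf F.c) :
    proj (F.lift ζ) = F.q ζ := by rw [F.lift_eq hζ]; rfl

/-- A set is open if with the point of a frame it contains the points of the frame near its apex. -/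
instance : TopologicalSpace (TransCover D₀) where
  IsOpen U := ∀ F : AlignedFrame D₀, F.mk ∈ U → ∃ a ≤ F.c, ∀ ω ∈ leftHalf a, F.lift ω ∈ U
  isOpen_univ F _ := ⟨F.c, le_rfl, fun _ _ => mem_univ _⟩
  isOpen_inter U V hU hV F hF := by
    obtain ⟨a, ha, h1⟩ := hU F hF.1
    obtain ⟨b, hb, h2⟩ := hV F hF.2
    exact ⟨min a b, (min_le_left _ _).trans ha, fun ω hω =>
      ⟨h1 ω (leftHalf_mono (min_le_left _ _) hω), h2 ω (leftHalf_mono (min_le_right _ _) hω)⟩⟩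
  isOpen_sUnion S hS F := by
    rintro ⟨U, hU, hF⟩
    obtain ⟨a, ha, h1⟩ := hS U hU F hF
    exact ⟨a, ha, fun ω hω => ⟨U, hU, h1 ω hω⟩⟩

theorem isOpen_iff {U : Set (TransCover D₀)} : IsOpen U ↔
    ∀ F : AlignedFrame D₀, F.mk ∈ U → ∃ a ≤ F.c, ∀ ω ∈ leftHalf a, F.lift ω ∈ U := Iff.rfl

theorem isOpen_image_lift (F : AlignedFrame D₀) {V : Set ℂ} (hV : IsOpen V)
    (hVc : V ⊆ leftHalf F.c) : IsOpen (F.lift '' V) := by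
  rintro G ⟨ζ, hζ, h⟩
  obtain ⟨a, ha, h1⟩ := lift_of_mk_eq_lift (hVc hζ) h (hV.mem_nhds hζ)
  exact ⟨a, ha, fun ω hω => ⟨_, (h1 ω hω).1, (h1 ω hω).2.2.symm⟩⟩

theorem isOpen_disc (F : AlignedFrame D₀) {a : ℝ} (ha : a ≤ F.c) :
    IsOpen (polarDisc F.mk a F.lift) := by
  rw [isOpen_iff]
  rintro G (h | h)
  · obtain ⟨b, n, hb, hb', h1⟩ := lift_eq_lift_of_mk_eq h.symm
    refine ⟨min a b, (min_le_right _ _).trans hb', fun ω hω => ?_⟩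
    rw [h1 ω (leftHalf_mono (min_le_right _ _) hω)]
    exact mem_insert_of_mem _ ⟨_, (isLift_shiftMap _).mem.2 (leftHalf_mono (min_le_left _ _) hω), rfl⟩
  · obtain ⟨b, hb, h1⟩ := isOpen_image_lift F (isOpen_leftHalf a) (leftHalf_mono ha) G h
    exact ⟨b, hb, fun ω hω => mem_insert_of_mem _ (h1 ω hω)⟩

/-- The lift of a frame is a polar parametrization of a neighbourhood of its point. -/
theorem polarTop_lift (F : AlignedFrame D₀) : PolarTop F.mk F.c F.lift := by
  refine ⟨fun ζ hζ => ContinuousAt.continuousWithinAt ?_, fun V hV hVc => isOpen_image_lift F hV hVc,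
    ?_, ?_⟩
  · intro U hU
    obtain ⟨V, hVU, hV, hζV⟩ := mem_nhds_iff.1 hU
    have hζV' := hζV
    rw [F.lift_eq hζ] at hζV
    obtain ⟨a, ha, h1⟩ := hV _ hζV
    obtain ⟨b, hb, h2⟩ := lift_of_mk_eq_lift hζ (F.lift_eq hζ) univ_mem
    have : ∀ᶠ u in 𝓝 (0 : ℂ), F.lift (lg ζ u) ∈ V :=
      eventually_of_leftHalf (a := min a b) (by simpa using hζV') fun ω hω => by
        rw [← (h2 ω (leftHalf_mono (min_le_right _ _) hω)).2.2]
        exact h1 ω (leftHalf_mono (min_le_left _ _) hω)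
    exact mem_map.2 (mem_of_superset (eventually_lg_iff.1 this) fun ω hω => hVU hω)
  · rintro ⟨ζ, hζ, h⟩
    have := congrArg proj h
    rw [proj_lift F hζ] at this
    exact F.frame.1.ne hζ this
  · refine ⟨fun t => ⟨fun ht => ?_, fun ⟨a, ha, h⟩ => mem_of_superset
      ((isOpen_disc F ha).mem_nhds (mem_insert _ _)) h⟩⟩
    obtain ⟨V, hVU, hV, hV'⟩ := mem_nhds_iff.1 ht
    obtain ⟨a, ha, h1⟩ := hV F hV'
    exact ⟨a, ha, insert_subset (hVU hV') (image_subset_iff.2 fun ω hω => hVU (h1 ω hω))⟩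

theorem continuous_proj : Continuous (proj : TransCover D₀ → P) := by
  refine ⟨fun U hU F hF => ?_⟩
  obtain ⟨a, ha, h⟩ := F.frame.1.2.2.2.mem_iff.1 (hU.mem_nhds hF)
  refine ⟨a, ha, fun ω hω => ?_⟩
  rw [mem_preimage, proj_lift F (leftHalf_mono ha hω)]
  exact h (mem_insert_of_mem _ ⟨ω, hω, rfl⟩)

variable (D₀) in
theorem surjective_proj : Function.Surjective (proj : TransCover D₀ → P) := fun x => by
  obtain ⟨c, q, h, h'⟩ := exists_aligned D₀ x
  exact ⟨AlignedFrame.mk ⟨x, c, q, h, h'⟩, rfl⟩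

/-- Frames at the same point that differ by a lift, with a common value, agree up to full turns. -/
theorem shift_of_lift_eq {F G : AlignedFrame D₀} {T : PlaneIso} {ℓ : PlaneRot} (hT : IsLift T ℓ)
    {a : ℝ} (haF : a ≤ F.c) (haG : a ≤ G.c) (hq : ∀ ω ∈ leftHalf a, G.q ω = F.q (T ω)) {ω ω' : ℂ}
    (hω : ω ∈ leftHalf a) (hω' : ω' ∈ leftHalf a) (h : F.lift ω = G.lift ω') :
    ∃ n : ℤ, shiftMap (2 * Real.pi * n) ω' = ω ∧
      ∀ ζ ∈ leftHalf a, G.q ζ = F.q (shiftMap (2 * Real.pi * n) ζ) := by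
  rw [lift_eq_lift (leftHalf_mono haF hω) (leftHalf_mono haG hω')] at h
  have h1 : ∀ᶠ η in 𝓝 ω', G.q η = (fun ω => F.q (T ω)) η := by
    filter_upwards [leftHalf_mem_nhds hω'] with η hη using hq η hη
  obtain ⟨n, hn, hn'⟩ := F.frame.shift_of_germ_eq hT (leftHalf_mono haF hω)
    (leftHalf_mono haF hω') (by
      filter_upwards [h, germ_congr h1] with u e1 e2
      rw [← e2, e1])
  exact ⟨n, hn, fun ζ hζ => by rw [hq ζ hζ, hn' ζ (leftHalf_mono haF hζ)]⟩

/-- The discs of two frames over the same disc of `P` are disjoint or have the same centre. -/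
theorem disjoint_disc {F G : AlignedFrame D₀} (hpt : F.pt = G.pt) {T : PlaneIso} {ℓ : PlaneRot}
    (hT : IsLift T ℓ) {a : ℝ} (haF : a ≤ F.c) (haG : a ≤ G.c)
    (hq : ∀ ω ∈ leftHalf a, G.q ω = F.q (T ω)) {s : TransCover D₀}
    (h : s ∈ polarDisc F.mk a F.lift) (h' : s ∈ polarDisc G.mk a G.lift) : F.mk = G.mk := by
  rcases h with rfl | ⟨ω, hω, rfl⟩
  · rcases h' with h' | ⟨ω', hω', h'⟩
    · exact h'
    · have := congrArg proj h'
      rw [proj_lift G (leftHalf_mono haG hω'), proj_mk, hpt] at this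
      exact absurd this (G.frame.1.ne (leftHalf_mono haG hω'))
  · rcases h' with h' | ⟨ω', hω', h'⟩
    · have := congrArg proj h'
      rw [proj_lift F (leftHalf_mono haF hω), proj_mk, ← hpt] at this
      exact absurd this (F.frame.1.ne (leftHalf_mono haF hω))
    · obtain ⟨n, -, hn⟩ := shift_of_lift_eq hT haF haG hq hω hω' h'.symm
      exact mk_eq_mk.2 ⟨hpt, a, n, hn⟩

instance : T2Space (TransCover D₀) := by
  refine ⟨fun s t hst => ?_⟩
  by_cases hp : proj s = proj t
  · obtain ⟨F, rfl⟩ := exists_mk s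
    obtain ⟨G, rfl⟩ := exists_mk t
    have hpt : F.pt = G.pt := hp
    have hG := G.frame
    rw [← hpt] at hG
    obtain ⟨T, ℓ, hT, a, haF, haG, hq⟩ := F.frame.unique hG
    refine ⟨_, _, isOpen_disc F haF, isOpen_disc G haG, mem_insert _ _, mem_insert _ _,
      disjoint_left.2 fun x hx hx' => hst ?_⟩
    exact disjoint_disc hpt hT haF haG hq hx hx'
  · obtain ⟨U, V, hU, hV, hsU, htV, hd⟩ := t2_separation hp
    exact ⟨_, _, hU.preimage continuous_proj, hV.preimage continuous_proj, hsU, htV,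
      hd.preimage _⟩

/-- Lifts with a common value agree near it, in the flat coordinate `u`. -/
theorem lift_germ_eq {F G : AlignedFrame D₀} {ζ ω : ℂ} (hζ : ζ ∈ leftHalf F.c)
    (hω : ω ∈ leftHalf G.c) (h : F.lift ζ = G.lift ω) :
    ∀ᶠ u in 𝓝 (0 : ℂ), germ F.lift ζ u = germ G.lift ω u := by
  have h1 := (lift_eq_lift hζ hω).1 h
  filter_upwards [h1.eventually_nhds, eventually_slit ζ, eventually_slit ω,
    (tendsto_lg ζ).eventually (leftHalf_mem_nhds hζ),
    (tendsto_lg ω).eventually (leftHalf_mem_nhds hω)] with u e1 e2 e3 e4 e5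
  rw [germ, germ, lift_eq_lift e4 e5]
  filter_upwards [(tendsto_add_zero u).eventually e1, germ_add F.q e2, germ_add G.q e3]
    with v v1 v2 v3
  rw [← v2, ← v3, v1]

/-! ### Cone angles of the covering -/

/-- The full turns that preserve an aligned frame are the multiples of `k` turns for some `k > 0`.
Some full turn preserves it, because the rotation by the cone angle belongs to the finite
rotational holonomy and therefore has finite order. -/
theorem exists_cone (hfin : Finite D₀.rotHol) (F : AlignedFrame D₀) : ∃ k : ℕ, 0 < k ∧
    (∀ n : ℤ, IsSym F.c F.q (shiftMap (2 * Real.pi * (n * k : ℤ)))) ∧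
    ∀ n : ℤ, IsSym F.c F.q (shiftMap (2 * Real.pi * n)) → ∃ m : ℤ, n = m * k := by
  obtain ⟨θ, hθ, hsym, -⟩ := F.frame.exists_rotation
  -- the rotational symmetries are a nontrivial subgroup of the full turns
  let H : AddSubgroup ℤ :=
    { carrier := {n | IsSym F.c F.q (shiftMap (2 * Real.pi * n))}
      zero_mem' := by
        have := hsym 0
        simpa using this
      add_mem' := fun {m n} hm hn => by
        have h := IsSym.mul hm hn
        have e : shiftMap (2 * Real.pi * m) * shiftMap (2 * Real.pi * n) =
            shiftMap (2 * Real.pi * (m + n : ℤ)) := by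
          ext ζ; simp [PlaneIso.mul_apply]; ring
        rwa [e] at h
      neg_mem' := fun {m} hm => by
        have h := IsSym.inv hm
        have e : (shiftMap (2 * Real.pi * m))⁻¹ = shiftMap (2 * Real.pi * (-m : ℤ)) := by
          rw [inv_eq_iff_mul_eq_one]
          ext ζ; simp [PlaneIso.mul_apply]
        rwa [e] at h }
  have hmem : ∀ n : ℤ, n ∈ H ↔ IsSym F.c F.q (shiftMap (2 * Real.pi * n)) := fun n => Iff.rfl
  obtain ⟨a, ha⟩ := Int.subgroup_cyclic H
  have hne : ∃ m : ℤ, m ∈ H ∧ m ≠ 0 := by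
    have hl := isLift_shiftMap θ
    have h1 : rotation (Circle.exp θ) ∈ D₀.rotHol := by
      refine F.aligned.mem_rotHol F.frame hl ?_
      refine F.aligned.congr F.frame le_rfl le_rfl fun ζ hζ => ?_
      have := (hsym 1).2 ζ hζ
      simpa using this
    obtain ⟨k, hk, hk'⟩ := isOfFinOrder_iff_pow_eq_one.1 (isOfFinOrder_of_finite
      (⟨_, h1⟩ : D₀.rotHol))
    -- `k` times the angle `θ` is a number of full turns
    have h2 : rotation (Circle.exp θ) ^ k = 1 := congrArg Subtype.val hk'
    have h3 : IsLift (shiftMap (k * θ)) 1 := by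
      have : shiftMap (k * θ) = shiftMap θ ^ k := by
        clear hk hk' h2
        induction k with
        | zero => ext ζ; simp
        | succ k ih =>
          rw [pow_succ, ← ih]
          ext ζ; simp [PlaneIso.mul_apply]; ring
      rw [this, ← h2]
      clear this hk hk' h2
      induction k with
      | zero => simpa using IsLift.one
      | succ k ih => rw [pow_succ, pow_succ]; exact ih.mul hl
    obtain ⟨n, hn⟩ := h3.eq_shiftMap
    refine ⟨n, ?_, ?_⟩
    · rw [hmem, ← hn]
      exact_mod_cast hsym k
    · rintro rfl
      have := congrArg (fun T : PlaneIso => (T 0).im) hn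
      simp at this
      rcases this with h | h
      · omega
      · exact hθ.ne' h
  have hadj : ∀ n : ℤ, n ∈ H ↔ ∃ m : ℤ, n = m * a := fun n => by
    rw [ha, AddSubgroup.mem_closure_singleton]
    simp only [smul_eq_mul, eq_comm]
  have ha0 : a ≠ 0 := by
    rintro rfl
    obtain ⟨m, hm, hm0⟩ := hne
    obtain ⟨n, rfl⟩ := (hadj m).1 hm
    simp at hm0
  refine ⟨a.natAbs, Int.natAbs_pos.2 ha0, fun n => (hmem _).1 ?_, fun n hn => ?_⟩
  · rcases Int.natAbs_eq a with h | h
    · exact (hadj _).2 ⟨n, by rw [← h]⟩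
    · exact (hadj _).2 ⟨-n, by rw [neg_mul, ← mul_neg]; congr 1; omega⟩
  · obtain ⟨m, rfl⟩ := (hadj n).1 ((hmem n).2 hn)
    rcases Int.natAbs_eq a with h | h
    · exact ⟨m, by rw [← h]⟩
    · exact ⟨-m, by rw [neg_mul, ← mul_neg]; congr 1⟩

/-- Two values of a lift agree iff the points differ by full turns that are symmetries of the
frame. -/
theorem lift_eq_iff_shift (F : AlignedFrame D₀) {ζ ζ' : ℂ} (hζ : ζ ∈ leftHalf F.c)
    (hζ' : ζ' ∈ leftHalf F.c) : F.lift ζ = F.lift ζ' ↔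
      ∃ n : ℤ, IsSym F.c F.q (shiftMap (2 * Real.pi * n)) ∧ ζ' = shiftMap (2 * Real.pi * n) ζ := by
  constructor
  · intro h
    obtain ⟨n, hn, hn'⟩ := shift_of_lift_eq (F := F) (G := F) IsLift.one le_rfl le_rfl
      (fun _ _ => rfl) hζ' hζ h.symm
    exact ⟨n, ⟨⟨1, isLift_shiftMap_int n⟩, fun η hη => (hn' η hη).symm⟩, hn.symm⟩
  · rintro ⟨n, hn, rfl⟩
    rw [lift_eq_lift hζ hζ']
    filter_upwards [hn.germ_eq (isLift_shiftMap_int n) hζ] with u hu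
    exact hu.symm

end TransCover

end PolygonalSurface

/-! ### Flat charts of the covering -/

/-- An open embedding of an open subset of the plane, read backwards, is a chart. -/
theorem exists_chart {X : Type u} [TopologicalSpace X] [Nonempty X] {f : ℂ → X}
    {U : Set ℂ} (hU : IsOpen U)
    (hc : ContinuousOn f U) (hi : InjOn f U)
    (ho : ∀ V : Set ℂ, IsOpen V → V ⊆ U → IsOpen (f '' V)) :
    ∃ e : OpenPartialHomeomorph X ℂ, e.source = f '' U ∧ e.target = U ∧ (∀ u ∈ U, e (f u) = u) ∧
      ∀ u, e.symm u = f u := by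
  let p := InjOn.toPartialEquiv f U hi
  have hom : IsOpenMap (p.source.domRestrict p) := by
    intro V hV
    obtain ⟨W, hW, rfl⟩ := isOpen_induced_iff.1 hV
    have : p.source.domRestrict p '' (Subtype.val ⁻¹' W) = f '' (W ∩ U) := by
      ext x
      constructor
      · rintro ⟨⟨u, hu⟩, hu', rfl⟩
        exact ⟨u, ⟨hu', hu⟩, rfl⟩
      · rintro ⟨u, ⟨hu', hu⟩, rfl⟩
        exact ⟨⟨u, hu⟩, hu', rfl⟩
    rw [this]
    exact ho _ (hW.inter hU) inter_subset_right
  let e := OpenPartialHomeomorph.ofContinuousOpenRestrict p hc hom hU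
  exact ⟨e.symm, rfl, rfl, fun u hu => e.left_inv hu, fun u => rfl⟩

namespace PolygonalSurface

open FlatAtlas

variable {P : PolygonalSurface.{u}} {D₀ : P.FlatDisc}

namespace TransCover

open AlignedFrame

/-- A flat chart of the covering: it inverts the lifts of aligned frames up to translation. -/
def IsFlatChart (e : OpenPartialHomeomorph (TransCover D₀) ℂ) : Prop :=
  ∀ s ∈ e.source, ∃ F : AlignedFrame D₀, ∃ ζ ∈ leftHalf F.c, F.lift ζ = s ∧
    ∃ b : ℂ, ∀ᶠ u in 𝓝 (0 : ℂ), e (germ F.lift ζ u) = u + b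

theorem IsFlatChart.exists_translation {e : OpenPartialHomeomorph (TransCover D₀) ℂ}
    (he : IsFlatChart e) {F : AlignedFrame D₀} {ζ : ℂ} (hζ : ζ ∈ leftHalf F.c)
    (hs : F.lift ζ ∈ e.source) : ∃ b : ℂ, ∀ᶠ u in 𝓝 (0 : ℂ), e (germ F.lift ζ u) = u + b := by
  obtain ⟨G, ω, hω, h, b, hb⟩ := he _ hs
  refine ⟨b, ?_⟩
  filter_upwards [hb, lift_germ_eq hω hζ h] with u e1 e2
  rw [← e2, e1]

variable (D₀) in
/-- The flat structure of the covering; its transition maps are translations. -/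
noncomputable def flatAtlas : FlatAtlas (TransCover D₀) where
  charts := {e | IsFlatChart e}
  compat := by
    rintro e he e' he' s ⟨hs, hs'⟩
    obtain ⟨F, ζ, hζ, rfl, b, hb⟩ := he s hs
    obtain ⟨b', hb'⟩ := IsFlatChart.exists_translation he' hζ hs'
    refine ⟨1, b' - b, by simp, ?_⟩
    rw [← (polarTop_lift F).map_germ hζ, eventually_map]
    filter_upwards [hb, hb'] with u e1 e2
    rw [e1, e2]; ring

/-- The lift of a frame is injective on strips of width `2π`. -/
theorem injOn_lift (F : AlignedFrame D₀) (t : ℝ) :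
    InjOn F.lift {ζ | ζ ∈ leftHalf F.c ∧ |ζ.im - t| < Real.pi} := by
  rintro ζ ⟨hζ, h1⟩ ζ' ⟨hζ', h2⟩ h
  obtain ⟨n, -, rfl⟩ := (lift_eq_iff_shift F hζ hζ').1 h
  have h3 : |2 * Real.pi * (n : ℝ)| < 2 * Real.pi := by
    have : (shiftMap (2 * Real.pi * n) ζ).im = ζ.im + 2 * Real.pi * n := by simp
    rw [this] at h2
    rw [abs_lt] at *
    constructor <;> linarith
  rw [abs_mul, abs_of_pos Real.two_pi_pos, mul_lt_iff_lt_one_right Real.two_pi_pos] at h3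
  have : n = 0 := by
    have h4 : |n| < 1 := by exact_mod_cast h3
    exact Int.abs_lt_one_iff.1 h4
  simp [this]

/-- The lift of a frame, in the flat coordinate `u = exp - exp ζ`, is the inverse of a flat chart. -/
theorem exists_germ_chart (F : AlignedFrame D₀) {ζ : ℂ} (hζ : ζ ∈ leftHalf F.c) :
    ∃ e ∈ (flatAtlas D₀).charts, 0 ∈ e.target ∧ ∀ u, e.symm u = germ F.lift ζ u := by
  have hev : ∀ᶠ u in 𝓝 (0 : ℂ), lg ζ u ∈ leftHalf F.c ∧ ‖u‖ < ‖Complex.exp ζ‖ := by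
    refine ((tendsto_lg ζ).eventually (leftHalf_mem_nhds hζ)).and ?_
    filter_upwards [Metric.ball_mem_nhds (0 : ℂ) (norm_pos_iff.2 (Complex.exp_ne_zero ζ))]
      with u hu
    simpa using hu
  obtain ⟨r, hr, hr'⟩ := Metric.eventually_nhds_iff_ball.1 hev
  have hslit : ∀ u ∈ Metric.ball (0 : ℂ) r, 1 + u * Complex.exp (-ζ) ∈ Complex.slitPlane :=
    fun u hu => lg_mem_slit (hr' u hu).2
  have hinj : InjOn (lg ζ) (Metric.ball (0 : ℂ) r) := fun u hu v hv h => by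
    have hne : ∀ w ∈ Metric.ball (0 : ℂ) r, Complex.exp ζ + w ≠ 0 := fun w hw h0 => by
      have := (hr' w hw).2
      rw [← norm_neg, ← eq_neg_of_add_eq_zero_left h0] at this
      exact lt_irrefl _ this
    have := congrArg Complex.exp h
    rw [exp_lg (hne u hu), exp_lg (hne v hv)] at this
    exact add_left_cancel this
  have : Nonempty (TransCover D₀) := ⟨F.mk⟩
  obtain ⟨e, hsrc, htgt, he, he'⟩ := exists_chart (f := germ F.lift ζ) (U := Metric.ball 0 r)
    Metric.isOpen_ball
    (fun u hu => ((polarTop_lift F).continuousAt (hr' u hu).1).comp_continuousWithinAt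
      (continuousAt_lg (hslit u hu)).continuousWithinAt)
    ((injOn_lift F ζ.im).comp hinj fun u hu => ⟨(hr' u hu).1, by
      have : (lg ζ u).im - ζ.im = (1 + u * Complex.exp (-ζ)).arg := by
        simp [lg, Complex.log_im]
      rw [this]
      refine (Complex.abs_arg_le_pi _).lt_of_ne fun h => ?_
      have hs := Complex.mem_slitPlane_iff_arg.1 (hslit u hu)
      rcases (abs_eq Real.pi_pos.le).1 h with h | h
      · exact hs.1 h
      · exact (Complex.neg_pi_lt_arg _).ne' h⟩)
    (fun V hV hVr => by
      change IsOpen ((fun u => F.lift (lg ζ u)) '' V)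
      rw [← image_image F.lift]
      exact (polarTop_lift F).2.1 _ (isOpen_image_lg hV fun v hv => (hr' v (hVr hv)).2)
        (image_subset_iff.2 fun v hv => (hr' v (hVr hv)).1))
  refine ⟨e, ?_, by rw [htgt]; exact Metric.mem_ball_self hr, he'⟩
  intro s hs
  rw [hsrc] at hs
  obtain ⟨u, hu, rfl⟩ := hs
  refine ⟨F, lg ζ u, (hr' u hu).1, rfl, u, ?_⟩
  filter_upwards [germ_add F.lift (hslit u hu),
    (tendsto_add_zero u).eventually (Metric.isOpen_ball.mem_nhds hu)] with v h1 h2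
  rw [← h1, he _ h2, add_comm]

theorem polarFlatAt_lift (F : AlignedFrame D₀) {ζ : ℂ} (hζ : ζ ∈ leftHalf F.c) :
    (flatAtlas D₀).PolarFlatAt F.lift ζ := by
  obtain ⟨e, he, h0, he'⟩ := exists_germ_chart F hζ
  refine ⟨e, he, planeMap 1 (-Complex.exp ζ), by simpa using h0, ?_⟩
  filter_upwards [eventually_lg_exp_sub ζ] with ω hω
  rw [he', germ, planeMap_apply]
  change F.lift ω = F.lift (lg ζ (Complex.exp ω + -Complex.exp ζ))
  rw [← sub_eq_add_neg, hω]

/-- The lift of an aligned frame is a cone chart, whose angle is a multiple of `2π`. -/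
theorem exists_isConeChart (hfin : Finite D₀.rotHol) (F : AlignedFrame D₀) : ∃ k : ℕ, 0 < k ∧
    (flatAtlas D₀).IsConeChart F.mk (2 * Real.pi * k) F.c F.lift := by
  obtain ⟨k, hk, hsym, hsym'⟩ := exists_cone hfin F
  refine ⟨k, hk, by positivity, polarTop_lift F, fun ζ hζ ζ' hζ' => ?_,
    fun ζ hζ => polarFlatAt_lift F hζ⟩
  rw [lift_eq_iff_shift F hζ hζ']
  constructor
  · rintro ⟨n, hn, rfl⟩
    obtain ⟨m, rfl⟩ := hsym' n hn
    refine ⟨m, ?_⟩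
    simp; ring
  · rintro ⟨m, rfl⟩
    refine ⟨m * k, hsym m, ?_⟩
    simp; ring

theorem isFrame_lift (hfin : Finite D₀.rotHol) (F : AlignedFrame D₀) :
    (flatAtlas D₀).IsFrame F.mk F.c F.lift := by
  obtain ⟨k, -, h⟩ := exists_isConeChart hfin F
  exact h.isFrame

/-! ### Connectedness of the covering -/

theorem isPreconnected_disc (F : AlignedFrame D₀) : IsPreconnected (polarDisc F.mk F.c F.lift) := by
  refine ((isPreconnected_leftHalf F.c).image _ (polarTop_lift F).1).subset_closure
    (subset_insert _ _) (insert_subset ?_ subset_closure)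
  rw [mem_closure_iff_nhds_basis (polarTop_lift F).2.2.2]
  intro a ha
  exact ⟨F.lift ((a - 1 : ℝ) : ℂ), ⟨_, leftHalf_mono ha (real_mem_leftHalf (by linarith)), rfl⟩,
    mem_insert_of_mem _ ⟨_, real_mem_leftHalf (by linarith), rfl⟩⟩

/-- The frame `F` is, near its apex, the disc `E` in polar coordinates about `z`. -/
def IsOf (E : P.FlatDisc) (z : ℂ) (F : AlignedFrame D₀) : Prop :=
  F.pt = E.map z ∧ ∀ᶠ u in 𝓝 (0 : ℂ), ∀ ω, Complex.exp ω = u → F.q ω = E.map (z + u)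

theorem IsOf.congr {E E' : P.FlatDisc} {z : ℂ} {F : AlignedFrame D₀} (h : IsOf E z F)
    (h' : ∀ᶠ w in 𝓝 z, E'.map w = E.map w) : IsOf E' z F := by
  refine ⟨h.1.trans h'.self_of_nhds.symm, ?_⟩
  filter_upwards [h.2, (tendsto_add_zero z).eventually h'] with u e1 e2 ω hω
  rw [e1 ω hω, e2]

theorem exists_isOf {E : P.FlatDisc} (hE : D₀.Develops E 1) {z : ℂ} (hz : z ∈ E.ball) :
    ∃ F : AlignedFrame D₀, IsOf E z F := by
  obtain ⟨b, hb⟩ := (E.regAt hz).isFrame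
  refine ⟨⟨E.map z, b, _, hb, ?_⟩, rfl, Eventually.of_forall fun u ω hω => by rw [← hω]⟩
  obtain ⟨a, ha⟩ := exists_leftHalf_of_eventually
    ((tendsto_add_zero z).eventually (E.isOpen_ball.mem_nhds hz))
  have hω : ((min a b - 1 : ℝ) : ℂ) ∈ leftHalf (min a b) := real_mem_leftHalf (by linarith)
  refine ⟨_, leftHalf_mono (min_le_right _ _) hω, E, _, hE,
    ha _ (leftHalf_mono (min_le_left _ _) hω), ?_⟩
  filter_upwards [eventually_ne_neg_exp ((min a b - 1 : ℝ) : ℂ)] with u hu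
  rw [germ, exp_lg hu, add_assoc]

theorem IsOf.mk_eq {E : P.FlatDisc} {z : ℂ} {F G : AlignedFrame D₀} (hF : IsOf E z F)
    (hG : IsOf E z G) : F.mk = G.mk := by
  obtain ⟨a, ha⟩ := exists_leftHalf_of_eventually (hF.2.and hG.2)
  refine mk_eq_mk.2 ⟨hF.1.trans hG.1.symm, a, 0, fun ω hω => ?_⟩
  have := ha ω hω
  rw [this.2 ω rfl]
  simpa using (this.1 ω rfl).symm

theorem connectedComponent_lift (F : AlignedFrame D₀) {s : TransCover D₀}
    (hs : s ∈ polarDisc F.mk F.c F.lift) : connectedComponent s = connectedComponent F.mk :=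
  (connectedComponent_eq ((isPreconnected_disc F).subset_connectedComponent
    (mem_insert _ _) hs)).symm

/-- The points of the covering that are given by a flat disc parallel to `D₀` lie in one
component. -/
theorem IsOf.connectedComponent_eq {E : P.FlatDisc} (hE : D₀.Develops E 1) {z z' : ℂ}
    (hz : z ∈ E.ball) (hz' : z' ∈ E.ball) {F G : AlignedFrame D₀} (hF : IsOf E z F)
    (hG : IsOf E z' G) : connectedComponent F.mk = connectedComponent G.mk := by
  let ρ : ℂ → Set (TransCover D₀) → Prop := fun w C =>
    ∀ H : AlignedFrame D₀, IsOf E w H → connectedComponent H.mk = C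
  have key : ∀ w ∈ E.ball, ∃ C, ∀ᶠ w' in 𝓝 w, ρ w' C := by
    intro w hw
    obtain ⟨H, hH⟩ := exists_isOf hE hw
    refine ⟨connectedComponent H.mk, ?_⟩
    have h1 : ∀ᶠ u in 𝓝 (0 : ℂ), ∀ ω, Complex.exp ω = u → ω ∈ leftHalf H.c := by
      filter_upwards [Metric.ball_mem_nhds (0 : ℂ) (Real.exp_pos H.c)] with u hu ω hω
      rw [← hω, ← mem_leftHalf_log_iff (Real.exp_pos _), Real.log_exp] at hu
      exact hu
    have h2 : ∀ᶠ u in 𝓝 (0 : ℂ), ρ (w + u) (connectedComponent H.mk) := by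
      filter_upwards [h1, hH.2.eventually_nhds] with u e1 e2 K hK
      by_cases hu : u = 0
      · rw [hu, add_zero] at hK
        rw [hK.mk_eq hH]
      · have h3 := e1 _ (Complex.exp_log hu)
        refine connectedComponent_lift H (mem_insert_of_mem _ ⟨Complex.log u, h3, ?_⟩)
        rw [lift_eq_mk h3]
        refine ⟨?_, ?_⟩
        · rw [e2.self_of_nhds _ (Complex.exp_log hu), hK.1]
        · obtain ⟨a, ha⟩ := exists_leftHalf_of_eventually (hK.2.and
            (((tendsto_add_zero u).eventually e2).and (eventually_ne_neg_exp (Complex.log u))))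
          refine ⟨a, fun ω hω => ?_⟩
          obtain ⟨a1, a2, a3⟩ := ha ω hω
          rw [a1 ω rfl, germ, a2 _ (by rw [exp_lg a3, Complex.exp_log hu]), add_assoc]
    have ht : Tendsto (fun w' : ℂ => w' - w) (𝓝 w) (𝓝 0) := by
      have : Continuous (fun w' : ℂ => w' - w) := by fun_prop
      simpa using this.tendsto w
    filter_upwards [ht.eventually h2] with w' hw'
    rwa [add_sub_cancel] at hw'
  have huniq : ∀ w ∈ E.ball, ∀ C C', ρ w C → ρ w C' → C = C' := fun w hw C C' h h' => by
    obtain ⟨H, hH⟩ := exists_isOf hE hw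
    exact (h H hH).symm.trans (h' H hH)
  have hpre : IsPreconnected E.ball := (convex_ball _ _).isPreconnected
  obtain ⟨C, hC⟩ := key z hz
  have := hpre.forall_of_local (ρ := ρ) (fun w hw => (key w hw).imp fun C h => h.self_of_nhds)
    (fun w hw C h => by
      obtain ⟨C', h'⟩ := key w hw
      rw [huniq w hw C C' h h'.self_of_nhds]
      exact mem_nhdsWithin_of_mem_nhds h')
    (fun w hw w' hw' C C' h h' h'' => huniq w hw C C' h h' ▸ h'') hz hC.self_of_nhds z' hz'
  rw [hC.self_of_nhds F hF, this G hG]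

/-- Following a development along a path does not leave the component; the disc `E.comp g` is `E`,
turned back so that it is parallel to `D₀`. -/
theorem IsOf.connectedComponent_eq_of_develops {E : P.FlatDisc} {g : PlaneIso}
    (hE : D₀.Develops E g) {G : AlignedFrame D₀} (hG : IsOf D₀ D₀.center G) {z : ℂ}
    (hz : z ∈ (E.comp g).ball) {F : AlignedFrame D₀} (hF : IsOf (E.comp g) z F) :
    connectedComponent F.mk = connectedComponent G.mk := by
  induction hE generalizing z F with
  | refl => exact IsOf.connectedComponent_eq .refl hz D₀.center_mem hF hG
  | @step E E' g h hE hadj ih =>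
    obtain ⟨w, hw, hw', hev⟩ := hadj
    have hw1 : g⁻¹ w ∈ (E.comp g).ball := by
      rw [FlatDisc.mem_ball_comp]; rwa [PlaneIso.apply_inv_self]
    have hw2 : g⁻¹ w ∈ (E'.comp (h * g)).ball := by
      rw [FlatDisc.mem_ball_comp, PlaneIso.mul_apply]; rwa [PlaneIso.apply_inv_self]
    obtain ⟨K, hK⟩ := exists_isOf hE.comp hw1
    have ht : Tendsto g (𝓝 (g⁻¹ w)) (𝓝 w) := by
      simpa [PlaneIso.apply_inv_self] using g.continuous.tendsto (g⁻¹ w)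
    have hK' : IsOf (E'.comp (h * g)) (g⁻¹ w) K := hK.congr (by
      filter_upwards [ht.eventually hev] with v hv
      exact hv.symm)
    rw [IsOf.connectedComponent_eq (hE.step ⟨w, hw, hw', hev⟩).comp hz hw2 hF hK']
    exact ih hw1 hK

instance : ConnectedSpace (TransCover D₀) := by
  -- each point is near a point given by a disc to which `D₀` develops without rotation
  obtain ⟨G, hG⟩ := exists_isOf (D₀ := D₀) .refl D₀.center_mem
  have : Nonempty (TransCover D₀) := ⟨G.mk⟩
  refine connectedSpace_iff_connectedComponent.2 ⟨G.mk, eq_univ_of_forall fun s => ?_⟩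
  obtain ⟨F, rfl⟩ := exists_mk s
  have hζ : ((F.c - 1 : ℝ) : ℂ) ∈ leftHalf F.c := real_mem_leftHalf (by linarith)
  obtain ⟨E, z, hE, hz, h⟩ := F.aligned.all F.frame _ hζ
  have h0 : IsOf E z (F.recenter hζ) := by
    refine ⟨by simpa [recenter] using h.self_of_nhds, ?_⟩
    filter_upwards [h] with u hu ω hω
    rw [← hu, ← hω]; rfl
  have h1 : connectedComponent (F.recenter hζ).mk = connectedComponent G.mk := by
    refine IsOf.connectedComponent_eq_of_develops hE hG (z := z) ?_ ?_
    · rwa [FlatDisc.mem_ball_comp]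
    · exact h0.congr (Eventually.of_forall fun w => rfl)
  rw [← F.lift_eq hζ, connectedComponent_lift F (mem_insert_of_mem _ ⟨_, hζ, rfl⟩)] at h1
  rw [← h1]
  exact mem_connectedComponent

end TransCover

end PolygonalSurface

/-! ### Rectangles with marked boundary points -/

/-- The real part (`true`) or the imaginary part (`false`). -/
def coord : Bool → ℂ → ℝ
  | true => Complex.re
  | false => Complex.im

/-- The point with coordinates `coord k = t` and `coord (!k) = h`. -/
def mkPt : Bool → ℝ → ℝ → ℂ
  | true, h, t => ⟨t, h⟩
  | false, h, t => ⟨h, t⟩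

@[simp] theorem coord_mkPt (k : Bool) (h t : ℝ) : coord k (mkPt k h t) = t := by cases k <;> rfl

@[simp] theorem coord_not_mkPt (k : Bool) (h t : ℝ) : coord (!k) (mkPt k h t) = h := by
  cases k <;> rfl

@[simp] theorem coord_add (k : Bool) (z w : ℂ) : coord k (z + w) = coord k z + coord k w := by
  cases k <;> rfl

@[simp] theorem coord_sub (k : Bool) (z w : ℂ) : coord k (z - w) = coord k z - coord k w := by
  cases k <;> rfl

theorem continuous_coord (k : Bool) : Continuous (coord k) := by
  cases k
  exacts [Complex.continuous_im, Complex.continuous_re]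

theorem eq_mkPt (k : Bool) (z : ℂ) : z = mkPt k (coord (!k) z) (coord k z) := by cases k <;> rfl

theorem continuous_mkPt (k : Bool) (h : ℝ) : Continuous (mkPt k h) := by
  have h0 : mkPt k h = fun t => mkPt k h 0 + t • mkPt k 0 1 := by
    ext t; cases k <;> apply Complex.ext <;> simp [mkPt]
  rw [h0]; fun_prop

theorem extremePoints_segment {E : Type*} [AddCommGroup E] [Module ℝ E] (x y : E) :
    (segment ℝ x y).extremePoints ℝ = {x, y} := by
  have key : ∀ x y : E, x ∈ (segment ℝ x y).extremePoints ℝ := fun x y => by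
    rw [mem_extremePoints_iff_left]
    refine ⟨left_mem_segment ℝ x y, ?_⟩
    rw [segment_eq_image']
    rintro _ ⟨s, hs, rfl⟩ _ ⟨t, ht, rfl⟩ ⟨a, b, ha, hb, hab, h⟩
    have h1 : (a * s + b * t) • (y - x) = 0 := by
      have : a • (x + s • (y - x)) + b • (x + t • (y - x)) =
        (a + b) • x + (a * s + b * t) • (y - x) := by module
      rw [this, hab, one_smul] at h
      exact left_eq_add.1 h.symm
    rcases smul_eq_zero.1 h1 with h1 | h1
    · have hs0 : s = 0 := by
        by_contra hne
        have := mul_pos ha (lt_of_le_of_ne hs.1 (Ne.symm hne))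
        nlinarith [mul_nonneg hb.le ht.1]
      simp [hs0]
    · simp [h1]
  refine Subset.antisymm (fun z hz => ?_) ?_
  · rw [mem_extremePoints_iff_left] at hz
    by_contra hne
    rw [mem_insert_iff, mem_singleton_iff, not_or] at hne
    have := mem_openSegment_of_ne_left_right (Ne.symm hne.1) (Ne.symm hne.2) hz.1
    exact hne.1 (hz.2 _ (left_mem_segment ℝ x y) _ (right_mem_segment ℝ x y) this).symm
  · rintro z (rfl | rfl)
    · exact key _ _
    · rw [segment_symm]; exact key _ _

theorem mem_segment_mkPt {k : Bool} {h p p' : ℝ} (hp : p < p') {z : ℂ} :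
    z ∈ segment ℝ (mkPt k h p) (mkPt k h p') ↔ coord (!k) z = h ∧ coord k z ∈ Icc p p' := by
  rw [segment_eq_image']
  constructor
  · rintro ⟨t, ht, rfl⟩
    have e : mkPt k h p + t • (mkPt k h p' - mkPt k h p) = mkPt k h (p + t * (p' - p)) := by
      cases k <;> apply Complex.ext <;> simp [mkPt]
    simp only [e, coord_mkPt, coord_not_mkPt, true_and, mem_Icc]
    constructor <;> nlinarith [ht.1, ht.2]
  · rintro ⟨h1, h2⟩
    have hd : 0 < p' - p := sub_pos.2 hp
    refine ⟨(coord k z - p) / (p' - p), ⟨div_nonneg (by linarith [h2.1]) hd.le,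
      (div_le_one hd).2 (by linarith [h2.2])⟩, ?_⟩
    have e : ∀ t : ℝ, mkPt k h p + t • (mkPt k h p' - mkPt k h p) =
        mkPt k h (p + t * (p' - p)) := fun t => by
      cases k <;> apply Complex.ext <;> simp [mkPt]
    simp only [e]
    rw [div_mul_cancel₀ _ hd.ne', add_sub_cancel, ← h1, ← eq_mkPt]

/-- `p < p'` are consecutive elements of `s`. -/
def Consec (s : Set ℝ) (p p' : ℝ) : Prop := p ∈ s ∧ p' ∈ s ∧ p < p' ∧ Disjoint s (Ioo p p')

theorem Consec.unique {s : Set ℝ} {p p' r r' t : ℝ} (h : Consec s p p') (h' : Consec s r r')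
    (ht : t ∈ Ioo p p') (ht' : t ∈ Ioo r r') : p = r ∧ p' = r' := by
  have key : ∀ {p p' r r' : ℝ}, Consec s p p' → Consec s r r' → t ∈ Ioo p p' → t ∈ Ioo r r' →
      p ≤ r ∧ r' ≤ p' := fun {p p' r r'} h h' ht ht' =>
    ⟨not_lt.1 fun hlt => disjoint_left.1 h'.2.2.2 h.1 ⟨hlt, ht.1.trans ht'.2⟩,
      not_lt.1 fun hlt => disjoint_left.1 h'.2.2.2 h.2.1 ⟨ht'.1.trans ht.2, hlt⟩⟩
  exact ⟨(key h h' ht ht').1.antisymm (key h' h ht' ht).1,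
    (key h' h ht' ht).2.antisymm (key h h' ht ht').2⟩

theorem exists_consec {s : Set ℝ} (hs : s.Finite) {a b t : ℝ} (ha : a ∈ s) (hb : b ∈ s)
    (hat : a ≤ t) (htb : t < b) : ∃ p p', Consec s p p' ∧ p ≤ t ∧ t < p' := by
  obtain ⟨p, ⟨hp, hpt⟩, hmax⟩ := (hs.subset (sep_subset s (· ≤ t))).exists_maximal ⟨a, ha, hat⟩
  obtain ⟨p', ⟨hp', hpt'⟩, hmin⟩ := (hs.subset (sep_subset s (t < ·))).exists_minimal ⟨b, hb, htb⟩
  refine ⟨p, p', ⟨hp, hp', hpt.trans_lt hpt', disjoint_left.2 fun r hr h => ?_⟩, hpt, hpt'⟩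
  rcases le_or_gt r t with hrt | hrt
  · exact (hmax ⟨hr, hrt⟩ h.1.le).not_gt h.1
  · exact (hmin ⟨hr, hrt⟩ h.2.le).not_gt h.2

theorem exists_consec' {s : Set ℝ} (hs : s.Finite) {a b t : ℝ} (ha : a ∈ s) (hb : b ∈ s)
    (hab : a < b) (ht : t ∈ Icc a b) : ∃ p p', Consec s p p' ∧ t ∈ Icc p p' := by
  rcases ht.2.lt_or_eq with h | rfl
  · obtain ⟨p, p', h1, h2, h3⟩ := exists_consec hs ha hb ht.1 h
    exact ⟨p, p', h1, h2, h3.le⟩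
  · obtain ⟨p, ⟨hp, hpt⟩, hmax⟩ := (hs.subset (sep_subset s (· < t))).exists_maximal ⟨a, ha, hab⟩
    exact ⟨p, t, ⟨hp, hb, hpt, disjoint_left.2 fun r hr h =>
      (hmax ⟨hr, h.2⟩ h.1.le).not_gt h.1⟩, hpt.le, le_rfl⟩

/-- A rectangle with sides parallel to the axes, `lo k ≤ coord k ≤ hi k`. -/
structure Box where
  lo : Bool → ℝ
  hi : Bool → ℝ
  lt : ∀ k, lo k < hi k

namespace Box

variable (B : Box)

/-- The closed rectangle. -/
def carrier : Set ℂ := {z | ∀ k, coord k z ∈ Icc (B.lo k) (B.hi k)}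

/-- The open rectangle. -/
def inner : Set ℂ := {z | ∀ k, coord k z ∈ Ioo (B.lo k) (B.hi k)}

/-- The four corners of a rectangle. -/
def corners : Set ℂ := {z | ∀ k, coord k z = B.lo k ∨ coord k z = B.hi k}

theorem carrier_eq : B.carrier = Icc (B.lo true) (B.hi true) ×ℂ Icc (B.lo false) (B.hi false) := by
  ext z
  simp only [carrier, mem_ofPred_eq, Bool.forall_bool, Complex.mem_reProdIm]
  exact and_comm

theorem inner_eq : B.inner = Ioo (B.lo true) (B.hi true) ×ℂ Ioo (B.lo false) (B.hi false) := by
  ext z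
  simp only [inner, mem_ofPred_eq, Bool.forall_bool, Complex.mem_reProdIm]
  exact and_comm

theorem interior_carrier : interior B.carrier = B.inner := by
  rw [carrier_eq, Complex.interior_reProdIm, interior_Icc, interior_Icc, inner_eq]

theorem closure_inner : closure B.inner = B.carrier := by
  rw [carrier_eq, inner_eq, Complex.closure_reProdIm, closure_Ioo (B.lt _).ne,
    closure_Ioo (B.lt _).ne]

theorem isClosed : IsClosed B.carrier := B.closure_inner ▸ isClosed_closure

theorem isOpen_inner : IsOpen B.inner := B.interior_carrier ▸ isOpen_interior

theorem inner_subset : B.inner ⊆ B.carrier := B.interior_carrier ▸ interior_subset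

theorem isCompact : IsCompact B.carrier := by
  rw [carrier_eq]; exact isCompact_Icc.reProdIm isCompact_Icc

theorem nonempty_inner : B.inner.Nonempty :=
  ⟨⟨(B.lo true + B.hi true) / 2, (B.lo false + B.hi false) / 2⟩, fun k => by
    have h1 := B.lt true
    have h2 := B.lt false
    cases k <;> constructor <;> simp only [coord] <;> linarith⟩

theorem convex_inner : Convex ℝ B.inner := by
  intro z hz w hw a b ha hb hab k
  have e : coord k (a • z + b • w) = a • coord k z + b • coord k w := by
    cases k <;> simp [coord]
  rw [e]
  exact convex_Ioo _ _ (hz k) (hw k) ha hb hab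

theorem isConnected_inner : IsConnected B.inner :=
  ⟨B.nonempty_inner, B.convex_inner.isPreconnected⟩

theorem frontier_eq : frontier B.carrier = B.carrier \ B.inner := by
  rw [B.isClosed.frontier_eq, interior_carrier]

theorem exists_edge {z : ℂ} (hz : z ∈ B.carrier \ B.inner) :
    ∃ k, coord (!k) z = B.lo (!k) ∨ coord (!k) z = B.hi (!k) := by
  have := hz.2
  simp only [inner, mem_ofPred_eq, not_forall] at this
  obtain ⟨k, hk⟩ := this
  refine ⟨!k, ?_⟩
  rw [Bool.not_not]
  by_contra! h
  exact hk ⟨lt_of_le_of_ne (hz.1 k).1 h.1.symm, lt_of_le_of_ne (hz.1 k).2 h.2⟩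

theorem mem_edge {k : Bool} {h t : ℝ} (hh : h = B.lo (!k) ∨ h = B.hi (!k))
    (ht : t ∈ Icc (B.lo k) (B.hi k)) : mkPt k h t ∈ B.carrier \ B.inner := by
  refine ⟨fun j => ?_, fun hi => ?_⟩
  · have : j = k ∨ j = !k := by cases j <;> cases k <;> simp
    rcases this with rfl | rfl
    · rwa [coord_mkPt]
    · rw [coord_not_mkPt]
      have := (B.lt (!k)).le
      rcases hh with rfl | rfl
      exacts [⟨le_rfl, this⟩, ⟨this, le_rfl⟩]
  · have := hi (!k)
    rw [coord_not_mkPt] at this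
    rcases hh with rfl | rfl
    exacts [lt_irrefl _ this.1, lt_irrefl _ this.2]

theorem corners_subset : B.corners ⊆ B.carrier \ B.inner := fun z hz => by
  rw [eq_mkPt true z]
  refine B.mem_edge (hz _) ?_
  have := (B.lt true).le
  rcases hz true with h | h <;> rw [h]
  exacts [⟨le_rfl, this⟩, ⟨this, le_rfl⟩]

theorem corner_mem {k : Bool} {h t : ℝ} (hh : h = B.lo (!k) ∨ h = B.hi (!k))
    (ht : t = B.lo k ∨ t = B.hi k) : mkPt k h t ∈ B.corners := fun j => by
  have : j = k ∨ j = !k := by cases j <;> cases k <;> simp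
  rcases this with rfl | rfl
  · rwa [coord_mkPt]
  · rwa [coord_not_mkPt]

theorem finite_corners : B.corners.Finite := by
  refine ((({B.lo true, B.hi true} : Set ℝ).toFinite.prod
    ({B.lo false, B.hi false} : Set ℝ).toFinite).image fun v => mkPt true v.2 v.1).subset ?_
  intro z hz
  exact ⟨(coord true z, coord false z), ⟨hz true, hz false⟩, rfl⟩

/-- The part of the edge `coord (!k) = h` that is marked by `M`. -/
def marks (M : Set ℂ) (k : Bool) (h : ℝ) : Set ℝ := {t | mkPt k h t ∈ M}

/-- The segments into which the boundary of a rectangle is divided by the marked points. -/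
def sides (M : Set ℂ) : Set (Set ℂ) :=
  {s | ∃ k h p p', (h = B.lo (!k) ∨ h = B.hi (!k)) ∧ Consec (marks M k h) p p' ∧
    s = segment ℝ (mkPt k h p) (mkPt k h p')}

variable {B} {M : Set ℂ}

theorem mkPt_injective (k : Bool) (h : ℝ) : Function.Injective (mkPt k h) := fun t t' e => by
  simpa using congrArg (coord k) e

theorem finite_marks (hM : M.Finite) (k : Bool) (h : ℝ) : (marks M k h).Finite :=
  hM.preimage (mkPt_injective k h).injOn

theorem marks_subset (hMB : M ⊆ B.carrier \ B.inner) (k : Bool) (h : ℝ) :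
    marks M k h ⊆ Icc (B.lo k) (B.hi k) := fun t ht => by
  have := (hMB ht).1 k
  rwa [coord_mkPt] at this

theorem exists_side (hM : M.Finite) (hMc : B.corners ⊆ M) {k : Bool} {h t : ℝ}
    (hh : h = B.lo (!k) ∨ h = B.hi (!k)) (ht : t ∈ Icc (B.lo k) (B.hi k)) :
    ∃ p p', Consec (marks M k h) p p' ∧ t ∈ Icc p p' :=
  exists_consec' (finite_marks hM k h) (hMc (B.corner_mem hh (.inl rfl)))
    (hMc (B.corner_mem hh (.inr rfl))) (B.lt k) ht

theorem exists_mem_side (hM : M.Finite) (hMc : B.corners ⊆ M) {z : ℂ}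
    (hz : z ∈ B.carrier \ B.inner) : ∃ k p p', (coord (!k) z = B.lo (!k) ∨ coord (!k) z = B.hi (!k)) ∧
      Consec (marks M k (coord (!k) z)) p p' ∧ coord k z ∈ Icc p p' := by
  obtain ⟨k, hk⟩ := B.exists_edge hz
  obtain ⟨p, p', h, h'⟩ := exists_side hM hMc hk (hz.1 k)
  exact ⟨k, p, p', hk, h, h'⟩

theorem sideEnds_segment (x y : ℂ) : sideEnds (segment ℝ x y) = {x, y} := extremePoints_segment x y

/-- The end points of a side are its marked points. -/
theorem mem_sideEnds {s : Set ℂ} (hs : s ∈ B.sides M) {z : ℂ} (hz : z ∈ s) :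
    z ∈ sideEnds s ↔ z ∈ M := by
  obtain ⟨k, h, p, p', hh, hc, rfl⟩ := hs
  rw [sideEnds_segment]
  rw [mem_segment_mkPt hc.2.2.1] at hz
  have e : z = mkPt k h (coord k z) := hz.1 ▸ eq_mkPt k z
  constructor
  · rintro (h | h) <;> rw [h]
    exacts [hc.1, hc.2.1]
  · intro hzM
    have h1 : coord k z ∈ marks M k h := by rw [e] at hzM; exact hzM
    have h2 := disjoint_left.1 hc.2.2.2 h1
    rw [mem_insert_iff, mem_singleton_iff]
    by_contra! hne
    refine h2 ⟨lt_of_le_of_ne hz.2.1 fun h => hne.1 ?_, lt_of_le_of_ne hz.2.2 fun h => hne.2 ?_⟩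
    · rw [h, ← e]
    · rw [← h, ← e]

/-- A rectangle is a polygon with the segments between neighbouring marked boundary points as
sides, where the corners are marked. -/
theorem isPolygon (hM : M.Finite) (hMB : M ⊆ B.carrier \ B.inner) (hMc : B.corners ⊆ M) :
    IsPolygon B.carrier (B.sides M) where
  closed := B.isClosed
  region := by rw [interior_carrier, closure_inner]
  connected := by rw [interior_carrier]; exact B.isConnected_inner
  side := by
    rintro s ⟨k, h, p, p', hh, hc, rfl⟩
    refine ⟨?_, convex_segment _ _, ?_, ?_⟩
    · rw [segment_eq_image']
      exact (isCompact_Icc.image (by fun_prop)).isClosed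
    · rw [segment_eq_image', collinear_iff_exists_forall_eq_smul_vadd]
      refine ⟨mkPt k h p, mkPt k h p' - mkPt k h p, ?_⟩
      rintro _ ⟨t, -, rfl⟩
      exact ⟨t, add_comm _ _⟩
    · exact ⟨_, left_mem_segment ℝ _ _, _, right_mem_segment ℝ _ _, fun e =>
        hc.2.2.1.ne (mkPt_injective k h e)⟩
  boundary := by
    rw [frontier_eq]
    ext z
    constructor
    · intro hz
      obtain ⟨k, p, p', hk, hc, ht⟩ := exists_mem_side hM hMc hz
      exact ⟨_, ⟨k, _, p, p', hk, hc, rfl⟩, (mem_segment_mkPt hc.2.2.1).2 ⟨rfl, ht⟩⟩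
    · rintro ⟨_, ⟨k, h, p, p', hk, hc, rfl⟩, hz⟩
      rw [mem_segment_mkPt hc.2.2.1] at hz
      rw [eq_mkPt k z, hz.1]
      exact B.mem_edge hk ⟨(marks_subset hMB k h hc.1).1.trans hz.2.1,
        hz.2.2.trans (marks_subset hMB k h hc.2.1).2⟩
  meet := by
    intro s hs t ht hst z hz
    suffices hzM : z ∈ M from ⟨(mem_sideEnds hs hz.1).2 hzM, (mem_sideEnds ht hz.2).2 hzM⟩
    by_contra hzM
    obtain ⟨k, h, p, p', hk, hc, rfl⟩ := id hs
    obtain ⟨j, l, r, r', hj, hc', rfl⟩ := id ht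
    have hz1 := (mem_segment_mkPt hc.2.2.1).1 hz.1
    have hz2 := (mem_segment_mkPt hc'.2.2.1).1 hz.2
    have hne : ∀ {k : Bool} {h t}, coord (!k) z = h → t ∈ marks M k h → t ≠ coord k z :=
      fun {k h t} e ht h' => hzM (by rw [eq_mkPt k z, ← h', e]; exact ht)
    have h1 : coord k z ∈ Ioo p p' := ⟨lt_of_le_of_ne hz1.2.1 (hne hz1.1 hc.1),
      lt_of_le_of_ne hz1.2.2 (hne hz1.1 hc.2.1).symm⟩
    have h2 : coord j z ∈ Ioo r r' := ⟨lt_of_le_of_ne hz2.2.1 (hne hz2.1 hc'.1),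
      lt_of_le_of_ne hz2.2.2 (hne hz2.1 hc'.2.1).symm⟩
    have : j = k ∨ j = !k := by cases j <;> cases k <;> simp
    rcases this with rfl | rfl
    · obtain rfl := hz1.1.symm.trans hz2.1
      obtain ⟨rfl, rfl⟩ := hc.unique hc' h1 h2
      exact hst rfl
    · refine hzM (hMc fun i => ?_)
      have : i = k ∨ i = !k := by cases i <;> cases k <;> simp
      rcases this with rfl | rfl
      · have e := hz2.1
        rw [Bool.not_not] at e
        rw [Bool.not_not] at hj
        rwa [e]
      · rw [hz1.1]; exact hk
  locallyFinite := fun a => by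
    refine ((hM.prod hM).image fun v : ℂ × ℂ => segment ℝ v.1 v.2).subset ?_
    rintro s ⟨⟨k, h, p, p', hk, hc, rfl⟩, -⟩
    exact ⟨(_, _), ⟨hc.1, hc.2.1⟩, rfl⟩

end Box

/-! ### Tilings by rectangles are polygonal decompositions -/

/-- Near an inner point of an edge the rectangle is a half-plane, with inner normal direction `σ`. -/
theorem Box.eventually_halfPlane {B : Box} {z : ℂ} (hz : z ∈ B.carrier) (hc : z ∉ B.corners) {k : Bool}
    (hk : coord (!k) z = B.lo (!k) ∨ coord (!k) z = B.hi (!k)) :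
    ∃ σ : ℝ, (σ = 1 ∨ σ = -1) ∧ ∀ᶠ u in 𝓝 (0 : ℂ),
      (0 ≤ σ * coord (!k) u → z + u ∈ B.carrier) ∧ (0 < σ * coord (!k) u → z + u ∈ B.inner) := by
  have hk' : coord k z ∈ Ioo (B.lo k) (B.hi k) := by
    have := hz k
    refine ⟨lt_of_le_of_ne this.1 fun h => hc fun j => ?_,
      lt_of_le_of_ne this.2 fun h => hc fun j => ?_⟩ <;>
    · have : j = k ∨ j = !k := by cases j <;> cases k <;> simp
      rcases this with rfl | rfl
      · first | exact .inl h.symm | exact .inr h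
      · exact hk
  have ht : ∀ j, Tendsto (fun u => coord j z + coord j u) (𝓝 0) (𝓝 (coord j z)) := fun j => by
    have h0 : coord j 0 = 0 := by cases j <;> rfl
    have := ((continuous_coord j).const_add (coord j z)).tendsto 0
    simpa only [Function.comp_def, h0, add_zero] using this
  have hall : ∀ {p : Bool → Prop}, p k → p (!k) → ∀ j, p j := fun {p} h1 h2 j => by
    have : j = k ∨ j = !k := by cases j <;> cases k <;> simp
    rcases this with rfl | rfl <;> assumption
  have h1 := (ht k).eventually (isOpen_Ioo.mem_nhds hk')
  have hlt := B.lt (!k)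
  rcases hk with hk | hk
  · refine ⟨1, .inl rfl, ?_⟩
    filter_upwards [h1, (ht (!k)).eventually (gt_mem_nhds (hk.trans_lt hlt))] with u h1 h2
    rw [hk] at h2
    refine ⟨fun h => hall ?_ ?_, fun h => hall ?_ ?_⟩ <;> rw [coord_add]
    · exact ⟨h1.1.le, h1.2.le⟩
    · rw [hk]; exact ⟨by linarith, h2.le⟩
    · exact h1
    · rw [hk]; exact ⟨by linarith, h2⟩
  · refine ⟨-1, .inr rfl, ?_⟩
    filter_upwards [h1, (ht (!k)).eventually (lt_mem_nhds (hlt.trans_eq hk.symm))] with u h1 h2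
    rw [hk] at h2
    refine ⟨fun h => hall ?_ ?_, fun h => hall ?_ ?_⟩ <;> rw [coord_add]
    · exact ⟨h1.1.le, h1.2.le⟩
    · rw [hk]; exact ⟨h2.le, by linarith⟩
    · exact h1
    · rw [hk]; exact ⟨h2, by linarith⟩

/-- A locally finite tiling of a flat surface by rectangles: the rectangles `f i '' B i` do not
overlap, and where they meet, away from corners, their coordinates differ by a translation. -/
structure IsTiling {X : Type u} [TopologicalSpace X] (A : FlatAtlas X) {ι : Type} (B : ι → Box)
    (f : ι → ℂ → X) : Prop where
  continuousOn : ∀ i, ContinuousOn (f i) (B i).carrier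
  injOn : ∀ i, InjOn (f i) (B i).carrier
  locallyFinite : LocallyFinite fun i => f i '' (B i).carrier
  cover : ∀ x, ∃ i, x ∈ f i '' (B i).carrier
  flat : ∀ i, ∀ z ∈ (B i).inner, A.FlatAt (f i) z
  disjoint : ∀ i j, i ≠ j → ∀ z ∈ (B i).inner, ∀ w ∈ (B j).carrier, f i z ≠ f j w
  translation : ∀ i j, ∀ z ∈ (B i).carrier \ (B i).corners, ∀ w ∈ (B j).carrier \ (B j).corners,
    f i z = f j w → ∀ᶠ u in 𝓝 (0 : ℂ), z + u ∈ (B i).carrier → w + u ∈ (B j).carrier →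
      f i (z + u) = f j (w + u)

namespace IsTiling

/-- The vertices of a tiling: the images of the corners. -/
def vertices {X ι : Type*} (B : ι → Box) (f : ι → ℂ → X) : Set X := ⋃ i, f i '' (B i).corners

/-- The boundary points of a rectangle that are vertices of the tiling. -/
def marked {X ι : Type*} (B : ι → Box) (f : ι → ℂ → X) (i : ι) : Set ℂ :=
  {z | z ∈ (B i).carrier \ (B i).inner ∧ f i z ∈ vertices B f}

theorem corners_subset_marked {X ι : Type*} {B : ι → Box} {f : ι → ℂ → X} (i : ι) :
    (B i).corners ⊆ marked B f i := fun z hz =>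
  ⟨(B i).corners_subset hz, mem_iUnion.2 ⟨i, z, hz, rfl⟩⟩

variable {X : Type u} [TopologicalSpace X] {A : FlatAtlas X} {ι : Type} {B : ι → Box}
  {f : ι → ℂ → X}

/-- Away from corners, two rectangles meet along opposite sides. -/
theorem eventually_edge (H : IsTiling A B f) {i j : ι} (hij : i ≠ j) {z w : ℂ}
    (hz : z ∈ (B i).carrier \ (B i).corners) (hw : w ∈ (B j).carrier \ (B j).corners)
    (h : f i z = f j w) {k l : Bool}
    (hk : coord (!k) z = (B i).lo (!k) ∨ coord (!k) z = (B i).hi (!k))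
    (hl : coord (!l) w = (B j).lo (!l) ∨ coord (!l) w = (B j).hi (!l)) :
    k = l ∧ ∀ᶠ u in 𝓝 (0 : ℂ), coord (!k) u = 0 → w + u ∈ (B j).carrier ∧
      f i (z + u) = f j (w + u) := by
  obtain ⟨σ, hσ, h1⟩ := Box.eventually_halfPlane hz.1 hz.2 hk
  obtain ⟨τ, hτ, h2⟩ := Box.eventually_halfPlane hw.1 hw.2 hl
  have h3 := H.translation i j z hz w hw h
  -- no direction points into both rectangles
  have key : ∀ v : ℂ, ¬ (0 < σ * coord (!k) v ∧ 0 < τ * coord (!l) v) := by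
    rintro v ⟨hv, hv'⟩
    have ht : Tendsto (fun ε : ℝ => ε • v) (𝓝[>] 0) (𝓝 0) := by
      have : Tendsto (fun ε : ℝ => ε • v) (𝓝 0) (𝓝 0) := by
        have h0 : Continuous fun ε : ℝ => ε • v := by fun_prop
        simpa using h0.tendsto 0
      exact this.mono_left nhdsWithin_le_nhds
    obtain ⟨ε, ⟨⟨e1, e2⟩, e3⟩, hε⟩ := (((ht.eventually (h1.and h2)).and (ht.eventually h3)).and
      self_mem_nhdsWithin).exists
    have hε : 0 < ε := hε
    have hc : ∀ m, coord m (ε • v) = ε * coord m v := fun m => by cases m <;> simp [coord]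
    have a1 := e1.2 (by rw [hc, mul_left_comm]; exact mul_pos hε hv)
    have a2 := e2.2 (by rw [hc, mul_left_comm]; exact mul_pos hε hv')
    exact H.disjoint i j hij _ a1 _ ((B j).inner_subset a2)
      (e3 ((B i).inner_subset a1) ((B j).inner_subset a2))
  have hσ0 : 0 < σ * σ := by rcases hσ with rfl | rfl <;> norm_num
  have hτ0 : 0 < τ * τ := by rcases hτ with rfl | rfl <;> norm_num
  have hkl : k = l := by
    by_contra hne
    have hl' : (!l) = k := by cases k <;> cases l <;> simp_all
    refine key (mkPt k σ τ) ⟨by rwa [coord_not_mkPt], by rwa [hl', coord_mkPt]⟩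
  subst hkl
  refine ⟨rfl, ?_⟩
  filter_upwards [h1, h2, h3] with u e1 e2 e3 hu
  have a1 := e1.1 (by rw [hu, mul_zero])
  have a2 := e2.1 (by rw [hu, mul_zero])
  exact ⟨a2, e3 a1 a2⟩

/-- By local finiteness only finitely many vertices lie on a rectangle. -/
theorem finite_marked (H : IsTiling A B f) (i : ι) : (marked B f i).Finite := by
  have hcpt : IsCompact (f i '' (B i).carrier) := (B i).isCompact.image_of_continuousOn (H.continuousOn i)
  have h1 := H.locallyFinite.finite_nonempty_inter_compact hcpt
  have h2 : (⋃ j ∈ {j | (f j '' (B j).carrier ∩ f i '' (B i).carrier).Nonempty},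
      f j '' (B j).corners).Finite := h1.biUnion fun j _ => (B j).finite_corners.image _
  refine Set.Finite.of_finite_image (h2.subset ?_)
    ((H.injOn i).mono fun z (hz : z ∈ marked B f i) => hz.1.1)
  rintro _ ⟨z, hz, rfl⟩
  obtain ⟨j, w, hw, hwz⟩ := mem_iUnion.1 hz.2
  exact mem_biUnion (show j ∈ {j | (f j '' (B j).carrier ∩ f i '' (B i).carrier).Nonempty} from
    ⟨f i z, ⟨w, ((B j).corners_subset hw).1, hwz⟩, ⟨z, hz.1.1, rfl⟩⟩) ⟨w, hw, hwz⟩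

theorem interior_inj (H : IsTiling A B f) {i j : ι} {z w : ℂ} (hz : z ∈ (B i).inner)
    (hw : w ∈ (B j).carrier) (h : f i z = f j w) : (⟨i, z⟩ : Σ _ : ι, ℂ) = ⟨j, w⟩ := by
  by_cases hij : i = j
  · subst hij
    rw [H.injOn i ((B i).inner_subset hz) hw h]
  · exact absurd h (H.disjoint i j hij z hz w hw)

theorem not_mem_inner (H : IsTiling A B f) {i j : ι} {z w : ℂ} (hz : z ∈ (B i).carrier \ (B i).inner)
    (h : f i z = f j w) : w ∉ (B j).inner := fun hw' => by
  have := H.interior_inj hw' hz.1 h.symm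
  simp only [Sigma.mk.injEq, heq_eq_eq] at this
  obtain ⟨rfl, rfl⟩ := this
  exact hz.2 hw'

/-- A side of a rectangle is contained in a side of any rectangle that meets it in an inner
point. -/
theorem side_subset [T2Space X] (H : IsTiling A B f) {i j : ι} (hij : i ≠ j) {k l : Bool}
    {h g p p' r r' : ℝ}
    (hk : h = (B i).lo (!k) ∨ h = (B i).hi (!k)) (hl : g = (B j).lo (!l) ∨ g = (B j).hi (!l))
    (hp : Consec (Box.marks (marked B f i) k h) p p')
    (hr : Consec (Box.marks (marked B f j) l g) r r') {t s : ℝ} (ht : t ∈ Ioo p p')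
    (hs : s ∈ Ioo r r') (hf : f i (mkPt k h t) = f j (mkPt l g s)) :
    k = l ∧ r ≤ p + (s - t) ∧ p' + (s - t) ≤ r' ∧
      ∀ t' ∈ Icc p p', f i (mkPt k h t') = f j (mkPt l g (t' + (s - t))) := by
  have hM : ∀ i, marked B f i ⊆ (B i).carrier \ (B i).inner := fun i z hz => hz.1
  have hpI : ∀ t ∈ Icc p p', t ∈ Icc ((B i).lo k) ((B i).hi k) := fun t ht =>
    ⟨(Box.marks_subset (hM i) k h hp.1).1.trans ht.1,
      ht.2.trans (Box.marks_subset (hM i) k h hp.2.1).2⟩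
  have hrI : ∀ t ∈ Icc r r', t ∈ Icc ((B j).lo l) ((B j).hi l) := fun t ht =>
    ⟨(Box.marks_subset (hM j) l g hr.1).1.trans ht.1,
      ht.2.trans (Box.marks_subset (hM j) l g hr.2.1).2⟩
  have hzi : ∀ t ∈ Ioo p p', mkPt k h t ∈ (B i).carrier \ (B i).corners ∧
      f i (mkPt k h t) ∉ vertices B f := fun t ht => by
    have h1 := (B i).mem_edge hk (hpI t ⟨ht.1.le, ht.2.le⟩)
    have h2 : mkPt k h t ∉ marked B f i := fun hm => disjoint_left.1 hp.2.2.2 hm ht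
    exact ⟨⟨h1.1, fun hc => h2 (corners_subset_marked i hc)⟩, fun hv => h2 ⟨h1, hv⟩⟩
  have hwj : ∀ w ∈ (B j).carrier, f j w ∉ vertices B f → w ∈ (B j).carrier \ (B j).corners :=
    fun w hw hv => ⟨hw, fun hc => hv (mem_iUnion.2 ⟨j, w, hc, rfl⟩)⟩
  have hkl : k = l := by
    have h2 := (B j).mem_edge hl (hrI s ⟨hs.1.le, hs.2.le⟩)
    refine (H.eventually_edge hij (hzi t ht).1
      (hwj _ h2.1 (hf ▸ (hzi t ht).2)) hf ?_ ?_).1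
    · rwa [coord_not_mkPt]
    · rwa [coord_not_mkPt]
  subst hkl
  -- the points of the side where the two rectangles meet
  set a := {t' | t' ∈ Icc p p' ∩ (fun t' => mkPt k g (t' + (s - t))) ⁻¹' (B j).carrier ∧
    f i (mkPt k h t') = f j (mkPt k g (t' + (s - t)))} with ha
  have hcont : Continuous fun t' => mkPt k g (t' + (s - t)) :=
    (continuous_mkPt k g).comp (by fun_prop)
  have hK : IsClosed (Icc p p' ∩ (fun t' => mkPt k g (t' + (s - t))) ⁻¹' (B j).carrier) :=
    isClosed_Icc.inter ((B j).isClosed.preimage hcont)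
  have haclosed : IsClosed a := by
    refine hK.isClosed_eq ?_ ?_
    · exact (H.continuousOn i).comp (continuous_mkPt k h).continuousOn fun t' ht' =>
        ((B i).mem_edge hk (hpI t' ht'.1)).1
    · exact (H.continuousOn j).comp hcont.continuousOn fun t' ht' => ht'.2
  have haopen : ∀ t' ∈ a, t' ∈ Ioo p p' → t' ∈ interior a := by
    rintro t' ⟨⟨h1, h2⟩, h3⟩ ht'
    have h4 := (hzi t' ht').2
    obtain ⟨l, h5⟩ := (B j).exists_edge ⟨h2, H.not_mem_inner
      ((B i).mem_edge hk (hpI t' h1)) h3⟩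
    obtain ⟨rfl, h6⟩ := H.eventually_edge hij (hzi t' ht').1 (hwj _ h2 (h3 ▸ h4)) h3 (k := k)
      (by rwa [coord_not_mkPt]) h5
    have h7 : Tendsto (fun t'' => mkPt k 0 (t'' - t')) (𝓝 t') (𝓝 0) := by
      have h0 : Continuous fun t'' => mkPt k 0 (t'' - t') :=
        (continuous_mkPt k 0).comp (by fun_prop)
      have h8 : mkPt k 0 0 = 0 := by cases k <;> rfl
      simpa [h8] using h0.tendsto t'
    rw [mem_interior_iff_mem_nhds]
    filter_upwards [h7.eventually h6, isOpen_Ioo.mem_nhds ht'] with t'' e1 e2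
    obtain ⟨e3, e4⟩ := e1 (coord_not_mkPt _ _ _)
    have e5 : ∀ g x, mkPt k g x + mkPt k 0 (t'' - t') = mkPt k g (x + (t'' - t')) := fun g x => by
      cases k <;> apply Complex.ext <;> simp [mkPt]
    rw [e5, e5] at e4
    rw [e5] at e3
    have e6 : t' + (s - t) + (t'' - t') = t'' + (s - t) := by ring
    rw [add_sub_cancel, e6] at e4
    rw [e6] at e3
    exact ⟨⟨⟨e2.1.le, e2.2.le⟩, e3⟩, e4⟩
  have hta : t ∈ a := by
    refine ⟨⟨⟨ht.1.le, ht.2.le⟩, ?_⟩, ?_⟩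
    · rw [mem_preimage, add_sub_cancel]
      exact ((B j).mem_edge hl (hrI s ⟨hs.1.le, hs.2.le⟩)).1
    · rw [add_sub_cancel]; exact hf
  have hsub : Ioo p p' ⊆ a := (isPreconnected_Ioo.subset_of_closure_inter_subset isOpen_interior
    ⟨t, ht, haopen t hta ht⟩ fun t' ht' => haopen t'
      (haclosed.closure_subset_iff.2 interior_subset ht'.1) ht'.2).trans interior_subset
  have hall : Icc p p' ⊆ a := by
    rw [← closure_Ioo hp.2.2.1.ne]
    exact haclosed.closure_subset_iff.2 hsub
  -- no marked point of the second rectangle is interior to the side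
  have hno : ∀ x, x + (s - t) ∈ Box.marks (marked B f j) k g → x ∉ Ioo p p' := fun x hx hx' =>
    (hzi x hx').2 ((hall ⟨hx'.1.le, hx'.2.le⟩).2 ▸ hx.2)
  refine ⟨rfl, ?_, ?_, fun t' ht' => (hall ht').2⟩
  · by_contra! hlt
    refine hno (r - (s - t)) (by rw [sub_add_cancel]; exact hr.1) ⟨by linarith, ?_⟩
    linarith [hs.1, ht.2]
  · by_contra! hlt
    refine hno (r' - (s - t)) (by rw [sub_add_cancel]; exact hr.2.1) ⟨?_, by linarith⟩
    linarith [hs.2, ht.1]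

/-- The map is closed, because the rectangles are compact and their images locally finite. -/
theorem isQuotientMap [T2Space X] (H : IsTiling A B f) :
    IsQuotientMap (fun v : (Σ i, (B i).carrier) => f v.1 v.2) := by
  have hcont : Continuous (fun v : (Σ i, (B i).carrier) => f v.1 v.2) :=
    continuous_sigma fun i => (H.continuousOn i).domRestrict
  have hclosed : IsClosedMap (fun v : (Σ i, (B i).carrier) => f v.1 v.2) := by
    intro C hC
    have e : (fun v : (Σ i, (B i).carrier) => f v.1 v.2) '' C =
        ⋃ i, (fun z : (B i).carrier => f i z) '' {z | (⟨i, z⟩ : Σ i, (B i).carrier) ∈ C} := by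
      ext x
      simp only [mem_image, mem_iUnion, mem_ofPred_eq]
      constructor
      · rintro ⟨⟨i, z⟩, h, rfl⟩
        exact ⟨i, z, h, rfl⟩
      · rintro ⟨i, z, h, rfl⟩
        exact ⟨⟨i, z⟩, h, rfl⟩
    rw [e]
    refine LocallyFinite.isClosed_iUnion (H.locallyFinite.subset fun i => ?_) fun i => ?_
    · rintro _ ⟨z, -, rfl⟩
      exact ⟨z, z.2, rfl⟩
    · have : CompactSpace (B i).carrier := isCompact_iff_compactSpace.1 (B i).isCompact
      exact ((hC.preimage (continuous_sigmaMk (σ := fun i => (B i).carrier) (i := i))).isCompact.image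
        (H.continuousOn i).domRestrict).isClosed
  refine hclosed.isQuotientMap hcont fun x => ?_
  obtain ⟨i, z, hz, rfl⟩ := H.cover x
  exact ⟨⟨i, z, hz⟩, rfl⟩

theorem finite_fibre (H : IsTiling A B f) (x : X) :
    {v : (Σ i, (B i).carrier) | f v.1 v.2 = x}.Finite := by
  refine Set.Finite.of_finite_image (f := Sigma.fst) ((H.locallyFinite.point_finite x).subset ?_) ?_
  · rintro _ ⟨⟨i, z⟩, h, rfl⟩
    exact ⟨z, z.2, h⟩
  · rintro ⟨i, z⟩ hz ⟨j, w⟩ hw (rfl : i = j)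
    have : z = w := Subtype.ext (H.injOn i z.2 w.2 (hz.trans hw.symm))
    rw [this]

theorem mem_marked_of_eq (H : IsTiling A B f) {i j : ι} {z w : ℂ} (hz : z ∈ marked B f i)
    (hw : w ∈ (B j).carrier) (h : f i z = f j w) : w ∈ marked B f j :=
  ⟨⟨hw, H.not_mem_inner hz.1 h⟩, h ▸ hz.2⟩

/-- A tiled surface is assembled from rectangles, the sides of which are the segments between
neighbouring vertices. -/
theorem isDefiningMap [T2Space X] (H : IsTiling A B f) :
    IsDefiningMap A (fun i => (B i).carrier) (fun i => (B i).sides (marked B f i)) f where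
  polygon i := Box.isPolygon (H.finite_marked i) (fun z hz => hz.1) (corners_subset_marked i)
  quotient := H.isQuotientMap
  finite_fibre := H.finite_fibre
  flat i z hz := H.flat i z (by rwa [Box.interior_carrier] at hz)
  interior_inj i j z hz w hw h :=
    H.interior_inj (by rwa [Box.interior_carrier] at hz) hw h
  corner i j s hs z hz w hw h := by
    have hzM : z ∈ marked B f i := (Box.mem_sideEnds hs (extremePoints_subset hz)).1 hz
    have hwM := H.mem_marked_of_eq hzM hw h
    obtain ⟨k, p, p', hk, hc, ht⟩ := Box.exists_mem_side (H.finite_marked j)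
      (corners_subset_marked j) hwM.1
    have hs' : segment ℝ (mkPt k (coord (!k) w) p) (mkPt k (coord (!k) w) p') ∈
      (B j).sides (marked B f j) := ⟨k, _, p, p', hk, hc, rfl⟩
    exact ⟨_, hs', (Box.mem_sideEnds hs' ((mem_segment_mkPt hc.2.2.1).2 ⟨rfl, ht⟩)).2 hwM⟩
  glue i j s hs t ht z hz w hw h := by
    have hzM : z ∉ marked B f i := fun hm => hz.2 ((Box.mem_sideEnds hs hz.1).2 hm)
    have hwM : w ∉ marked B f j := fun hm => hw.2 ((Box.mem_sideEnds ht hw.1).2 hm)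
    have hside : ∀ i, ∀ s ∈ (B i).sides (marked B f i), s ⊆ (B i).carrier := fun i s hs z hz => by
      have := (Box.isPolygon (H.finite_marked i) (fun z hz => hz.1)
        (corners_subset_marked i)).boundary
      have h1 : z ∈ frontier (B i).carrier := this ▸ ⟨s, hs, hz⟩
      rw [Box.frontier_eq] at h1
      exact h1.1
    by_cases hij : i = j
    · subst hij
      obtain rfl := H.injOn i (hside i s hs hz.1) (hside i t ht hw.1) h
      have hst : s = t := by
        by_contra hne
        exact hz.2 ((Box.isPolygon (H.finite_marked i) (fun z hz => hz.1)
          (corners_subset_marked i)).meet s hs t ht hne ⟨hz.1, hw.1⟩).1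
      exact ⟨1, rfl, by simpa using hst, fun z' _ => rfl⟩
    · obtain ⟨k, a, p, p', hk, hp, rfl⟩ := hs
      obtain ⟨l, b, r, r', hl, hr, rfl⟩ := ht
      have hz1 := (mem_segment_mkPt hp.2.2.1).1 hz.1
      have hw1 := (mem_segment_mkPt hr.2.2.1).1 hw.1
      obtain ⟨x, rfl⟩ : ∃ x, z = mkPt k a x := ⟨coord k z, hz1.1 ▸ eq_mkPt k z⟩
      obtain ⟨y, rfl⟩ : ∃ y, w = mkPt l b y := ⟨coord l w, hw1.1 ▸ eq_mkPt l w⟩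
      rw [coord_mkPt] at hz1 hw1
      have hx : x ∈ Ioo p p' := ⟨lt_of_le_of_ne hz1.2.1 fun e => hzM (e ▸ hp.1),
        lt_of_le_of_ne hz1.2.2 fun e => hzM (e ▸ hp.2.1)⟩
      have hy : y ∈ Ioo r r' := ⟨lt_of_le_of_ne hw1.2.1 fun e => hwM (e ▸ hr.1),
        lt_of_le_of_ne hw1.2.2 fun e => hwM (e ▸ hr.2.1)⟩
      -- each of the two sides is contained in the other, so that they agree up to translation
      obtain ⟨rfl, h1, h2, h3⟩ := H.side_subset hij hk hl hp hr hx hy h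
      obtain ⟨-, h4, h5, -⟩ := H.side_subset (Ne.symm hij) hl hk hr hp hy hx h.symm
      have e1 : r = p + (y - x) := by linarith
      have e2 : r' = p' + (y - x) := by linarith
      have hg : ∀ t, planeMap 1 (mkPt k b y - mkPt k a x) (mkPt k a t) =
          mkPt k b (t + (y - x)) := fun t => by
        rw [planeMap_apply]
        cases k <;> apply Complex.ext <;> simp [mkPt]
      refine ⟨planeMap 1 (mkPt k b y - mkPt k a x), by rw [hg, add_sub_cancel], ?_, ?_⟩
      · have := image_segment ℝ (planeMap 1 (mkPt k b y - mkPt k a x)).toAffineEquiv.toAffineMap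
          (mkPt k a p) (mkPt k a p')
        refine this.trans ?_
        change segment ℝ (planeMap 1 _ (mkPt k a p)) (planeMap 1 _ (mkPt k a p')) = _
        rw [hg, hg, e1, e2]
      · intro z' hz'
        obtain ⟨h6, h7⟩ := (mem_segment_mkPt hp.2.2.1).1 hz'
        obtain ⟨x', rfl⟩ : ∃ x, z' = mkPt k a x := ⟨coord k z', h6 ▸ eq_mkPt k z'⟩
        rw [coord_mkPt] at h7
        rw [hg, h3 x' h7]

end IsTiling

/-! ### Cutting a covering by squares into a tiling -/

/-- A locally finite covering of a flat surface by rectangles with sides parallel to two fixed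
directions: the coordinates of two of them differ locally by a translation. -/
structure IsPatchwork {X : Type u} [TopologicalSpace X] (A : FlatAtlas X) {κ : Type} (Q : κ → Box)
    (τ : κ → ℂ → X) : Prop where
  continuousOn : ∀ i, ContinuousOn (τ i) (Q i).carrier
  injOn : ∀ i, InjOn (τ i) (Q i).carrier
  isOpen : ∀ i, ∀ V : Set ℂ, IsOpen V → V ⊆ (Q i).inner → IsOpen (τ i '' V)
  locallyFinite : LocallyFinite fun i => τ i '' (Q i).carrier
  cover : ∀ x, ∃ i, x ∈ τ i '' (Q i).carrier
  flat : ∀ i, ∀ z ∈ (Q i).inner, A.FlatAt (τ i) z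
  sub_eq : ∀ i j, ∀ z ∈ (Q i).carrier, ∀ w ∈ (Q j).carrier, τ i z = τ j w →
    ∀ᶠ p in 𝓝 (z, w), p.1 ∈ (Q i).carrier → p.2 ∈ (Q j).carrier → τ i p.1 = τ j p.2 →
      p.1 - p.2 = z - w
  translation : ∀ i j, ∀ z ∈ (Q i).carrier \ (Q i).corners, ∀ w ∈ (Q j).carrier \ (Q j).corners,
    τ i z = τ j w → ∀ᶠ u in 𝓝 (0 : ℂ), z + u ∈ (Q i).carrier → w + u ∈ (Q j).carrier →
      τ i (z + u) = τ j (w + u)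

/-- From a point of a rectangle one can move into the interior, away from finitely many lines. -/
theorem Box.exists_generic (Q : Box) {z : ℂ} (hz : z ∈ Q.carrier) {G : Bool → Set ℝ}
    (hG : ∀ c, (G c).Finite) {N : Set ℂ} (hN : N ∈ 𝓝[Q.carrier] z) :
    ∃ z' ∈ Q.inner, z' ∈ N ∧ ∀ c, coord c z' ∉ G c := by
  have hm : ∀ c, ∃ m ∈ Ioo (Q.lo c) (Q.hi c), m ≠ coord c z := fun c => by
    have := Q.lt c
    by_cases h : (Q.lo c + Q.hi c) / 2 = coord c z
    · exact ⟨(Q.lo c + 2 * Q.hi c) / 3, ⟨by linarith, by linarith⟩, by rw [← h]; intro h'; linarith⟩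
    · exact ⟨_, ⟨by linarith, by linarith⟩, h⟩
  choose m hm hm' using hm
  set y : ℂ := ⟨m true, m false⟩ with hy
  have hyc : ∀ c, coord c y = m c := fun c => by cases c <;> rfl
  have hyi : y ∈ Q.inner := fun c => by rw [hyc]; exact hm c
  have hco : ∀ (c) (ε : ℝ), coord c (z + ε • (y - z)) = coord c z + ε * (m c - coord c z) :=
    fun c ε => by rw [← hyc]; cases c <;> simp [coord]
  have h1 : ∀ ε ∈ Ioc (0 : ℝ) 1, z + ε • (y - z) ∈ Q.inner := fun ε hε => by
    rw [← Q.isOpen_inner.interior_eq]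
    refine Q.convex_inner.add_smul_sub_mem_interior' ?_ ?_ hε
    · rwa [Q.closure_inner]
    · rwa [Q.isOpen_inner.interior_eq]
  have h2 : ∀ c, ∀ᶠ ε in 𝓝[>] (0 : ℝ), coord c (z + ε • (y - z)) ∉ G c := fun c => by
    have hinj : Function.Injective fun ε : ℝ => coord c z + ε * (m c - coord c z) :=
      fun a b h => by
        have : m c - coord c z ≠ 0 := sub_ne_zero.2 (hm' c)
        simpa [this] using h
    have hfin := ((hG c).preimage hinj.injOn).subset (sdiff_subset (t := {0}))
    have := hfin.isClosed.isOpen_compl.mem_nhds (x := (0 : ℝ)) (by simp)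
    filter_upwards [mem_nhdsWithin_of_mem_nhds this, self_mem_nhdsWithin] with ε h3 h4 h5
    exact h3 ⟨by rw [hco] at h5; exact h5, (ne_of_gt h4 : ε ≠ 0)⟩
  have h3 : Tendsto (fun ε : ℝ => z + ε • (y - z)) (𝓝[>] 0) (𝓝[Q.carrier] z) := by
    refine tendsto_nhdsWithin_iff.2 ⟨?_, ?_⟩
    · have h0 : Continuous fun ε : ℝ => z + ε • (y - z) := by fun_prop
      have := h0.tendsto 0
      simp only [zero_smul, add_zero] at this
      exact this.mono_left nhdsWithin_le_nhds
    · filter_upwards [Ioc_mem_nhdsGT (zero_lt_one' ℝ)] with ε hε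
      exact Q.inner_subset (h1 ε hε)
  obtain ⟨ε, ⟨⟨e1, e2⟩, e3⟩, e4⟩ := ((((h2 true).and (h2 false)).and
    (h3.eventually hN)).and (Ioc_mem_nhdsGT (zero_lt_one' ℝ))).exists
  exact ⟨_, h1 ε e4, e3, fun c => by cases c <;> assumption⟩

namespace IsPatchwork

variable {X : Type u} [TopologicalSpace X] {A : FlatAtlas X} {κ : Type} {Q : κ → Box}
  {τ : κ → ℂ → X}

theorem isCompact_image (H : IsPatchwork A Q τ) (i : κ) : IsCompact (τ i '' (Q i).carrier) :=
  (Q i).isCompact.image_of_continuousOn (H.continuousOn i)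

/-- Only finitely many translations occur between two rectangles. -/
theorem finite_sub [T2Space X] (H : IsPatchwork A Q τ) (i j : κ) :
    {v | ∃ z ∈ (Q i).carrier, ∃ w ∈ (Q j).carrier, τ i z = τ j w ∧ v = z - w}.Finite := by
  set K : Set (ℂ × ℂ) := {p ∈ (Q i).carrier ×ˢ (Q j).carrier | τ i p.1 = τ j p.2}
  have hprod := (Q i).isCompact.prod (Q j).isCompact
  have hK : IsCompact K := hprod.of_isClosed_subset
    (hprod.isClosed.isClosed_eq
      ((H.continuousOn i).comp continuousOn_fst fun p hp => hp.1)
      ((H.continuousOn j).comp continuousOn_snd fun p hp => hp.2)) (sep_subset _ _)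
  have : ((fun p : ℂ × ℂ => p.1 - p.2) '' K).Finite := by
    refine hK.induction_on (p := fun s => ((fun p : ℂ × ℂ => p.1 - p.2) '' s).Finite)
      (by simp) (fun s t hst ht => ht.subset (image_mono hst))
      (fun s t hs ht => by rw [image_union]; exact hs.union ht) ?_
    rintro ⟨z, w⟩ ⟨hzw, he⟩
    have h1 := H.sub_eq i j z hzw.1 w hzw.2 he
    refine ⟨_, inter_mem (mem_nhdsWithin_of_mem_nhds h1) self_mem_nhdsWithin,
      (Set.finite_singleton (z - w)).subset ?_⟩
    rintro _ ⟨p, ⟨hp, hpK⟩, rfl⟩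
    exact hp hpK.1.1 hpK.1.2 hpK.2
  refine this.subset ?_
  rintro v ⟨z, hz, w, hw, h, rfl⟩
  exact ⟨(z, w), ⟨⟨hz, hw⟩, h⟩, rfl⟩

/-- The coordinates of the lines, in one of the rectangles, that are traced by the boundaries of all
rectangles. -/
def grid (Q : κ → Box) (τ : κ → ℂ → X) (i : κ) (c : Bool) : Set ℝ :=
  {t | t ∈ Icc ((Q i).lo c) ((Q i).hi c) ∧ ∃ j, ∃ z ∈ (Q i).carrier, ∃ w ∈ (Q j).carrier,
    τ i z = τ j w ∧ (t = (Q j).lo c + coord c (z - w) ∨ t = (Q j).hi c + coord c (z - w))}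

theorem finite_grid [T2Space X] (H : IsPatchwork A Q τ) (i : κ) (c : Bool) :
    (grid Q τ i c).Finite := by
  have h1 := H.locallyFinite.finite_nonempty_inter_compact (H.isCompact_image i)
  refine (h1.biUnion fun j _ => ((H.finite_sub i j).image fun v => (Q j).lo c + coord c v).union
    ((H.finite_sub i j).image fun v => (Q j).hi c + coord c v)).subset ?_
  rintro t ⟨-, j, z, hz, w, hw, h, ht⟩
  refine mem_biUnion (show j ∈ {j | (τ j '' (Q j).carrier ∩ τ i '' (Q i).carrier).Nonempty} from
    ⟨_, ⟨w, hw, rfl⟩, ⟨z, hz, h⟩⟩) ?_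
  rcases ht with rfl | rfl
  · exact .inl ⟨z - w, ⟨z, hz, w, hw, h, rfl⟩, rfl⟩
  · exact .inr ⟨z - w, ⟨z, hz, w, hw, h, rfl⟩, rfl⟩

omit [TopologicalSpace X] in
theorem ends_mem_grid (i : κ) (c : Bool) :
    (Q i).lo c ∈ grid Q τ i c ∧ (Q i).hi c ∈ grid Q τ i c := by
  obtain ⟨z, hz⟩ := (Q i).nonempty_inner
  have hz := (Q i).inner_subset hz
  have h := ((Q i).lt c).le
  have h0 : coord c 0 = 0 := by cases c <;> rfl
  exact ⟨⟨⟨le_rfl, h⟩, i, z, hz, z, hz, rfl, .inl (by simp [h0])⟩,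
    ⟨⟨h, le_rfl⟩, i, z, hz, z, hz, rfl, .inr (by simp [h0])⟩⟩

/-- A cell of the grid in one of the rectangles, given by its lower and upper coordinates. -/
def IsCell (Q : κ → Box) (τ : κ → ℂ → X) (x : κ × (Bool → ℝ) × (Bool → ℝ)) : Prop :=
  ∀ c, Consec (grid Q τ x.1 c) (x.2.1 c) (x.2.2 c)

/-- The rectangle of a cell. -/
def IsCell.box {x : κ × (Bool → ℝ) × (Bool → ℝ)} (h : IsCell Q τ x) : Box :=
  ⟨x.2.1, x.2.2, fun c => (h c).2.2.1⟩

section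
variable {x : κ × (Bool → ℝ) × (Bool → ℝ)}

omit [TopologicalSpace X] in
theorem IsCell.subset (h : IsCell Q τ x) : h.box.carrier ⊆ (Q x.1).carrier := fun _ hz c =>
  ⟨(h c).1.1.1.trans (hz c).1, (hz c).2.trans (h c).2.1.1.2⟩

omit [TopologicalSpace X] in
theorem IsCell.inner_subset (h : IsCell Q τ x) : h.box.inner ⊆ (Q x.1).inner := fun _ hz c =>
  ⟨(h c).1.1.1.trans_lt (hz c).1, (hz c).2.trans_le (h c).2.1.1.2⟩

theorem IsCell.notMem_corners (h : IsCell Q τ x) {z : ℂ} (hz : z ∈ h.box.carrier \ h.box.corners) :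
    z ∈ (Q x.1).carrier \ (Q x.1).corners := by
  refine ⟨h.subset hz.1, fun hc => hz.2 fun c => ?_⟩
  refine (hc c).imp (fun e => le_antisymm ?_ (hz.1 c).1) fun e => le_antisymm (hz.1 c).2 ?_
  · rw [e]; exact (h c).1.1.1
  · rw [e]; exact (h c).2.1.1.2

/-- The inner points of a cell avoid the boundaries of all rectangles. -/
theorem IsCell.mem_inner (h : IsCell Q τ x) {z w : ℂ} (hz : z ∈ h.box.inner) {j : κ}
    (hw : w ∈ (Q j).carrier) (e : τ x.1 z = τ j w) : w ∈ (Q j).inner := fun c => by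
  have hz' := h.subset (h.box.inner_subset hz)
  have key : coord c z ∉ grid Q τ x.1 c := fun hg => disjoint_left.1 (h c).2.2.2 hg (hz c)
  refine ⟨lt_of_le_of_ne (hw c).1 fun e' => ?_, lt_of_le_of_ne (hw c).2 fun e' => ?_⟩
  · exact key ⟨hz' c, j, z, hz', w, hw, e, .inl (by rw [e']; simp)⟩
  · exact key ⟨hz' c, j, z, hz', w, hw, e, .inr (by rw [← e']; simp)⟩

end

theorem isPreconnected_cell (H : IsPatchwork A Q τ) {x : κ × (Bool → ℝ) × (Bool → ℝ)}
    (h : IsCell Q τ x) : IsPreconnected (τ x.1 '' h.box.inner) :=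
  h.box.isConnected_inner.isPreconnected.image _
    ((H.continuousOn _).mono (h.inner_subset.trans (Q x.1).inner_subset))

variable [LinearOrder κ]

/-- The cells that are not covered by rectangles with a smaller index. -/
def Cells (Q : κ → Box) (τ : κ → ℂ → X) : Type :=
  {x : κ × (Bool → ℝ) × (Bool → ℝ) // ∃ h : IsCell Q τ x,
    ∀ j < x.1, Disjoint (τ x.1 '' h.box.inner) (τ j '' (Q j).carrier)}

omit [TopologicalSpace X] in
theorem Cells.isCell (x : Cells Q τ) : IsCell Q τ x.1 := x.2.choose

omit [TopologicalSpace X] in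
theorem Cells.disjoint (x : Cells Q τ) : ∀ j < x.1.1, Disjoint (τ x.1.1 '' x.isCell.box.inner)
    (τ j '' (Q j).carrier) := x.2.choose_spec

theorem finite_cells [T2Space X] (H : IsPatchwork A Q τ) (i : κ) :
    {x : Cells Q τ | x.1.1 = i}.Finite := by
  have hpi : ({p : Bool → ℝ | ∀ c, p c ∈ grid Q τ i c}).Finite := by
    have := Set.Finite.pi' (fun c => H.finite_grid i c)
    exact this
  refine Set.Finite.of_finite_image (f := fun x : Cells Q τ => x.1.2) ((hpi.prod hpi).subset ?_) ?_
  · rintro _ ⟨x, rfl, rfl⟩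
    exact ⟨fun c => (x.isCell c).1, fun c => (x.isCell c).2.1⟩
  · intro x hx y hy h
    exact Subtype.ext (Prod.ext (hx.trans hy.symm) h)

theorem countable_cells [T2Space X] [Countable κ] (H : IsPatchwork A Q τ) : Countable (Cells Q τ) := by
  rw [← Set.countable_univ_iff]
  refine (Set.countable_iUnion fun i => (H.finite_cells i).countable).mono fun x _ => ?_
  exact mem_iUnion.2 ⟨x.1.1, rfl⟩

/-- Different cells have disjoint interiors: in one rectangle by construction, and else because a
cell avoids the rectangles with smaller index. -/
theorem cells_inner_eq (H : IsPatchwork A Q τ) {x y : Cells Q τ} {z w : ℂ}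
    (hz : z ∈ x.isCell.box.inner) (hw : w ∈ y.isCell.box.inner) (h : τ x.1.1 z = τ y.1.1 w) :
    x = y := by
  have hz' := (Q _).inner_subset (x.isCell.inner_subset hz)
  have hw' := (Q _).inner_subset (y.isCell.inner_subset hw)
  rcases lt_trichotomy x.1.1 y.1.1 with hlt | heq | hlt
  · exact absurd ⟨z, hz', h⟩ (disjoint_left.1 (y.disjoint _ hlt) ⟨w, hw, rfl⟩)
  · have hx := x.isCell
    have hy := y.isCell
    have hz1 : ∀ c, coord c z ∈ Ioo (x.1.2.1 c) (x.1.2.2 c) := hz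
    have hw1 : ∀ c, coord c w ∈ Ioo (y.1.2.1 c) (y.1.2.2 c) := hw
    clear hz hw
    obtain ⟨⟨i, p, p'⟩, hxx⟩ := x
    obtain ⟨⟨j, r, r'⟩, hyy⟩ := y
    obtain rfl : i = j := heq
    obtain rfl := H.injOn _ hz' hw' h
    refine Subtype.ext (Prod.ext rfl (Prod.ext (funext fun c => ?_) (funext fun c => ?_)))
    · exact ((hx c).unique (hy c) (hz1 c) (hw1 c)).1
    · exact ((hx c).unique (hy c) (hz1 c) (hw1 c)).2
  · exact absurd ⟨w, hw', h.symm⟩ (disjoint_left.1 (x.disjoint _ hlt) ⟨z, hz, rfl⟩)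

theorem locallyFinite_cells [T2Space X] (H : IsPatchwork A Q τ) :
    LocallyFinite fun x : Cells Q τ => τ x.1.1 '' x.isCell.box.carrier := fun y => by
  obtain ⟨t, ht, hfin⟩ := H.locallyFinite y
  refine ⟨t, ht, (hfin.preimage' (f := fun x : Cells Q τ => x.1.1)
    fun i _ => H.finite_cells i).subset ?_⟩
  rintro x ⟨_, ⟨z, hz, rfl⟩, hzt⟩
  exact ⟨_, ⟨z, x.isCell.subset hz, rfl⟩, hzt⟩

/-- The cells cover: a generic point of the complement, in the first rectangle that meets it, lies
in a cell of this rectangle; this cell is disjoint from the previous rectangles, since it would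
otherwise be contained in one of them. -/
theorem cells_cover [T2Space X] [WellFoundedLT κ] (H : IsPatchwork A Q τ) (y : X) :
    ∃ x : Cells Q τ, y ∈ τ x.1.1 '' x.isCell.box.carrier := by
  by_contra! hy
  set C := ⋃ x : Cells Q τ, τ x.1.1 '' x.isCell.box.carrier
  have hC : IsClosed C := H.locallyFinite_cells.isClosed_iUnion fun x =>
    (x.isCell.box.isCompact.image_of_continuousOn
      ((H.continuousOn _).mono x.isCell.subset)).isClosed
  have hyC : y ∈ Cᶜ := fun h => by
    obtain ⟨x, hx⟩ := mem_iUnion.1 h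
    exact hy x hx
  -- the first rectangle that meets the complement
  obtain ⟨i, ⟨_, hi, ⟨z, hz, rfl⟩⟩, hmin⟩ := exists_minimal_of_wellFoundedLT
    (fun i => (Cᶜ ∩ τ i '' (Q i).carrier).Nonempty) ⟨_, y, hyC, (H.cover y).choose_spec⟩
  obtain ⟨z', hz', hzC, hzG⟩ := (Q i).exists_generic hz (H.finite_grid i)
    ((H.continuousOn i z hz) (hC.isOpen_compl.mem_nhds hi))
  have hcell : ∀ c, ∃ p p', Consec (grid Q τ i c) p p' ∧ coord c z' ∈ Ioo p p' := fun c => by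
    obtain ⟨p, p', h1, h2, h3⟩ := exists_consec (H.finite_grid i c) (ends_mem_grid i c).1
      (ends_mem_grid i c).2 (hz' c).1.le (hz' c).2
    exact ⟨p, p', h1, lt_of_le_of_ne h2 fun e => hzG c (e ▸ h1.1), h3⟩
  choose p p' h1 h2 using hcell
  have hx : IsCell Q τ (i, p, p') := h1
  refine hzC (mem_iUnion.2 ⟨⟨(i, p, p'), hx, fun j hj => ?_⟩, z', ?_, rfl⟩)
  · by_contra hne
    obtain ⟨_, ⟨w, hw, rfl⟩, v, hv, hvw⟩ := not_disjoint_iff.1 hne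
    have hsub : τ i '' hx.box.inner ⊆ τ j '' (Q j).inner := by
      refine (H.isPreconnected_cell hx).subset_of_closure_inter_subset
        (H.isOpen j _ (Q j).isOpen_inner Subset.rfl) ?_ ?_
      · exact ⟨τ i w, ⟨w, hw, rfl⟩, v, hx.mem_inner hw hv hvw.symm, hvw⟩
      · rintro _ ⟨h3, ⟨w', hw', rfl⟩⟩
        have h4 := (H.isCompact_image j).isClosed.closure_subset_iff.2
          (image_mono (Q j).inner_subset) h3
        obtain ⟨v', hv', e⟩ := h4
        exact ⟨v', hx.mem_inner hw' hv' e.symm, e⟩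
    obtain ⟨v', hv', e⟩ := hsub ⟨z', h2, rfl⟩
    exact absurd (hmin ⟨_, hzC, v', (Q j).inner_subset hv', e⟩ hj.le) (not_le.2 hj)
  · exact fun c => ⟨(h2 c).1.le, (h2 c).2.le⟩

/-- The cells of a patchwork form a tiling. -/
theorem isTiling [T2Space X] [WellFoundedLT κ] (H : IsPatchwork A Q τ) :
    IsTiling A (fun x : Cells Q τ => x.isCell.box) (fun x => τ x.1.1) where
  continuousOn x := (H.continuousOn _).mono x.isCell.subset
  injOn x := (H.injOn _).mono x.isCell.subset
  locallyFinite := H.locallyFinite_cells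
  cover := H.cells_cover
  flat x z hz := H.flat _ z (x.isCell.inner_subset hz)
  disjoint x y hxy z hz w hw h := by
    have hopen := H.isOpen x.1.1 _ x.isCell.box.isOpen_inner x.isCell.inner_subset
    have hmem : τ y.1.1 w ∈ τ x.1.1 '' x.isCell.box.inner := ⟨z, hz, h⟩
    have h1 := H.continuousOn _ w (y.isCell.subset hw) (hopen.mem_nhds hmem)
    have h2 : w ∈ closure y.isCell.box.inner := by rwa [Box.closure_inner]
    obtain ⟨w', ⟨z', hz', e⟩, hw'⟩ := (mem_closure_iff_nhdsWithin_neBot.1 h2).nonempty_of_mem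
      (inter_mem (nhdsWithin_mono _ (y.isCell.inner_subset.trans (Q _).inner_subset) h1)
        self_mem_nhdsWithin)
    exact hxy (H.cells_inner_eq hz' hw' e)
  translation x y z hz w hw h := by
    filter_upwards [H.translation _ _ z (x.isCell.notMem_corners hz) w (y.isCell.notMem_corners hw) h]
      with u hu h1 h2
    exact hu (x.isCell.subset h1) (y.isCell.subset h2)

end IsPatchwork

/-! ### Quadrants of cones -/

/-- The angle in the middle of the quadrant `m π / 2 ≤ t ≤ (m + 1) π / 2`. -/
noncomputable def midAngle (m : ℕ) : ℝ := m * (Real.pi / 2) + Real.pi / 4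

/-- The branch of the logarithm on the `m`-th quadrant. -/
noncomputable def quadLog (m : ℕ) (z : ℂ) : ℂ :=
  Complex.log (z * Complex.exp (-(midAngle m * Complex.I))) + midAngle m * Complex.I

theorem exp_quadLog (m : ℕ) {z : ℂ} (hz : z ≠ 0) : Complex.exp (quadLog m z) = z := by
  rw [quadLog, Complex.exp_add, Complex.exp_log (mul_ne_zero hz (Complex.exp_ne_zero _)), mul_assoc,
    ← Complex.exp_add, neg_add_cancel, Complex.exp_zero, mul_one]

theorem mem_leftHalf_iff {c : ℝ} {ζ : ℂ} : ζ ∈ leftHalf c ↔ ‖Complex.exp ζ‖ < Real.exp c := by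
  rw [Complex.norm_exp, Real.exp_lt_exp]; rfl

theorem abs_cos_add_pi_div_four_le {φ : ℝ} (hφ : φ ∈ Icc 0 (Real.pi / 2)) :
    |Real.cos (φ + Real.pi / 4)| ≤ Real.cos (φ - Real.pi / 4) := by
  have h1 : 0 ≤ Real.cos φ := Real.cos_nonneg_of_mem_Icc ⟨by linarith [hφ.1, Real.pi_pos], hφ.2⟩
  have h2 : 0 ≤ Real.sin φ := Real.sin_nonneg_of_mem_Icc ⟨hφ.1, by linarith [hφ.2, Real.pi_pos]⟩
  have h3 : 0 ≤ Real.cos (Real.pi / 4) := by rw [Real.cos_pi_div_four]; positivity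
  rw [Real.cos_add, Real.cos_sub, Real.sin_pi_div_four, ← Real.cos_pi_div_four, abs_le]
  constructor <;> nlinarith [mul_nonneg h1 h3, mul_nonneg h2 h3]

/-- In a quadrant, cosine and sine keep their signs. -/
theorem midAngle_sign (m : ℕ) {φ : ℝ} (hφ : φ ∈ Icc 0 (Real.pi / 2)) :
    0 ≤ Real.cos (m * (Real.pi / 2) + φ) * Real.cos (midAngle m) ∧
      0 ≤ Real.sin (m * (Real.pi / 2) + φ) * Real.sin (midAngle m) := by
  set a := m * (Real.pi / 2) + φ with ha
  set b := midAngle m with hb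
  have h1 : a - b = φ - Real.pi / 4 := by rw [ha, hb, midAngle]; ring
  have h2 : a + b = φ + Real.pi / 4 + m * Real.pi := by rw [ha, hb, midAngle]; ring
  have h3 : |Real.cos (a + b)| ≤ Real.cos (a - b) := by
    rw [h1, h2, Real.cos_add_nat_mul_pi, abs_mul, abs_pow, abs_neg, abs_one, one_pow, one_mul]
    exact abs_cos_add_pi_div_four_le hφ
  rw [Real.cos_add, Real.cos_sub, abs_le] at h3
  constructor <;> nlinarith [h3.1, h3.2]

theorem midAngle_ne (m : ℕ) : Real.cos (midAngle m) ≠ 0 ∧ Real.sin (midAngle m) ≠ 0 := by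
  have h : Real.cos (2 * midAngle m) = 0 := by
    have : 2 * midAngle m = Real.pi / 2 + m * Real.pi := by rw [midAngle]; ring
    rw [this, Real.cos_add_nat_mul_pi, Real.cos_pi_div_two, mul_zero]
  have h1 := Real.cos_sq_add_sin_sq (midAngle m)
  rw [Real.cos_two_mul] at h
  constructor <;> intro h0
  · rw [h0] at h; norm_num at h
  · rw [h0] at h1; nlinarith

/-- The direction in the middle of the `m`-th quadrant. -/
noncomputable def midDir (m : ℕ) : Bool → ℝ
  | true => Real.cos (midAngle m)
  | false => Real.sin (midAngle m)

theorem midDir_ne (m : ℕ) (c : Bool) : midDir m c ≠ 0 := by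
  cases c
  exacts [(midAngle_ne m).2, (midAngle_ne m).1]

/-- The square with side `r` at the origin in the `m`-th quadrant. -/
noncomputable def quad (m : ℕ) {r : ℝ} (hr : 0 < r) : Box where
  lo c := if 0 < midDir m c then 0 else -r
  hi c := if 0 < midDir m c then r else 0
  lt c := by split_ifs <;> linarith

theorem mem_quad {m : ℕ} {r : ℝ} (hr : 0 < r) {z : ℂ} :
    z ∈ (quad m hr).carrier ↔ ∀ c, |coord c z| ≤ r ∧ 0 ≤ coord c z * midDir m c := by
  refine forall_congr' fun c => ?_
  simp only [quad, mem_Icc, abs_le]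
  split_ifs with h
  · rw [mul_nonneg_iff_of_pos_right h]
    constructor
    · rintro ⟨h1, h2⟩; exact ⟨⟨by linarith, h2⟩, h1⟩
    · rintro ⟨⟨h1, h2⟩, h3⟩; exact ⟨h3, h2⟩
  · have h' := lt_of_le_of_ne (not_lt.1 h) (midDir_ne m c)
    constructor
    · rintro ⟨h1, h2⟩; exact ⟨⟨h1, by linarith⟩, mul_nonneg_of_nonpos_of_nonpos h2 h'.le⟩
    · rintro ⟨⟨h1, h2⟩, h3⟩
      exact ⟨h1, not_lt.1 fun h4 => absurd h3 (not_le.2 (mul_neg_of_pos_of_neg h4 h'))⟩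

theorem zero_mem_corners (m : ℕ) {r : ℝ} (hr : 0 < r) : (0 : ℂ) ∈ (quad m hr).corners := fun c => by
  have h0 : coord c 0 = 0 := by cases c <;> rfl
  rw [h0]
  simp only [quad]
  split_ifs <;> simp

theorem norm_le_of_mem_quad {m : ℕ} {r : ℝ} {hr : 0 < r} {z : ℂ} (hz : z ∈ (quad m hr).carrier) :
    ‖z‖ ≤ 2 * r := by
  rw [mem_quad] at hz
  have := Complex.norm_le_abs_re_add_abs_im z
  have h1 : |z.re| ≤ r := (hz true).1
  have h2 : |z.im| ≤ r := (hz false).1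
  linarith

/-- A quadrant avoids the slit of its branch `quadLog` of the logarithm. -/
theorem quad_slit {m : ℕ} {r : ℝ} {hr : 0 < r} {z : ℂ} (hz : z ∈ (quad m hr).carrier) (h0 : z ≠ 0) :
    z * Complex.exp (-(midAngle m * Complex.I)) ∈ Complex.slitPlane := by
  rw [mem_quad] at hz
  refine Or.inl ?_
  have e : Complex.exp (-(midAngle m * Complex.I)) =
      ⟨Real.cos (midAngle m), -Real.sin (midAngle m)⟩ := by
    rw [← neg_mul, ← Complex.ofReal_neg]
    apply Complex.ext
    · rw [Complex.exp_ofReal_mul_I_re, Real.cos_neg]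
    · rw [Complex.exp_ofReal_mul_I_im, Real.sin_neg]
  rw [e, Complex.mul_re]
  have h1 : 0 ≤ z.re * Real.cos (midAngle m) := (hz true).2
  have h2 : 0 ≤ z.im * Real.sin (midAngle m) := (hz false).2
  rw [mul_neg, sub_neg_eq_add]
  refine lt_of_le_of_ne (add_nonneg h1 h2) fun h => h0 ?_
  have h3 : z.re * Real.cos (midAngle m) = 0 := by linarith
  have h4 : z.im * Real.sin (midAngle m) = 0 := by linarith
  apply Complex.ext
  · exact (mul_eq_zero.1 h3).resolve_right (midAngle_ne m).1
  · exact (mul_eq_zero.1 h4).resolve_right (midAngle_ne m).2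

theorem quadLog_im {m : ℕ} {z : ℂ}
    (hz : z * Complex.exp (-(midAngle m * Complex.I)) ∈ Complex.slitPlane) :
    |(quadLog m z).im - midAngle m| < Real.pi := by
  have : (quadLog m z).im - midAngle m = (z * Complex.exp (-(midAngle m * Complex.I))).arg := by
    simp [quadLog, Complex.log_im]
  rw [this]
  refine (Complex.abs_arg_le_pi _).lt_of_ne fun h => ?_
  rcases (abs_eq Real.pi_pos.le).1 h with h | h
  · exact (Complex.mem_slitPlane_iff_arg.1 hz).1 h
  · exact (Complex.neg_pi_lt_arg _).ne' h

/-- Near a point, the branch of the logarithm is the local logarithm. -/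
theorem eventually_quadLog {m : ℕ} {z : ℂ}
    (hz : z * Complex.exp (-(midAngle m * Complex.I)) ∈ Complex.slitPlane) :
    ∀ᶠ u in 𝓝 (0 : ℂ), z + u ≠ 0 ∧ quadLog m (z + u) = lg (quadLog m z) u := by
  have h0 : z ≠ 0 := fun h => by simp [h] at hz
  have h1 : ContinuousAt (quadLog m) z :=
    ((continuousAt_id.mul continuousAt_const).clog hz).add continuousAt_const
  have h2 : Tendsto (fun u => quadLog m (z + u)) (𝓝 0) (𝓝 (quadLog m z)) :=
    h1.tendsto.comp (tendsto_add_zero z)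
  filter_upwards [h2.eventually (eventually_lg_exp_sub _),
    (tendsto_add_zero z).eventually_ne h0] with u h3 h4
  rw [exp_quadLog m h4, exp_quadLog m h0, add_sub_cancel_left] at h3
  exact ⟨h4, h3.symm⟩

/-- Each point of the logarithmic half-plane whose angle lies in the `m`-th quadrant is reached by
`quadLog m`. -/
theorem exists_quad {ω : ℂ} {m : ℕ} (hω : ω.im ∈ Icc (m * (Real.pi / 2)) ((m + 1) * (Real.pi / 2)))
    {r : ℝ} (hr : 0 < r) (hωr : ‖Complex.exp ω‖ ≤ r) :
    Complex.exp ω ∈ (quad m hr).carrier ∧ quadLog m (Complex.exp ω) = ω := by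
  have hφ : ω.im - m * (Real.pi / 2) ∈ Icc 0 (Real.pi / 2) :=
    ⟨by linarith [hω.1], by linarith [hω.2]⟩
  have hs := midAngle_sign m hφ
  rw [add_sub_cancel] at hs
  constructor
  · rw [mem_quad]
    rintro (_ | _)
    · refine ⟨(Complex.abs_im_le_norm _).trans hωr, ?_⟩
      change 0 ≤ (Complex.exp ω).im * Real.sin (midAngle m)
      rw [Complex.exp_im, mul_assoc]
      exact mul_nonneg (Real.exp_pos _).le hs.2
    · refine ⟨(Complex.abs_re_le_norm _).trans hωr, ?_⟩
      change 0 ≤ (Complex.exp ω).re * Real.cos (midAngle m)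
      rw [Complex.exp_re, mul_assoc]
      exact mul_nonneg (Real.exp_pos _).le hs.1
  · rw [quadLog, ← Complex.exp_add]
    have him : (ω + -(midAngle m * Complex.I)).im = ω.im - midAngle m := by simp [sub_eq_add_neg]
    have : midAngle m = m * (Real.pi / 2) + Real.pi / 4 := rfl
    rw [Complex.log_exp, neg_add_cancel_right]
    · rw [him]; linarith [hφ.1, Real.pi_pos]
    · rw [him]; linarith [hφ.2, Real.pi_pos]

theorem FlatAtlas.IsConeChart.congr {X : Type u} [TopologicalSpace X] {A : FlatAtlas X} {x : X}
    {θ c : ℝ} {q q' : ℂ → X} (H : A.IsConeChart x θ c q) (h : ∀ ζ ∈ leftHalf c, q' ζ = q ζ) :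
    A.IsConeChart x θ c q' := by
  refine ⟨H.1, H.2.1.congr h, fun ζ hζ ζ' hζ' => ?_, fun ζ hζ => (H.2.2.2 ζ hζ).congr ?_⟩
  · rw [h ζ hζ, h ζ' hζ']; exact H.2.2.1 ζ hζ ζ' hζ'
  · filter_upwards [leftHalf_mem_nhds hζ] with ω hω using h ω hω

namespace PolygonalSurface

open FlatAtlas

variable {P : PolygonalSurface.{u}} {D₀ : P.FlatDisc}

namespace TransCover

open AlignedFrame

/-- The map of the `m`-th quadrant of the plane to the cone with apex `F.mk`. -/
noncomputable def quadMap (F : AlignedFrame D₀) (m : ℕ) (z : ℂ) : TransCover D₀ :=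
  open Classical in if z = 0 then F.mk else F.lift (quadLog m z)

theorem quadMap_zero (F : AlignedFrame D₀) (m : ℕ) : quadMap F m 0 = F.mk := if_pos rfl

theorem quadMap_of_ne (F : AlignedFrame D₀) (m : ℕ) {z : ℂ} (hz : z ≠ 0) :
    quadMap F m z = F.lift (quadLog m z) := if_neg hz

/-- `u` is the coordinate of `s` under the developing map of the cone with apex `G.mk`. -/
def IsDev (G : AlignedFrame D₀) (s : TransCover D₀) (u : ℂ) : Prop :=
  (u = 0 ∧ s = G.mk) ∨ ∃ ω ∈ leftHalf G.c, s = G.lift ω ∧ Complex.exp ω = u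

theorem lift_ne_mk (F : AlignedFrame D₀) {ζ : ℂ} (hζ : ζ ∈ leftHalf F.c) : F.lift ζ ≠ F.mk :=
  (polarTop_lift F).ne hζ

/-- Developed coordinates are well defined, because the values of a lift agree only up to full
turns. -/
theorem IsDev.unique {G : AlignedFrame D₀} {s : TransCover D₀} {u v : ℂ} (hu : IsDev G s u)
    (hv : IsDev G s v) : u = v := by
  rcases hu with ⟨rfl, rfl⟩ | ⟨ω, hω, rfl, rfl⟩
  · rcases hv with ⟨rfl, -⟩ | ⟨η, hη, h, -⟩
    · rfl
    · exact absurd h.symm (lift_ne_mk G hη)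
  · rcases hv with ⟨rfl, h⟩ | ⟨η, hη, h, rfl⟩
    · exact absurd h (lift_ne_mk G hω)
    · obtain ⟨n, -, rfl⟩ := (lift_eq_iff_shift G hω hη).1 h
      rw [isLift_shiftMap_int n]; rfl

theorem quadLog_mem {F : AlignedFrame D₀} {m : ℕ} {r : ℝ} {hr : 0 < r} (hF : 2 * r < Real.exp F.c)
    {z : ℂ} (hz : z ∈ (quad m hr).carrier) (h0 : z ≠ 0) : quadLog m z ∈ leftHalf F.c := by
  rw [mem_leftHalf_iff, exp_quadLog m h0]
  exact (norm_le_of_mem_quad hz).trans_lt hF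

theorem eventually_quadMap (F : AlignedFrame D₀) {m : ℕ} {z : ℂ}
    (hz : z * Complex.exp (-(midAngle m * Complex.I)) ∈ Complex.slitPlane) :
    ∀ᶠ u in 𝓝 (0 : ℂ), quadMap F m (z + u) = germ F.lift (quadLog m z) u := by
  filter_upwards [eventually_quadLog hz] with u hu
  rw [quadMap_of_ne F m hu.1, hu.2]; rfl

/-- Near a point `G.mk` of a quadrant, the difference from the coordinate of this point is the
developed coordinate of the cone at `G.mk`. -/
theorem eventually_isDev {F : AlignedFrame D₀} {m : ℕ} {r : ℝ} {hr : 0 < r}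
    (hF : 2 * r < Real.exp F.c) {z : ℂ} (hz : z ∈ (quad m hr).carrier) {G : AlignedFrame D₀}
    (h : quadMap F m z = G.mk) :
    ∀ᶠ u in 𝓝 (0 : ℂ), z + u ∈ (quad m hr).carrier → IsDev G (quadMap F m (z + u)) u := by
  by_cases h0 : z = 0
  · subst h0
    rw [quadMap_zero] at h
    obtain ⟨a, n, haG, haF, h1⟩ := lift_eq_lift_of_mk_eq h.symm
    filter_upwards [Metric.ball_mem_nhds (0 : ℂ) (Real.exp_pos a)] with u hu hQ
    rw [zero_add]
    by_cases hu0 : u = 0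
    · exact .inl ⟨hu0, by rw [hu0, quadMap_zero, h]⟩
    · have hm : quadLog m u ∈ leftHalf a := by
        rw [mem_leftHalf_iff, exp_quadLog m hu0]
        simpa using hu
      refine .inr ⟨_, (isLift_shiftMap (2 * Real.pi * n)).mem.2 (leftHalf_mono haG hm), ?_, ?_⟩
      · rw [quadMap_of_ne F m hu0, h1 _ hm]
      · rw [isLift_shiftMap_int n, exp_quadLog m hu0]; rfl
  · rw [quadMap_of_ne F m h0] at h
    obtain ⟨a, haG, h1⟩ := lift_of_mk_eq_lift (quadLog_mem hF hz h0) h univ_mem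
    filter_upwards [Metric.ball_mem_nhds (0 : ℂ) (Real.exp_pos a),
      eventually_quadMap F (quad_slit hz h0)] with u hu h2 _
    rw [h2]
    by_cases hu0 : u = 0
    · exact .inl ⟨hu0, by rw [hu0, germ_zero, h]⟩
    · have hm : Complex.log u ∈ leftHalf a := by
        rw [mem_leftHalf_iff, Complex.exp_log hu0]
        simpa using hu
      refine .inr ⟨Complex.log u, leftHalf_mono haG hm, ?_, Complex.exp_log hu0⟩
      rw [(h1 _ hm).2.2, Complex.exp_log hu0]; rfl

/-- Where two quadrants meet, their coordinates differ locally by a translation, since both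
develop the same cone. -/
theorem quadMap_sub_eq {F G : AlignedFrame D₀} {m n : ℕ} {r s : ℝ} {hr : 0 < r} {hs : 0 < s}
    (hF : 2 * r < Real.exp F.c) (hG : 2 * s < Real.exp G.c) {z w : ℂ}
    (hz : z ∈ (quad m hr).carrier) (hw : w ∈ (quad n hs).carrier) (h : quadMap F m z = quadMap G n w) :
    ∀ᶠ p in 𝓝 (z, w), p.1 ∈ (quad m hr).carrier → p.2 ∈ (quad n hs).carrier →
      quadMap F m p.1 = quadMap G n p.2 → p.1 - p.2 = z - w := by
  obtain ⟨K, hK⟩ := exists_mk (quadMap F m z)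
  have h1 := eventually_isDev hF hz hK.symm
  have h2 := eventually_isDev hG hw (h.symm.trans hK.symm)
  have ht : Tendsto (fun p : ℂ × ℂ => p.1 - z) (𝓝 (z, w)) (𝓝 0) := by
    have : Continuous fun p : ℂ × ℂ => p.1 - z := by fun_prop
    simpa using this.tendsto (z, w)
  have ht' : Tendsto (fun p : ℂ × ℂ => p.2 - w) (𝓝 (z, w)) (𝓝 0) := by
    have : Continuous fun p : ℂ × ℂ => p.2 - w := by fun_prop
    simpa using this.tendsto (z, w)
  filter_upwards [ht.eventually h1, ht'.eventually h2] with p e1 e2 hp1 hp2 he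
  rw [add_sub_cancel] at e1 e2
  have := (e1 hp1).unique (he ▸ e2 hp2)
  linear_combination this

/-- Away from the corners, where a cone angle may exceed `2π`, the translation identifies all
nearby points of two quadrants. -/
theorem quadMap_translation {F G : AlignedFrame D₀} {m n : ℕ} {r s : ℝ} {hr : 0 < r} {hs : 0 < s}
    (hF : 2 * r < Real.exp F.c) (hG : 2 * s < Real.exp G.c) {z w : ℂ}
    (hz : z ∈ (quad m hr).carrier \ (quad m hr).corners)
    (hw : w ∈ (quad n hs).carrier \ (quad n hs).corners) (h : quadMap F m z = quadMap G n w) :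
    ∀ᶠ u in 𝓝 (0 : ℂ), quadMap F m (z + u) = quadMap G n (w + u) := by
  have hz0 : z ≠ 0 := fun h => hz.2 (h ▸ zero_mem_corners m hr)
  have hw0 : w ≠ 0 := fun h => hw.2 (h ▸ zero_mem_corners n hs)
  rw [quadMap_of_ne F m hz0, quadMap_of_ne G n hw0] at h
  filter_upwards [eventually_quadMap F (quad_slit hz.1 hz0),
    eventually_quadMap G (quad_slit hw.1 hw0),
    lift_germ_eq (quadLog_mem hF hz.1 hz0) (quadLog_mem hG hw.1 hw0) h] with u e1 e2 e3
  rw [e1, e2, e3]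

theorem injOn_quadMap {F : AlignedFrame D₀} {m : ℕ} {r : ℝ} {hr : 0 < r}
    (hF : 2 * r < Real.exp F.c) : InjOn (quadMap F m) (quad m hr).carrier := by
  intro z hz w hw h
  by_cases hz0 : z = 0
  · by_contra hne
    have hw0 : w ≠ 0 := fun h => hne (hz0.trans h.symm)
    rw [hz0, quadMap_zero, quadMap_of_ne F m hw0] at h
    exact lift_ne_mk F (quadLog_mem hF hw hw0) h.symm
  · by_cases hw0 : w = 0
    · rw [hw0, quadMap_zero, quadMap_of_ne F m hz0] at h
      exact absurd h (lift_ne_mk F (quadLog_mem hF hz hz0))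
    · rw [quadMap_of_ne F m hz0, quadMap_of_ne F m hw0] at h
      have := injOn_lift F (midAngle m)
        ⟨quadLog_mem hF hz hz0, quadLog_im (quad_slit hz hz0)⟩
        ⟨quadLog_mem hF hw hw0, quadLog_im (quad_slit hw hw0)⟩ h
      rw [← exp_quadLog m hz0, this, exp_quadLog m hw0]

theorem map_quadMap {F : AlignedFrame D₀} {m : ℕ} {r : ℝ} {hr : 0 < r}
    (hF : 2 * r < Real.exp F.c) {z : ℂ} (hz : z ∈ (quad m hr).carrier) (h0 : z ≠ 0) :
    map (quadMap F m) (𝓝 z) = 𝓝 (quadMap F m z) := by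
  have h1 : map (fun u => z + u) (𝓝 0) = 𝓝 z := by simp
  rw [← h1, map_map, Function.comp_def,
    Filter.map_congr (m₂ := germ F.lift (quadLog m z)) (eventually_quadMap F (quad_slit hz h0)),
    (polarTop_lift F).map_germ (quadLog_mem hF hz h0), quadMap_of_ne F m h0]

theorem isOpen_quadMap {F : AlignedFrame D₀} {m : ℕ} {r : ℝ} {hr : 0 < r}
    (hF : 2 * r < Real.exp F.c) {V : Set ℂ} (hV : IsOpen V) (hVQ : V ⊆ (quad m hr).inner) :
    IsOpen (quadMap F m '' V) := by
  rw [isOpen_iff_mem_nhds]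
  rintro _ ⟨z, hz, rfl⟩
  have hz' := hVQ hz
  have h0 : z ≠ 0 := fun h => ((quad m hr).corners_subset (h ▸ zero_mem_corners m hr)).2 hz'
  rw [← map_quadMap hF ((quad m hr).inner_subset hz') h0]
  exact image_mem_map (hV.mem_nhds hz)

theorem continuousOn_quadMap {F : AlignedFrame D₀} {m : ℕ} {r : ℝ} {hr : 0 < r}
    (hF : 2 * r < Real.exp F.c) : ContinuousOn (quadMap F m) (quad m hr).carrier := by
  intro z hz
  by_cases h0 : z = 0
  · subst h0
    rw [ContinuousWithinAt, quadMap_zero, (polarTop_lift F).2.2.2.tendsto_right_iff]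
    intro a ha
    filter_upwards [mem_nhdsWithin_of_mem_nhds (Metric.ball_mem_nhds (0 : ℂ) (Real.exp_pos a))]
      with u hu
    by_cases hu0 : u = 0
    · rw [hu0, quadMap_zero]; exact mem_insert _ _
    · rw [quadMap_of_ne F m hu0]
      refine mem_insert_of_mem _ ⟨_, ?_, rfl⟩
      rw [mem_leftHalf_iff, exp_quadLog m hu0]
      simpa using hu
  · exact ContinuousAt.continuousWithinAt (map_quadMap hF hz h0).le

/-- Points that are not apices are regular. -/
theorem exists_flat_chart (hfin : Finite D₀.rotHol) (F : AlignedFrame D₀) {ζ : ℂ}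
    (hζ : ζ ∈ leftHalf F.c) : ∃ a, (flatAtlas D₀).IsConeChart (F.lift ζ) (2 * Real.pi) a
      (fun η => germ F.lift ζ (Complex.exp η)) := by
  obtain ⟨k, hk, hcone⟩ := exists_isConeChart hfin (F.recenter hζ)
  obtain ⟨a, ha, h1⟩ := lift_of_mk_eq_lift hζ (F.lift_eq hζ) univ_mem
  -- the chart of the recentred frame has period `2π`
  obtain ⟨n, hn⟩ := (hcone.2.2.1 ((a - 1 : ℝ) : ℂ) (leftHalf_mono ha (real_mem_leftHalf (by linarith)))
    (shiftMap (2 * Real.pi * (1 : ℤ)) ((a - 1 : ℝ) : ℂ))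
    ((isLift_shiftMap _).mem.2 (leftHalf_mono ha (real_mem_leftHalf (by linarith))))).1 (by
      rw [(h1 _ (real_mem_leftHalf (by linarith))).2.2,
        (h1 _ ((isLift_shiftMap _).mem.2 (real_mem_leftHalf (by linarith)))).2.2,
        isLift_shiftMap_int 1]
      rfl)
  have hk1 : k = 1 := by
    have h2 := congrArg Complex.im hn
    simp only [shiftMap_apply, Complex.add_im, Complex.ofReal_im, Complex.mul_im, Complex.ofReal_re,
      Complex.I_im, Complex.I_re, mul_one, mul_zero, add_zero, zero_add] at h2
    have h3 : (n * k : ℝ) = 1 := by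
      have := Real.two_pi_pos
      have h4 : (2 * Real.pi) * (n * k) = (2 * Real.pi) * 1 := by
        push_cast at h2
        linarith
      exact mul_left_cancel₀ this.ne' h4
    have h5 : n * k = 1 := by exact_mod_cast h3
    exact_mod_cast Int.eq_one_of_mul_eq_one_left (by positivity) h5
  subst hk1
  rw [Nat.cast_one, mul_one] at hcone
  refine ⟨a, ?_⟩
  have h2 := hcone.mono ha
  rw [← F.lift_eq hζ] at h2
  exact h2.congr fun η hη => ((h1 η hη).2.2).symm

theorem flatAt_quadMap (hfin : Finite D₀.rotHol) {F : AlignedFrame D₀} {m : ℕ} {r : ℝ} {hr : 0 < r}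
    (hF : 2 * r < Real.exp F.c) {z : ℂ} (hz : z ∈ (quad m hr).inner) :
    (flatAtlas D₀).FlatAt (quadMap F m) z := by
  have h0 : z ≠ 0 := fun h => ((quad m hr).corners_subset (h ▸ zero_mem_corners m hr)).2 hz
  have hz' := (quad m hr).inner_subset hz
  obtain ⟨a, ha⟩ := exists_flat_chart hfin F (quadLog_mem hF hz' h0)
  obtain ⟨b, hb⟩ := exists_leftHalf_of_eventually (eventually_quadMap F (quad_slit hz' h0))
  refine ⟨min a b, fun η => germ F.lift (quadLog m z) (Complex.exp η), planeMap 1 z, by simp, ?_,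
    fun ζ hζ => ?_⟩
  · rw [quadMap_of_ne F m h0]; exact ha.mono (min_le_left _ _)
  · refine Eq.trans ?_ (hb ζ (leftHalf_mono (min_le_right _ _) hζ))
    rw [planeMap_apply, add_comm]; rfl

end TransCover

end PolygonalSurface

/-- The closed square with side `r` at the origin in the `m`-th quadrant. -/
def quadSet (m : ℕ) (r : ℝ) : Set ℂ := {z | ∀ c, |coord c z| ≤ r ∧ 0 ≤ coord c z * midDir m c}

theorem quad_carrier (m : ℕ) {r : ℝ} (hr : 0 < r) : (quad m hr).carrier = quadSet m r :=
  Set.ext fun _ => mem_quad hr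

namespace PolygonalSurface

open FlatAtlas

variable {P : PolygonalSurface.{u}} {D₀ : P.FlatDisc}

namespace TransCover

open AlignedFrame

/-! ### Compact neighbourhoods and fibres -/

/-- The union of the `4k` squares with side `r` at the apex of a cone of angle `2πk`. -/
def coneDisc (F : AlignedFrame D₀) (k : ℕ) (r : ℝ) : Set (TransCover D₀) :=
  ⋃ m ∈ Finset.range (4 * k), quadMap F m '' quadSet m r

theorem isCompact_coneDisc (F : AlignedFrame D₀) (k : ℕ) {r : ℝ} (hr : 0 < r)
    (hF : 2 * r < Real.exp F.c) : IsCompact (coneDisc F k r) :=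
  Finset.isCompact_biUnion _ fun m _ => by
    rw [← quad_carrier m hr]
    exact (quad m hr).isCompact.image_of_continuousOn (continuousOn_quadMap hF)

/-- The squares of side `r` lie in each disc of radius greater than `2r`. -/
theorem coneDisc_subset (F : AlignedFrame D₀) (k : ℕ) {r a : ℝ} (hr : 0 < r)
    (hF : 2 * r < Real.exp a) : coneDisc F k r ⊆ polarDisc F.mk a F.lift := by
  refine iUnion₂_subset fun m _ => ?_
  rintro _ ⟨z, hz, rfl⟩
  by_cases h0 : z = 0
  · rw [h0, quadMap_zero]; exact mem_insert _ _
  · rw [quadMap_of_ne F m h0]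
    refine mem_insert_of_mem _ ⟨_, ?_, rfl⟩
    rw [← quad_carrier m hr] at hz
    rw [mem_leftHalf_iff, exp_quadLog m h0]
    exact (norm_le_of_mem_quad hz).trans_lt hF

/-- The squares of side `r` cover the disc of radius `r`: up to multiples of the cone angle, each
direction lies in one of the `4k` quadrants. -/
theorem subset_coneDisc {F : AlignedFrame D₀} {k : ℕ} (hk : 0 < k)
    (h : (flatAtlas D₀).IsConeChart F.mk (2 * Real.pi * k) F.c F.lift) {r a : ℝ} (hr : 0 < r)
    (ha : a ≤ F.c) (har : Real.exp a ≤ r) : polarDisc F.mk a F.lift ⊆ coneDisc F k r := by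
  have h4k : 0 < 4 * k := by positivity
  rintro s (rfl | ⟨ω, hω, rfl⟩)
  · refine mem_biUnion (Finset.mem_range.2 h4k) ⟨0, ?_, quadMap_zero F 0⟩
    rw [← quad_carrier 0 hr]
    exact ((quad 0 hr).corners_subset (zero_mem_corners 0 hr)).1
  · -- turn `ω` into one of the first `4k` quadrants
    set N := ⌊ω.im / (Real.pi / 2)⌋ with hN
    have hpi : 0 < Real.pi / 2 := by positivity
    have h1 : (N : ℝ) * (Real.pi / 2) ≤ ω.im := (le_div_iff₀ hpi).1 (Int.floor_le _)
    have h2 : ω.im < (N + 1) * (Real.pi / 2) := (div_lt_iff₀ hpi).1 (Int.lt_floor_add_one _)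
    have h4k' : (0 : ℤ) < (4 * k : ℕ) := by exact_mod_cast h4k
    obtain ⟨m, hm⟩ := Int.eq_ofNat_of_zero_le (Int.emod_nonneg N h4k'.ne')
    have hm' : m < 4 * k := by
      have := Int.emod_lt_of_pos N h4k'
      rw [hm] at this
      exact_mod_cast this
    have hNm : (N : ℝ) = 4 * k * (N / (4 * k : ℕ) : ℤ) + m := by
      have := Int.mul_ediv_add_emod N (4 * k : ℕ)
      rw [hm] at this
      exact_mod_cast this.symm
    set n : ℤ := N / (4 * k : ℕ)
    set ω' : ℂ := ω + (((-n : ℤ) * (2 * Real.pi * k) : ℝ) : ℂ) * Complex.I with hω'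
    have hre : ω'.re = ω.re := by simp [hω']
    have him : ω'.im = ω.im - n * (2 * Real.pi * k) := by
      simp [hω', sub_eq_add_neg]
    have hmem : ω' ∈ leftHalf a := by
      change ω'.re < a
      rw [hre]; exact hω
    have heq : F.lift ω = F.lift ω' :=
      (h.2.2.1 ω (leftHalf_mono ha hω) ω' (leftHalf_mono ha hmem)).2 ⟨-n, hω'⟩
    have him' : ω'.im ∈ Icc (m * (Real.pi / 2)) ((m + 1) * (Real.pi / 2)) := by
      rw [hNm] at h1 h2
      rw [him]
      constructor <;> nlinarith
    obtain ⟨h3, h4⟩ := exists_quad him' hr ((mem_leftHalf_iff.1 hmem).le.trans har)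
    refine mem_biUnion (Finset.mem_range.2 hm') ⟨Complex.exp ω', quad_carrier m hr ▸ h3, ?_⟩
    rw [quadMap_of_ne F m (Complex.exp_ne_zero _), h4, heq]

theorem hasBasis_coneDisc {F : AlignedFrame D₀} {k : ℕ} (hk : 0 < k)
    (h : (flatAtlas D₀).IsConeChart F.mk (2 * Real.pi * k) F.c F.lift) :
    (𝓝 F.mk).HasBasis (fun r : ℝ => 0 < r ∧ 2 * r < Real.exp F.c) (coneDisc F k) := by
  refine (polarTop_lift F).2.2.2.to_hasBasis (fun a ha => ?_) fun r hr => ?_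
  · have := Real.exp_pos a
    have hlt : 2 * (Real.exp a / 3) < Real.exp a := by linarith
    exact ⟨Real.exp a / 3, ⟨by positivity, hlt.trans_le (Real.exp_le_exp.2 ha)⟩,
      coneDisc_subset F k (by positivity) hlt⟩
  · have hle : Real.log r ≤ F.c := by
      rw [← Real.exp_le_exp, Real.exp_log hr.1]; linarith [hr.1, hr.2]
    exact ⟨Real.log r, hle, subset_coneDisc hk h hr.1 hle (Real.exp_log hr.1).le⟩

end TransCover

namespace AlignedFrame

/-- The frame `F` turned by an element of the rotational holonomy. -/
noncomputable def rot (F : AlignedFrame D₀) (ℓ : D₀.rotHol) : AlignedFrame D₀ where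
  pt := F.pt
  c := F.c
  q ζ := F.q ((exists_lift ℓ.1).choose ζ)
  frame := F.frame.comp_lift (exists_lift ℓ.1).choose_spec
  aligned := F.aligned.of_mem_rotHol F.frame (exists_lift ℓ.1).choose_spec ℓ.2

theorem rot_q (F : AlignedFrame D₀) (ℓ : D₀.rotHol) :
    ∃ T, IsLift T ℓ.1 ∧ ∀ ζ, (F.rot ℓ).q ζ = F.q (T ζ) :=
  ⟨_, (exists_lift ℓ.1).choose_spec, fun _ => rfl⟩

theorem mk_rot_of_lift {F G : AlignedFrame D₀} (h : F.pt = G.pt) {T : PlaneIso} {ℓ : D₀.rotHol}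
    (hT : IsLift T ℓ.1) {a : ℝ} (hG : ∀ ω ∈ leftHalf a, G.q ω = F.q (T ω)) :
    (F.rot ℓ).mk = G.mk := by
  obtain ⟨T', hT', hq⟩ := F.rot_q ℓ
  have h1 : IsLift (T'⁻¹ * T) 1 := by
    have := hT'.inv.mul hT
    rwa [inv_mul_cancel] at this
  obtain ⟨n, hn⟩ := h1.eq_shiftMap
  refine mk_eq_mk.2 ⟨h, a, n, fun ω hω => ?_⟩
  rw [hq, ← hn, PlaneIso.mul_apply, PlaneIso.apply_inv_self, hG ω hω]

/-- The rotational holonomy acts transitively on the fibres. -/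
theorem exists_mk_rot (F : AlignedFrame D₀) {s : TransCover D₀} (hs : TransCover.proj s = F.pt) :
    ∃ ℓ, (F.rot ℓ).mk = s := by
  obtain ⟨G, rfl⟩ := exists_mk s
  have hG := G.frame
  have hs : G.pt = F.pt := hs
  rw [hs] at hG
  obtain ⟨T, ℓ, hT, a, haF, haG, hq⟩ := F.frame.unique hG
  have hT' := F.frame.comp_lift hT
  have hal : Aligned D₀ F.c (fun ζ => F.q (T ζ)) := G.aligned.congr hG haG haF
    fun ζ hζ => (hq ζ hζ).symm
  exact ⟨⟨ℓ, F.aligned.mem_rotHol F.frame hT hal⟩, mk_rot_of_lift hs.symm hT hq⟩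

theorem germ_of_eq_comp {F G : AlignedFrame D₀} {T : PlaneIso} {ℓ : PlaneRot} (hT : IsLift T ℓ)
    (hq : ∀ ζ, G.q ζ = F.q (T ζ)) (ζ : ℂ) :
    ∀ᶠ u in 𝓝 (0 : ℂ), germ G.q (T⁻¹ ζ) u = germ F.q ζ (ℓ u) := by
  have h1 : G.q = fun ζ => F.q (T ζ) := funext hq
  rw [h1]
  have := germ_comp_lift F.q hT (T⁻¹ ζ)
  rwa [PlaneIso.apply_inv_self] at this

end AlignedFrame

namespace TransCover

open AlignedFrame

/-- The preimage of a disc is the union of the discs of the turned frames. -/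
theorem preimage_disc (F : AlignedFrame D₀) {a : ℝ} (ha : a ≤ F.c) :
    proj ⁻¹' polarDisc F.pt a F.q = ⋃ ℓ, polarDisc (F.rot ℓ).mk a (F.rot ℓ).lift := by
  ext s
  simp only [mem_preimage, mem_iUnion]
  constructor
  · rintro (h | ⟨ζ, hζ, h⟩)
    · obtain ⟨ℓ, rfl⟩ := F.exists_mk_rot h
      exact ⟨ℓ, mem_insert _ _⟩
    · have hζF := leftHalf_mono ha hζ
      obtain ⟨ℓ, hℓ⟩ := (F.recenter hζF).exists_mk_rot (s := s) h.symm
      refine ⟨ℓ, mem_insert_of_mem _ ?_⟩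
      obtain ⟨T, hT, hq⟩ := F.rot_q ℓ
      obtain ⟨T', hT', hq'⟩ := (F.recenter hζF).rot_q ℓ
      refine ⟨T⁻¹ ζ, hT.inv.mem.2 hζ, ?_⟩
      rw [← hℓ, lift_eq_mk (F := F.rot ℓ) (hT.inv.mem.2 hζF)]
      refine ⟨by rw [hq, PlaneIso.apply_inv_self]; rfl, ?_⟩
      obtain ⟨b, hb⟩ := exists_leftHalf_of_eventually
        (germ_of_eq_comp (F := F) hT hq ζ)
      refine ⟨b, fun ω hω => ?_⟩
      rw [hq', hb ω hω]
      change germ F.q ζ (Complex.exp (T' ω)) = _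
      rw [hT']
  · rintro ⟨ℓ, rfl | ⟨ζ, hζ, rfl⟩⟩
    · exact mem_insert _ _
    · obtain ⟨T, hT, hq⟩ := F.rot_q ℓ
      refine mem_insert_of_mem _ ⟨T ζ, hT.mem.2 hζ, ?_⟩
      rw [proj_lift (F.rot ℓ) (leftHalf_mono ha hζ), hq]

theorem finite_fibre (hfin : Finite D₀.rotHol) (y : P) :
    (proj ⁻¹' {y} : Set (TransCover D₀)).Finite := by
  obtain ⟨s, rfl⟩ := surjective_proj D₀ y
  obtain ⟨F, rfl⟩ := exists_mk s
  refine (Set.finite_range fun ℓ => (F.rot ℓ).mk).subset fun s hs => ?_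
  obtain ⟨ℓ, rfl⟩ := F.exists_mk_rot hs
  exact ⟨ℓ, rfl⟩

theorem locallyCompactSpace (hfin : Finite D₀.rotHol) : LocallyCompactSpace (TransCover D₀) := by
  choose F hF using exists_mk (D₀ := D₀)
  choose k hk h using fun s => exists_isConeChart hfin (F s)
  refine LocallyCompactSpace.of_hasBasis (fun s => ?_) (fun s r (hr : 0 < r ∧ 2 * r < Real.exp (F s).c) =>
    isCompact_coneDisc (F s) (k s) hr.1 hr.2)
  have := hasBasis_coneDisc (hk s) (h s)
  rwa [hF] at this

end TransCover

instance (P : PolygonalSurface.{u}) : SigmaCompactSpace P := by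
  obtain ⟨ι, _, Ω, sides, f, hf⟩ := P.assembled
  have : ∀ i, SigmaCompactSpace (Ω i) := fun i => (hf.polygon i).closed.sigmaCompactSpace
  rw [← isSigmaCompact_univ_iff, ← hf.quotient.surjective.range_eq]
  exact isSigmaCompact_range hf.quotient.continuous

namespace TransCover

open AlignedFrame

/-- The preimage of a compact set lies in a compact set, since discs have finitely many compact
lifts. -/
theorem exists_isCompact_preimage (hfin : Finite D₀.rotHol) {K : Set P} (hK : IsCompact K) :
    ∃ K' : Set (TransCover D₀), IsCompact K' ∧ proj ⁻¹' K ⊆ K' := by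
  refine hK.induction_on (p := fun K => ∃ K' : Set (TransCover D₀), IsCompact K' ∧ proj ⁻¹' K ⊆ K')
    ⟨∅, isCompact_empty, by simp⟩ (fun s t hst ⟨K', h, h'⟩ => ⟨K', h, (preimage_mono hst).trans h'⟩)
    (fun s t ⟨K', h, h'⟩ ⟨L, g, g'⟩ => ⟨K' ∪ L, h.union g, by
      rw [preimage_union]; exact union_subset_union h' g'⟩) fun y _ => ?_
  obtain ⟨s, rfl⟩ := surjective_proj D₀ y
  obtain ⟨F, rfl⟩ := exists_mk s
  have h0 := Real.exp_pos F.c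
  set r := Real.exp F.c / 3 with hr
  have hr0 : 0 < r := by positivity
  have hrc : 2 * r < Real.exp F.c := by rw [hr]; linarith
  have hle : Real.log r ≤ F.c := by
    rw [← Real.exp_le_exp, Real.exp_log hr0]; linarith
  choose k hk h using fun ℓ => exists_isConeChart hfin (F.rot ℓ)
  refine ⟨_, mem_nhdsWithin_of_mem_nhds (F.frame.1.disc_mem hle),
    ⋃ ℓ, coneDisc (F.rot ℓ) (k ℓ) r, isCompact_iUnion fun ℓ =>
      isCompact_coneDisc (F.rot ℓ) (k ℓ) hr0 hrc, ?_⟩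
  rw [preimage_disc F hle]
  exact iUnion_mono fun ℓ => subset_coneDisc (F := F.rot ℓ) (hk ℓ) (h ℓ) hr0 hle (Real.exp_log hr0).le

theorem sigmaCompactSpace (hfin : Finite D₀.rotHol) : SigmaCompactSpace (TransCover D₀) := by
  choose K hK hsub using fun n => exists_isCompact_preimage hfin (isCompact_compactCovering P n)
  refine SigmaCompactSpace_iff_exists_compact_covering.2 ⟨K, hK, eq_univ_of_forall fun s => ?_⟩
  have : proj s ∈ ⋃ n, compactCovering P n := by rw [iUnion_compactCovering]; trivial
  obtain ⟨n, hn⟩ := mem_iUnion.1 this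
  exact mem_iUnion.2 ⟨n, hsub n hn⟩

/-! ### The covering is a polygonal surface -/

/-- The covering has a locally finite patchwork of squares: quadrants of cones. Their coordinates
differ by translations because the covering has no rotational holonomy. -/
theorem exists_isPatchwork (hfin : Finite D₀.rotHol) :
    ∃ (κ : Set ℕ) (Q : κ → Box) (τ : κ → ℂ → TransCover D₀),
      IsPatchwork (flatAtlas D₀) Q τ := by
  have := locallyCompactSpace hfin
  have := sigmaCompactSpace hfin
  choose F hF using exists_mk (D₀ := D₀)
  choose k hk h using fun s => exists_isConeChart hfin (F s)
  obtain ⟨α, c, r, hr, hcov, hloc⟩ := refinement_of_locallyCompact_sigmaCompact_of_nhds_basis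
    (X := TransCover D₀) (ι := fun _ => ℝ) (p := fun s r => 0 < r ∧ 2 * r < Real.exp (F s).c)
    (B := fun s => coneDisc (F s) (k s)) fun s => by
      have := hasBasis_coneDisc (hk s) (h s)
      rwa [hF] at this
  have hα : Countable α := by
    rw [← Set.countable_univ_iff]
    refine hloc.countable_univ fun a => ?_
    have := subset_coneDisc (hk (c a)) (h (c a)) (hr a).1 (a := min (Real.log (r a)) (F (c a)).c)
      (min_le_right _ _) ((Real.exp_le_exp.2 (min_le_left _ _)).trans_eq (Real.exp_log (hr a).1))
    exact ⟨_, this (mem_insert _ _)⟩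
  -- the squares are numbered
  let J := Σ a : α, Fin (4 * k (c a))
  obtain ⟨e, he⟩ := exists_injective_nat J
  let E : range e ≃ J := (Equiv.ofInjective e he).symm
  let Q' : J → Box := fun j => quad j.2 (hr j.1).1
  let τ' : J → ℂ → TransCover D₀ := fun j => quadMap (F (c j.1)) j.2
  have hb : ∀ j : J, 2 * r j.1 < Real.exp (F (c j.1)).c := fun j => (hr j.1).2
  have hsub : ∀ j : J, τ' j '' (Q' j).carrier ⊆ coneDisc (F (c j.1)) (k (c j.1)) (r j.1) := fun j => by
    refine (subset_of_eq ?_).trans (subset_biUnion_of_mem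
      (u := fun m => quadMap (F (c j.1)) m '' quadSet m (r j.1)) (Finset.mem_range.2 j.2.2))
    exact congrArg _ (quad_carrier j.2 (hr j.1).1)
  have hloc' : LocallyFinite fun j => τ' j '' (Q' j).carrier := fun s => by
    obtain ⟨t, ht, hfin⟩ := hloc s
    refine ⟨t, ht, (hfin.preimage' (f := Sigma.fst (β := fun a : α => Fin (4 * k (c a))))
      fun a _ => ?_).subset ?_⟩
    · refine (Set.finite_range fun m : Fin (4 * k (c a)) => (⟨a, m⟩ : J)).subset ?_
      rintro ⟨b, m⟩ (rfl : b = a)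
      exact ⟨m, rfl⟩
    · rintro j ⟨s, hs, hst⟩
      exact ⟨s, hsub j hs, hst⟩
  refine ⟨range e, fun i => Q' (E i), fun i => τ' (E i), ?_⟩
  exact
    { continuousOn := fun i => continuousOn_quadMap (hb _)
      injOn := fun i => injOn_quadMap (hb _)
      isOpen := fun i V hV hVQ => isOpen_quadMap (hb _) hV hVQ
      locallyFinite := hloc'.comp_injective E.injective
      cover := fun s => by
        obtain ⟨a, ha⟩ := mem_iUnion.1 (hcov ▸ mem_univ s : s ∈ ⋃ a, _)
        obtain ⟨m, hm, hs⟩ := mem_iUnion₂.1 ha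
        refine ⟨E.symm ⟨a, ⟨m, Finset.mem_range.1 hm⟩⟩, ?_⟩
        rw [Equiv.apply_symm_apply]
        rw [← quad_carrier m (hr a).1] at hs
        exact hs
      flat := fun i z hz => flatAt_quadMap hfin (hb _) hz
      sub_eq := fun i j z hz w hw h => quadMap_sub_eq (hb _) (hb _) hz hw h
      translation := fun i j z hz w hw h => by
        filter_upwards [quadMap_translation (hb _) (hb _) hz hw h] with u hu _ _ using hu }

variable (D₀) in
/-- The covering as a polygonal surface. -/
noncomputable def surface (hfin : Finite D₀.rotHol) : PolygonalSurface.{u} where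
  carrier := TransCover D₀
  atlas := flatAtlas D₀
  polar s := by
    obtain ⟨F, rfl⟩ := exists_mk s
    obtain ⟨k, -, h⟩ := exists_isConeChart hfin F
    exact ⟨F.c, F.lift, .inl ⟨_, h⟩⟩
  assembled := by
    obtain ⟨κ, Q, τ, H⟩ := exists_isPatchwork hfin
    exact ⟨_, H.countable_cells, _, _, _, H.isTiling.isDefiningMap⟩

end TransCover

end PolygonalSurface

theorem FlatAtlas.IsConeChart.comp_lift {X : Type u} [TopologicalSpace X] {A : FlatAtlas X} {x : X}
    {θ c : ℝ} {q : ℂ → X} (H : A.IsConeChart x θ c q) {T : PlaneIso} {ℓ : PlaneRot}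
    (hT : IsLift T ℓ) : A.IsConeChart x θ c (fun ζ => q (T ζ)) := by
  refine ⟨H.1, H.2.1.comp_lift hT, fun ζ hζ ζ' hζ' => ?_,
    fun ζ hζ => (H.2.2.2 _ (hT.mem.2 hζ)).comp_lift hT⟩
  rw [H.2.2.1 _ (hT.mem.2 hζ) _ (hT.mem.2 hζ')]
  obtain ⟨t, rfl | rfl⟩ := hT.shift_or_flip
  · refine exists_congr fun n => ?_
    rw [shiftMap_apply, shiftMap_apply, add_right_comm, add_left_inj]
  · constructor
    · rintro ⟨n, hn⟩
      refine ⟨-n, ?_⟩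
      rw [flipMap_apply, flipMap_apply, add_right_comm, add_left_inj] at hn
      have := congrArg (starRingEnd ℂ) hn
      simp at this
      rw [this]; simp
    · rintro ⟨n, rfl⟩
      refine ⟨-n, ?_⟩
      rw [flipMap_apply, flipMap_apply]
      simp
      ring

namespace PolygonalSurface

open FlatAtlas

variable {P R S : PolygonalSurface.{u}} {D₀ : P.FlatDisc}

theorem IsCovering.isTameCovering {φ : R → S} (h : IsCovering φ)
    (hS : ∀ E : S.FlatDisc, Finite E.rotHol) : IsTameCovering φ :=
  ⟨h, fun D E _ _ _ => by
    have := hS E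
    rw [Subgroup.relIndex]
    exact Subgroup.index_ne_zero_of_finite⟩

namespace TransCover

open AlignedFrame

/-! ### The covering is a translation surface -/

/-- Near `z`, the map `p` is the lift of an aligned frame in a coordinate turned by `ℓ`. -/
def HasDir (p : ℂ → TransCover D₀) (z : ℂ) (ℓ : PlaneRot) : Prop :=
  ∃ F : AlignedFrame D₀, ∃ ζ ∈ leftHalf F.c,
    ∀ᶠ v in 𝓝 (0 : ℂ), p (z + v) = germ F.lift ζ (ℓ v)

theorem HasDir.unique {p : ℂ → TransCover D₀} {z : ℂ} {ℓ m : PlaneRot} (h : HasDir p z ℓ)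
    (h' : HasDir p z m) : ℓ = m := by
  obtain ⟨F, ζ, hζ, h⟩ := h
  obtain ⟨G, ω, hω, h'⟩ := h'
  have h0 : F.lift ζ = G.lift ω := by
    have h1 := h.self_of_nhds
    have h2 := h'.self_of_nhds
    rw [map_zero, germ_zero] at h1 h2
    exact h1.symm.trans h2
  refine (polarFlatAt_lift F hζ).eq_of_germ_eq ?_
  filter_upwards [h, h', m.tendsto_zero.eventually (lift_germ_eq hζ hω h0)] with v e1 e2 e3
  rw [← e1, e2, e3]

/-- A flat disc of the covering has a direction near each of its points. The point itself is
omitted, as it may be the image of an apex. -/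
theorem exists_hasDir (hfin : Finite D₀.rotHol) (D : (surface D₀ hfin).FlatDisc) {z : ℂ}
    (hz : z ∈ D.ball) : ∃ ℓ, ∀ᶠ z' in 𝓝[≠] z, HasDir (D₀ := D₀) D.map z' ℓ := by
  obtain ⟨b, hb⟩ := (D.regAt hz).isFrame
  obtain ⟨F, hF⟩ := exists_mk (D₀ := D₀) (D.map z)
  have h1 : (flatAtlas D₀).IsFrame (D.map z) F.c F.lift := by rw [← hF]; exact isFrame_lift hfin F
  obtain ⟨T, ℓ, hT, a, haF, -, h2⟩ := IsFrame.unique (X := TransCover D₀) h1 hb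
  refine ⟨ℓ, ?_⟩
  have h3 : ∀ᶠ u in 𝓝[≠] (0 : ℂ), HasDir (D₀ := D₀) D.map (z + u) ℓ := by
    filter_upwards [mem_nhdsWithin_of_mem_nhds (Metric.ball_mem_nhds (0 : ℂ) (Real.exp_pos a)),
      self_mem_nhdsWithin] with u hu hu0
    have hω : Complex.log u ∈ leftHalf a := by
      rw [mem_leftHalf_iff, Complex.exp_log hu0]; simpa using hu
    refine ⟨F, T (Complex.log u), hT.mem.2 (leftHalf_mono haF hω), ?_⟩
    filter_upwards [eventually_ne_neg_exp (Complex.log u), hT.lg (Complex.log u),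
      (tendsto_lg (Complex.log u)).eventually (leftHalf_mem_nhds hω)] with v e1 e2 e3
    rw [germ, ← e2, ← h2 _ e3, exp_lg e1, Complex.exp_log hu0, add_assoc]
  have ht : Tendsto (fun z' : ℂ => z' - z) (𝓝[≠] z) (𝓝[≠] 0) := by
    refine tendsto_nhdsWithin_iff.2 ⟨?_, ?_⟩
    · have : Continuous (fun z' : ℂ => z' - z) := by fun_prop
      have := this.tendsto z
      rw [sub_self] at this
      exact this.mono_left nhdsWithin_le_nhds
    · filter_upwards [self_mem_nhdsWithin] with z' hz' using sub_ne_zero.2 hz'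
  filter_upwards [ht.eventually h3] with z' hz'
  rwa [add_sub_cancel] at hz'

/-- The direction of a flat disc of the covering. -/
theorem exists_dir (hfin : Finite D₀.rotHol) (D : (surface D₀ hfin).FlatDisc) :
    ∃ ℓ, ∀ z ∈ D.ball, ∀ᶠ z' in 𝓝[≠] z, HasDir (D₀ := D₀) D.map z' ℓ := by
  obtain ⟨ℓ, hℓ⟩ := exists_hasDir hfin D D.center_mem
  refine ⟨ℓ, (convex_ball _ _).isPreconnected.forall_of_local
    (ρ := fun z ℓ => ∀ᶠ z' in 𝓝[≠] z, HasDir (D₀ := D₀) D.map z' ℓ)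
    (fun z hz => exists_hasDir hfin D hz) (fun z _ ℓ h => ?_) (fun z hz w hw ℓ m h h' h'' => ?_)
    D.center_mem hℓ⟩
  · refine mem_nhdsWithin_of_mem_nhds ?_
    have h1 := eventually_eventually_nhdsWithin.2 h
    rw [eventually_nhdsWithin_iff] at h1
    filter_upwards [h1] with y hy
    by_cases hyz : y = z
    · rwa [hyz]
    · have := hy hyz
      rw [isOpen_compl_singleton.nhdsWithin_eq hyz] at this
      exact this.filter_mono nhdsWithin_le_nhds
  · obtain ⟨z', e1, e2⟩ := (h.and h').exists
    exact e1.unique e2 ▸ h''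

/-- Developing along a chain of flat discs preserves the direction, hence has no rotation. -/
theorem isTranslation_surface (hfin : Finite D₀.rotHol) : (surface D₀ hfin).IsTranslation := by
  intro D
  obtain ⟨ℓ, hℓ⟩ := exists_dir hfin D
  have key : ∀ {E : (surface D₀ hfin).FlatDisc} {g : PlaneIso}, D.Develops E g → ∀ {m},
      (∀ z ∈ E.ball, ∀ᶠ z' in 𝓝[≠] z, HasDir (D₀ := D₀) E.map z' m) → ℓ = m * linearPart g := by
    intro E g hE
    induction hE with
    | refl =>
      intro m hm
      obtain ⟨z', e1, e2⟩ := ((hℓ _ D.center_mem).and (hm _ D.center_mem)).exists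
      rw [map_one, mul_one]
      exact e1.unique e2
    | @step E E' g h hE hadj ih =>
      intro m hm
      obtain ⟨n, hn⟩ := exists_dir hfin E
      rw [ih hn, map_mul, ← mul_assoc]
      congr 1
      obtain ⟨z, hz, hz', hev⟩ := hadj
      have ht : Tendsto h (𝓝[≠] z) (𝓝[≠] (h z)) := by
        refine tendsto_nhdsWithin_iff.2
          ⟨(h.continuous.tendsto z).mono_left nhdsWithin_le_nhds, ?_⟩
        filter_upwards [self_mem_nhdsWithin] with w hw using fun e => hw (h.injective e)
      obtain ⟨w, ⟨e1, e2⟩, e3⟩ := (((hn z hz).and (ht.eventually (hm _ hz'))).and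
        (mem_nhdsWithin_of_mem_nhds hev.eventually_nhds)).exists
      refine e1.unique ?_
      obtain ⟨F, ζ, hζ, hF⟩ := e2
      refine ⟨F, ζ, hζ, ?_⟩
      filter_upwards [(linearPart h).tendsto_zero.eventually hF,
        (tendsto_add_zero w).eventually e3] with v e4 e5
      rw [e5, h.apply_add, e4]
      rfl
  rw [eq_bot_iff]
  rintro _ ⟨g, hg, rfl⟩
  rw [Subgroup.mem_bot]
  exact mul_left_cancel (a := ℓ) ((key hg hℓ).symm.trans (mul_one ℓ).symm)

/-! ### The covering map -/

/-- Frames of the same radius that are related by a rotation, and give the same point, have lifts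
that differ by full turns. -/
theorem exists_shift_of_mk_eq {F G : AlignedFrame D₀} (h : F.mk = G.mk) (hc : G.c = F.c)
    {T : PlaneIso} {ℓ : PlaneRot} (hT : IsLift T ℓ) (hq : ∀ ζ ∈ leftHalf F.c, G.q ζ = F.q (T ζ)) :
    ∃ n : ℤ, ∀ ζ ∈ leftHalf F.c, G.lift ζ = F.lift (shiftMap (2 * Real.pi * n) ζ) := by
  obtain ⟨-, a, n, hn⟩ := mk_eq_mk.1 h
  have hω : ((min a F.c - 1 : ℝ) : ℂ) ∈ leftHalf (min a F.c) := real_mem_leftHalf (by linarith)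
  have h1 := F.frame.comp_eq hT (isLift_shiftMap_int n)
    (leftHalf_mono (min_le_right a F.c) hω) (by
      filter_upwards [leftHalf_mem_nhds hω] with η hη
      rw [← hq η (leftHalf_mono (min_le_right a F.c) hη),
        hn η (leftHalf_mono (min_le_left a F.c) hη)])
  refine ⟨n, fun ζ hζ => ?_⟩
  rw [lift_eq_lift (hc ▸ hζ) ((isLift_shiftMap _).mem.2 hζ)]
  simp only [germ_shift]
  refine germ_congr ?_
  filter_upwards [leftHalf_mem_nhds hζ] with η hη
  rw [hq η hη, h1 η hη]

theorem disc_subset_of_mk_eq {F G : AlignedFrame D₀} (h : F.mk = G.mk) (hc : G.c = F.c)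
    {T : PlaneIso} {ℓ : PlaneRot} (hT : IsLift T ℓ) (hq : ∀ ζ ∈ leftHalf F.c, G.q ζ = F.q (T ζ)) :
    polarDisc G.mk G.c G.lift ⊆ polarDisc F.mk F.c F.lift := by
  obtain ⟨n, hn⟩ := exists_shift_of_mk_eq h hc hT hq
  rintro s (rfl | ⟨ζ, hζ, rfl⟩)
  · rw [h]; exact mem_insert _ _
  · rw [hc] at hζ
    exact mem_insert_of_mem _ ⟨_, (isLift_shiftMap _).mem.2 hζ, (hn ζ hζ).symm⟩

/-- Over a polar disc of `P` the discs about the points of the fibre, in the coordinates of the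
given polar chart `Q`. -/
theorem exists_disc_family (hfin : Finite D₀.rotHol) (y : P) :
    ∃ (c : ℝ) (Q : ℂ → P) (q : TransCover D₀ → ℂ → TransCover D₀), P.atlas.IsPolarChart y c Q ∧
      (∀ s, proj s = y → (flatAtlas D₀).IsPolarChart s c (q s) ∧
        ∀ ζ ∈ leftHalf c, proj (q s ζ) = Q ζ) ∧
      (∀ s t, proj s = y → proj t = y → ∀ x ∈ polarDisc s c (q s), x ∈ polarDisc t c (q t) →
        s = t) ∧
      proj ⁻¹' polarDisc y c Q = ⋃ s ∈ proj ⁻¹' {y}, polarDisc s c (q s) := by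
  obtain ⟨c, Q, hQ⟩ := P.polar y
  obtain ⟨T₀, ℓ₀, hT₀, hal⟩ := exists_aligned_of_isFrame D₀ hQ.isFrame
  let F₀ : AlignedFrame D₀ := ⟨y, c, _, hQ.isFrame.comp_lift hT₀, hal⟩
  have hex : ∀ s : TransCover D₀, ∃ (ℓ : D₀.rotHol) (U : PlaneIso) (m : PlaneRot), IsLift U m ∧
      (∀ ζ, (F₀.rot ℓ).q ζ = Q (U ζ)) ∧ (proj s = y → (F₀.rot ℓ).mk = s) := fun s => by
    have : ∃ ℓ : D₀.rotHol, proj s = y → (F₀.rot ℓ).mk = s := by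
      by_cases hs : proj s = y
      · obtain ⟨ℓ, hℓ⟩ := F₀.exists_mk_rot hs
        exact ⟨ℓ, fun _ => hℓ⟩
      · exact ⟨1, fun h => absurd h hs⟩
    obtain ⟨ℓ, hℓ⟩ := this
    obtain ⟨T, hT, hq⟩ := F₀.rot_q ℓ
    exact ⟨ℓ, T₀ * T, _, hT₀.mul hT, fun ζ => hq ζ, hℓ⟩
  choose ℓ U m hU hq hmk using hex
  have hdisc : ∀ s, polarDisc s c (fun ζ => (F₀.rot (ℓ s)).lift ((U s)⁻¹ ζ)) =
      polarDisc s c (F₀.rot (ℓ s)).lift := fun s => polarDisc_comp_lift (hU s).inv _ _ _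
  refine ⟨c, Q, fun s ζ => (F₀.rot (ℓ s)).lift ((U s)⁻¹ ζ), hQ, fun s hs => ⟨?_, ?_⟩, ?_, ?_⟩
  · obtain ⟨k, -, h⟩ := exists_isConeChart hfin (F₀.rot (ℓ s))
    rw [hmk s hs] at h
    exact .inl ⟨_, h.comp_lift (hU s).inv⟩
  · intro ζ hζ
    rw [proj_lift _ ((hU s).inv.mem.2 hζ), hq, PlaneIso.apply_inv_self]
  · intro s t hs ht x hx hx'
    rw [hdisc] at hx hx'
    have hx1 : x ∈ polarDisc (F₀.rot (ℓ s)).mk c (F₀.rot (ℓ s)).lift := by rwa [hmk s hs]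
    have hx2 : x ∈ polarDisc (F₀.rot (ℓ t)).mk c (F₀.rot (ℓ t)).lift := by rwa [hmk t ht]
    have := disjoint_disc (F := F₀.rot (ℓ s)) (G := F₀.rot (ℓ t)) rfl ((hU s).inv.mul (hU t))
      le_rfl le_rfl (fun ω _ => by
        rw [hq, hq, PlaneIso.mul_apply, PlaneIso.apply_inv_self]) hx1 hx2
    rwa [hmk s hs, hmk t ht] at this
  · have h1 : polarDisc y c Q = polarDisc F₀.pt c F₀.q := (polarDisc_comp_lift hT₀ y c Q).symm
    have h2 := preimage_disc F₀ (le_refl c)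
    rw [h1, h2]
    refine Subset.antisymm ?_ ?_
    · refine iUnion_subset fun k => ?_
      have hs : proj (F₀.rot k).mk = y := rfl
      refine subset_trans ?_ (subset_biUnion_of_mem (show (F₀.rot k).mk ∈ proj ⁻¹' {y} from hs))
      obtain ⟨T, hT, hq'⟩ := F₀.rot_q k
      obtain ⟨T', hT', hq''⟩ := F₀.rot_q (ℓ (F₀.rot k).mk)
      rw [hdisc]
      have := disc_subset_of_mk_eq (hmk _ hs) (F := F₀.rot (ℓ (F₀.rot k).mk)) (G := F₀.rot k) rfl
        (hT'.inv.mul hT) fun ζ _ => by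
          rw [hq', hq'', PlaneIso.mul_apply, PlaneIso.apply_inv_self]
      rwa [hmk _ hs] at this
    · refine iUnion₂_subset fun s hs => ?_
      rw [hdisc]
      refine subset_trans ?_ (subset_iUnion _ (ℓ s))
      rw [hmk s hs]

theorem isCovering_proj (hfin : Finite D₀.rotHol) :
    IsCovering (R := surface D₀ hfin) (S := P) proj := by
  refine ⟨continuous_proj, surjective_proj D₀, fun y => ?_⟩
  obtain ⟨c, Q, q, h1, h2, h3, h4⟩ := exists_disc_family hfin y
  refine ⟨c, Q, q, fun _ => 0, h1, fun s hs => ⟨(h2 s hs).1, fun ζ hζ => ?_⟩,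
    fun s hs t ht hst => disjoint_left.2 fun x hx hx' => hst (h3 s t hs ht x hx hx'), h4⟩
  rw [(h2 s hs).2 ζ hζ]
  simp

/-- Over a regular point the fibre is a torsor of the rotational holonomy. -/
theorem hasDegree_proj (hfin : Finite D₀.rotHol) :
    HasDegree (R := surface D₀ hfin) (S := P) proj (Nat.card D₀.rotHol) := by
  rintro y ⟨c, Q, hQ⟩ -
  obtain ⟨T₀, ℓ₀, hT₀, hal⟩ := exists_aligned_of_isFrame D₀ hQ.isFrame
  let F₀ : AlignedFrame D₀ := ⟨y, c, _, hQ.isFrame.comp_lift hT₀, hal⟩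
  have hinj : Function.Injective fun ℓ => (F₀.rot ℓ).mk := by
    intro ℓ ℓ' h
    obtain ⟨-, a, n, hn⟩ := mk_eq_mk.1 h
    obtain ⟨T, hT, hq⟩ := F₀.rot_q ℓ
    obtain ⟨T', hT', hq'⟩ := F₀.rot_q ℓ'
    refine Subtype.ext (PlaneRot.eq_of_eventuallyEq ?_)
    refine eventually_of_leftHalf (a := min a c) (by rw [map_zero, map_zero]) fun ω hω => ?_
    have h1 := hn ω (leftHalf_mono (min_le_left _ _) hω)
    rw [hq, hq'] at h1
    have hω' := leftHalf_mono (min_le_right a c) hω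
    have hU := hT₀.mul hT'
    have hV := (hT₀.mul hT).mul (isLift_shiftMap_int n)
    obtain ⟨j, hj⟩ := (hQ.2.2.1 ((T₀ * T') ω) (hU.mem.2 hω')
      ((T₀ * T * shiftMap (2 * Real.pi * n)) ω) (hV.mem.2 hω')).1 h1
    have h2 := congrArg Complex.exp hj
    have h3 : (((j * (2 * Real.pi) : ℝ) : ℂ) * Complex.I) = j * (2 * Real.pi * Complex.I) := by
      push_cast; ring
    rw [hV, h3, Complex.exp_add, Complex.exp_int_mul_two_pi_mul_I, mul_one, hU, mul_one] at h2
    exact ℓ₀.injective h2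
  have hfib : (proj ⁻¹' {y} : Set (TransCover D₀)) = range fun ℓ => (F₀.rot ℓ).mk := by
    ext s
    constructor
    · intro hs
      obtain ⟨ℓ, hℓ⟩ := F₀.exists_mk_rot hs
      exact ⟨ℓ, hℓ⟩
    · rintro ⟨ℓ, rfl⟩
      rfl
  have h1 : (proj ⁻¹' {y} : Set (TransCover D₀)).encard = Nat.card D₀.rotHol := by
    rw [hfib, ← image_univ, hinj.encard_image, encard_univ, ENat.card_eq_coe_natCard]
  exact h1

end TransCover

end PolygonalSurface

namespace PolygonalSurface

open FlatAtlas

variable {P R : PolygonalSurface.{u}} {D₀ : P.FlatDisc}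

/-! ### Translation surfaces over `P` -/

/-- A translation surface has no boundary. -/
theorem IsTranslation.isConeChart (hR : R.IsTranslation) {x : R} {c : ℝ} {q : ℂ → R}
    (h : R.atlas.IsPolarChart x c q) : ∃ θ, R.atlas.IsConeChart x θ c q := by
  rcases h with h | ⟨α, h⟩
  · exact h
  · -- the reflection in the mirror of a wedge belongs to the holonomy
    exfalso
    have hf := h.isFrame
    obtain ⟨D, hD⟩ := exists_base_disc hf
    have h1 : ∀ ζ ∈ leftHalf c, q (flipMap 0 ζ) = q ζ := fun ζ hζ =>
      ((h.2.2.1 ζ hζ (flipMap 0 ζ) ((isLift_flipMap 0).mem.2 hζ)).2 ⟨0, .inr (by simp)⟩).symm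
    have h2 := hD.mem_rotHol hf (isLift_flipMap 0) (hD.congr hf le_rfl le_rfl h1)
    rw [hR D, Subgroup.mem_bot] at h2
    have h3 := congrArg (fun ℓ : PlaneRot => ℓ Complex.I) h2
    have h4 := congrArg Complex.im h3
    norm_num at h4

theorem IsCovering.exists_push {φ : R → P} (hφ : IsCovering φ) (x : R) : ∃ c p,
    R.atlas.IsFrame x c p ∧ P.atlas.IsFrame (φ x) c (fun ζ => φ (p ζ)) := by
  obtain ⟨c, Q, q, t, hQ, hq, -, -⟩ := hφ.2.2 (φ x)
  obtain ⟨h1, h2⟩ := hq x rfl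
  refine ⟨c, q x, h1.isFrame, (hQ.isFrame.comp_lift (isLift_shiftMap (t x))).congr fun ζ hζ => ?_⟩
  rw [h2 ζ hζ, shiftMap_apply]

/-- After shrinking, a covering maps every frame to a frame. -/
theorem IsCovering.push_frame {φ : R → P} (hφ : IsCovering φ) {x : R} {c : ℝ} {p : ℂ → R}
    (hp : R.atlas.IsFrame x c p) : ∃ a ≤ c, P.atlas.IsFrame (φ x) a (fun ζ => φ (p ζ)) := by
  obtain ⟨c', p', h1, h2⟩ := hφ.exists_push x
  obtain ⟨T, ℓ, hT, a, ha', ha, h⟩ := h1.unique hp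
  exact ⟨a, ha, ((h2.comp_lift hT).mono ha').congr fun ζ hζ => by rw [h ζ hζ]⟩

/-- An aligned frame of `R` that is mapped to a frame of `P`. -/
def Adapted (φ : R → P) (D : R.FlatDisc) (x : R) (c : ℝ) (p : ℂ → R) : Prop :=
  R.atlas.IsFrame x c p ∧ Aligned D c p ∧ P.atlas.IsFrame (φ x) c (fun ζ => φ (p ζ))

theorem IsCovering.exists_adapted {φ : R → P} (hφ : IsCovering φ) (D : R.FlatDisc) (x : R) :
    ∃ c p, Adapted φ D x c p := by
  obtain ⟨c, p, hp, hal⟩ := exists_aligned D x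
  obtain ⟨a, ha, h⟩ := hφ.push_frame hp
  exact ⟨a, p, hp.mono ha, hal.congr hp ha le_rfl fun _ _ => rfl, h⟩

/-- Over a translation surface adapted frames at a point are unique up to full turns. -/
theorem Adapted.unique {φ : R → P} (hR : R.IsTranslation) {D : R.FlatDisc} {x : R} {c c' : ℝ}
    {p p' : ℂ → R} (h : Adapted φ D x c p) (h' : Adapted φ D x c' p') :
    ∃ a : ℝ, ∃ n : ℤ, a ≤ c ∧ a ≤ c' ∧
      ∀ ω ∈ leftHalf a, p' ω = p (shiftMap (2 * Real.pi * n) ω) := by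
  obtain ⟨T, ℓ, hT, a, ha, ha', hq⟩ := h.1.unique h'.1
  have hal : Aligned D c (fun ζ => p (T ζ)) := h'.2.1.congr h'.1 ha' ha fun ζ hζ => (hq ζ hζ).symm
  have h1 := h.2.1.mem_rotHol h.1 hT hal
  rw [hR D, Subgroup.mem_bot] at h1
  subst h1
  obtain ⟨n, rfl⟩ := hT.eq_shiftMap
  exact ⟨a, n, ha, ha', hq⟩

theorem Adapted.recenter {φ : R → P} {D : R.FlatDisc} {x : R} {c : ℝ} {p : ℂ → R}
    (h : Adapted φ D x c p) {ζ : ℂ} (hζ : ζ ∈ leftHalf c) :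
    ∃ b, Adapted φ D (p ζ) b (fun ω => germ p ζ (Complex.exp ω)) := by
  obtain ⟨b, hb⟩ := h.1.recenter hζ
  obtain ⟨b', hb'⟩ := h.2.2.recenter hζ
  have hal := (Aligned.recenter_iff h.1 hζ hb).2 h.2.1
  exact ⟨min b b', hb.mono (min_le_left _ _), hal.congr hb (min_le_left _ _) le_rfl fun _ _ => rfl,
    hb'.mono (min_le_right _ _)⟩

theorem Adapted.aligned_iff {φ : R → P} (hR : R.IsTranslation) {D : R.FlatDisc} {x : R} {c c' : ℝ}
    {p p' : ℂ → R} (h : Adapted φ D x c p) (h' : Adapted φ D x c' p') :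
    Aligned D₀ c (fun ζ => φ (p ζ)) → Aligned D₀ c' (fun ζ => φ (p' ζ)) := fun hal => by
  obtain ⟨a, n, ha, ha', hq⟩ := h.unique hR h'
  have h1 := hal.of_mem_rotHol h.2.2 (isLift_shiftMap_int n) (one_mem _)
  exact h1.congr (h.2.2.comp_lift (isLift_shiftMap _)) ha ha' fun ζ hζ => by rw [hq ζ hζ]

theorem Adapted.aligned_recenter_iff {φ : R → P} {D : R.FlatDisc} {x : R} {c b : ℝ} {p : ℂ → R}
    (h : Adapted φ D x c p) {ζ : ℂ} (hζ : ζ ∈ leftHalf c)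
    (hb : Adapted φ D (p ζ) b (fun ω => germ p ζ (Complex.exp ω))) :
    Aligned D₀ b (fun ω => φ (germ p ζ (Complex.exp ω))) ↔ Aligned D₀ c (fun ζ => φ (p ζ)) :=
  Aligned.recenter_iff h.2.2 hζ hb.2.2

/-- With a suitable base disc of the translation surface `R`, the covering maps aligned frames to
aligned frames. -/
theorem IsCovering.exists_base {φ : R → P} (hφ : IsCovering φ) (hR : R.IsTranslation)
    (D₀ : P.FlatDisc) : ∃ D : R.FlatDisc, ∀ x c p, Adapted φ D x c p →
      Aligned D₀ c (fun ζ => φ (p ζ)) := by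
  obtain ⟨x₀⟩ : Nonempty R := inferInstance
  obtain ⟨c₀, p₀, h1, h2⟩ := hφ.exists_push x₀
  obtain ⟨T, ℓ, hT, hal⟩ := exists_aligned_of_isFrame D₀ h2
  obtain ⟨D, hD⟩ := exists_base_disc (h1.comp_lift hT)
  have h0 : Adapted φ D x₀ c₀ (fun ζ => p₀ (T ζ)) := ⟨h1.comp_lift hT, hD, h2.comp_lift hT⟩
  refine ⟨D, fun x => ?_⟩
  let good : R → Prop := fun x => ∀ c p, Adapted φ D x c p → Aligned D₀ c (fun ζ => φ (p ζ))
  have hloc : ∀ x y, good x ↔ good y := fun x y => by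
    refine isPreconnected_univ.induction₂ (fun x y => good x ↔ good y) (fun x _ => ?_)
      (fun _ _ _ _ _ _ h h' => h.trans h') (fun _ _ _ _ h => h.symm) (mem_univ x) (mem_univ y)
    rw [nhdsWithin_univ]
    obtain ⟨c, p, hp⟩ := hφ.exists_adapted D x
    filter_upwards [hp.1.1.disc_mem le_rfl] with y hy
    rcases hy with rfl | ⟨ζ, hζ, rfl⟩
    · exact Iff.rfl
    obtain ⟨b, hb⟩ := hp.recenter hζ
    have h3 := Adapted.aligned_recenter_iff (D₀ := D₀) hp hζ hb
    exact ⟨fun h c' p' h' => hb.aligned_iff hR h' (h3.2 (h c p hp)),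
      fun h c' p' h' => hp.aligned_iff hR h' (h3.1 (h _ _ hb))⟩
  exact (hloc x₀ x).1 fun c p h => h0.aligned_iff hR h hal

namespace TransCover

open AlignedFrame

section factor

variable {φ : R → P} {D : R.FlatDisc}
  (hD : ∀ x c p, Adapted φ D x c p → Aligned D₀ c (fun ζ => φ (p ζ)))

/-- The image in `P` of an adapted frame. -/
def pushFrame {x : R} {c : ℝ} {p : ℂ → R} (h : Adapted φ D x c p) : AlignedFrame D₀ :=
  ⟨φ x, c, fun ζ => φ (p ζ), h.2.2, hD x c p h⟩

/-- The factorization of a covering by a translation surface. -/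
theorem exists_factor (hφ : IsCovering φ) (hR : R.IsTranslation) :
    ∃ ψ : R → TransCover D₀, ∀ x c p (h : Adapted φ D x c p), ψ x = (pushFrame hD h).mk := by
  choose c p h using hφ.exists_adapted D
  refine ⟨fun x => (pushFrame hD (h x)).mk, fun x c' p' h' => mk_eq_mk.2 ⟨rfl, ?_⟩⟩
  obtain ⟨a, n, -, -, hn⟩ := (h x).unique hR h'
  exact ⟨a, n, fun ω hω => congrArg φ (hn ω hω)⟩

variable {ψ : R → TransCover D₀} (hψ : ∀ x c p (h : Adapted φ D x c p), ψ x = (pushFrame hD h).mk)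
include hψ

/-- The factorization maps adapted frames to the lifts of their images. -/
theorem factor_apply {x : R} {c : ℝ} {p : ℂ → R} (h : Adapted φ D x c p) {ζ : ℂ}
    (hζ : ζ ∈ leftHalf c) : ψ (p ζ) = (pushFrame hD h).lift ζ := by
  obtain ⟨b, hb⟩ := h.recenter hζ
  rw [hψ _ _ _ hb, eq_comm, lift_eq_mk hζ]
  exact ⟨rfl, 0, fun _ _ => rfl⟩

theorem proj_factor (hφ : IsCovering φ) (x : R) : proj (ψ x) = φ x := by
  obtain ⟨c, p, h⟩ := hφ.exists_adapted D x
  rw [hψ _ _ _ h]; rfl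

theorem image_disc_factor {x : R} {c : ℝ} {p : ℂ → R} (h : Adapted φ D x c p) {a : ℝ} (ha : a ≤ c) :
    ψ '' polarDisc x a p = polarDisc (pushFrame hD h).mk a (pushFrame hD h).lift := by
  rw [polarDisc, image_insert_eq, hψ _ _ _ h, polarDisc, image_image]
  congr 1
  exact image_congr fun ζ hζ => factor_apply hD hψ h (leftHalf_mono ha hζ)

theorem continuous_factor (hφ : IsCovering φ) : Continuous ψ := by
  refine continuous_iff_continuousAt.2 fun x => ?_
  obtain ⟨c, p, h⟩ := hφ.exists_adapted D x
  rw [ContinuousAt, hψ _ _ _ h, (polarTop_lift (pushFrame hD h)).2.2.2.tendsto_right_iff]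
  intro a ha
  filter_upwards [h.1.1.disc_mem (a := a) ha] with y hy
  rw [← image_disc_factor hD hψ h ha]
  exact mem_image_of_mem ψ hy

/-- The factorization is a covering, in the coordinates of the given covering. -/
theorem exists_disc_family_factor (hφ : IsCovering φ) (hR : R.IsTranslation)
    (hfin : Finite D₀.rotHol) (s : TransCover D₀) :
    ∃ (c : ℝ) (Q : ℂ → TransCover D₀) (q : R → ℂ → R) (t : R → ℝ),
      (flatAtlas D₀).IsPolarChart s c Q ∧
      (∀ x, ψ x = s → R.atlas.IsPolarChart x c (q x) ∧
        ∀ ζ ∈ leftHalf c, ψ (q x ζ) = Q (ζ + (t x : ℂ) * Complex.I)) ∧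
      (ψ ⁻¹' {s}).PairwiseDisjoint (fun x => polarDisc x c (q x)) ∧
      ψ ⁻¹' polarDisc s c Q = ⋃ x ∈ ψ ⁻¹' {s}, polarDisc x c (q x) := by
  obtain ⟨c, Q, q, t, hQ, hq, hdis, hpre⟩ := hφ.2.2 (proj s)
  obtain ⟨T₀, ℓ₀, hT₀, hal⟩ := exists_aligned_of_isFrame D₀ hQ.isFrame
  let F₀ : AlignedFrame D₀ := ⟨proj s, c, _, hQ.isFrame.comp_lift hT₀, hal⟩
  obtain ⟨ℓ, hℓ⟩ := F₀.exists_mk_rot (s := s) rfl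
  obtain ⟨U₀, hU₀, hU₀q⟩ := F₀.rot_q ℓ
  set G := F₀.rot ℓ with hG
  have hGc : G.c = c := rfl
  have hU := hT₀.mul hU₀
  have hGq : ∀ ζ, G.q ζ = Q ((T₀ * U₀) ζ) := hU₀q
  -- the charts of `R`, turned so that they are aligned
  have hex : ∀ x, ∃ (T : PlaneIso) (m : PlaneRot), IsLift T m ∧
      (φ x = proj s → Adapted φ D x c (fun ζ => q x (T ζ))) := fun x => by
    by_cases hx : φ x = proj s
    · have h1 := (hq x hx).1.isFrame
      obtain ⟨T, m, hT, h2⟩ := exists_aligned_of_isFrame D h1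
      refine ⟨T, m, hT, fun _ => ⟨h1.comp_lift hT, h2, ?_⟩⟩
      rw [hx]
      refine (hQ.isFrame.comp_lift ((isLift_shiftMap (t x)).mul hT)).congr fun ζ hζ => ?_
      rw [(hq x hx).2 _ (hT.mem.2 hζ), PlaneIso.mul_apply, shiftMap_apply]
    · exact ⟨1, 1, IsLift.one, fun h => absurd h hx⟩
  choose T m hT hA using hex
  have hrel : ∀ x (hx : φ x = proj s), ∀ ζ ∈ leftHalf c, (pushFrame hD (hA x hx)).q ζ =
      G.q (((T₀ * U₀)⁻¹ * (shiftMap (t x) * T x)) ζ) := fun x hx ζ hζ => by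
    rw [hGq, PlaneIso.mul_apply (T₀ * U₀)⁻¹, PlaneIso.apply_inv_self,
      PlaneIso.mul_apply (shiftMap (t x)), shiftMap_apply]
    exact (hq x hx).2 _ ((hT x).mem.2 hζ)
  have hrelT : ∀ x, IsLift ((T₀ * U₀)⁻¹ * (shiftMap (t x) * T x)) _ := fun x =>
    hU.inv.mul ((isLift_shiftMap (t x)).mul (hT x))
  have hproj : ∀ x, ψ x = s → φ x = proj s := fun x hx => by
    rw [← hx, proj_factor hD hψ hφ]
  have hshift : ∀ x, ∃ n : ℤ, ψ x = s → ∀ ζ ∈ leftHalf c,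
      ψ (q x (T x ζ)) = G.lift (shiftMap (2 * Real.pi * n) ζ) := fun x => by
    by_cases hx : ψ x = s
    · obtain ⟨n, hn⟩ := exists_shift_of_mk_eq (F := G) (G := pushFrame hD (hA x (hproj x hx)))
        (hℓ.trans (hx.symm.trans (hψ _ _ _ _))) rfl (hrelT x) (hrel x (hproj x hx))
      exact ⟨n, fun _ ζ hζ => (factor_apply hD hψ (hA x (hproj x hx)) hζ).trans (hn ζ hζ)⟩
    · exact ⟨0, fun h => absurd h hx⟩
  choose n hn using hshift
  have hdisc : ∀ x, polarDisc x c (fun ζ => q x (T x ζ)) = polarDisc x c (q x) := fun x =>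
    polarDisc_comp_lift (hT x) _ _ _
  refine ⟨c, G.lift, fun x ζ => q x (T x ζ), fun x => 2 * Real.pi * n x, ?_, fun x hx => ⟨?_, ?_⟩,
    fun x hx y hy hxy => ?_, ?_⟩
  · obtain ⟨k, -, h⟩ := exists_isConeChart hfin G
    rw [hℓ] at h
    exact .inl ⟨_, h⟩
  · obtain ⟨θ, h⟩ := hR.isConeChart (hq x (hproj x hx)).1
    exact .inl ⟨θ, h.comp_lift (hT x)⟩
  · intro ζ hζ
    rw [hn x hx ζ hζ, shiftMap_apply]
  · change Disjoint (polarDisc x c _) (polarDisc y c _)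
    rw [hdisc, hdisc]
    exact hdis (hproj x hx) (hproj y hy) hxy
  · ext x'
    simp only [mem_iUnion, mem_preimage, mem_singleton_iff, exists_prop]
    constructor
    · intro hx'
      have h1 : x' ∈ φ ⁻¹' polarDisc (proj s) c Q := by
        rw [mem_preimage, ← proj_factor hD hψ hφ]
        rcases hx' with h | ⟨ω, hω, h⟩
        · rw [h]; exact mem_insert _ _
        · rw [← h, proj_lift G hω, hGq]
          exact mem_insert_of_mem _ ⟨_, hU.mem.2 hω, rfl⟩
      rw [hpre] at h1
      obtain ⟨x, hx, hxx'⟩ := mem_iUnion₂.1 h1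
      rw [← hdisc] at hxx'
      have h2 : ψ x' ∈ polarDisc (pushFrame hD (hA x hx)).mk c (pushFrame hD (hA x hx)).lift := by
        rw [← image_disc_factor hD hψ (hA x hx) le_rfl]
        exact mem_image_of_mem ψ hxx'
      have h3 : ψ x' ∈ polarDisc G.mk c G.lift := by rwa [hℓ]
      -- the discs about the images of the fibre of `φ` are disjoint or equal, which selects the
      -- points of the fibre over `s`
      have h4 := disjoint_disc (F := G) (G := pushFrame hD (hA x hx)) hx.symm (hrelT x) le_rfl le_rfl
        (hrel x hx) h3 h2
      exact ⟨x, by rw [hψ _ _ _ (hA x hx), ← h4, hℓ], hxx'⟩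
    · rintro ⟨x, hx, rfl | ⟨ζ, hζ, rfl⟩⟩
      · rw [hx]; exact mem_insert _ _
      · rw [hn x hx ζ hζ]
        exact mem_insert_of_mem _ ⟨_, (isLift_shiftMap _).mem.2 hζ, rfl⟩

/-- The image is open and closed. -/
theorem surjective_factor (hφ : IsCovering φ) (hR : R.IsTranslation)
    (hfin : Finite D₀.rotHol) : Function.Surjective ψ := by
  have hopen : IsOpen (range ψ) := by
    rw [isOpen_iff_mem_nhds]
    rintro _ ⟨x, rfl⟩
    obtain ⟨c, p, h⟩ := hφ.exists_adapted D x
    refine mem_of_superset ?_ (image_subset_range ψ (polarDisc x c p))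
    rw [image_disc_factor hD hψ h le_rfl, hψ _ _ _ h]
    exact (polarTop_lift _).disc_mem le_rfl
  have hclosed : IsClosed (range ψ) := by
    refine isClosed_of_closure_subset fun s hs => ?_
    obtain ⟨c, Q, q, t, hQ, -, -, hpre⟩ := exists_disc_family_factor hD hψ hφ hR hfin s
    obtain ⟨_, h1, ⟨x, rfl⟩⟩ := mem_closure_iff_nhds.1 hs _ (hQ.isFrame.1.disc_mem le_rfl)
    have h2 : x ∈ ψ ⁻¹' polarDisc s c Q := h1
    rw [hpre] at h2
    obtain ⟨y, hy, -⟩ := mem_iUnion₂.1 h2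
    exact ⟨y, hy⟩
  obtain ⟨x⟩ : Nonempty R := inferInstance
  exact range_eq_univ.1 (IsClopen.eq_univ ⟨hclosed, hopen⟩ ⟨_, x, rfl⟩)

end factor

/-- Every covering of `P` by a translation surface factors through the covering `proj`. -/
theorem exists_covering_factor (hfin : Finite D₀.rotHol) {φ : R → P} (hφ : IsCovering φ)
    (hR : R.IsTranslation) :
    ∃ ψ : R → surface D₀ hfin, IsCovering ψ ∧ ∀ x, φ x = proj (D₀ := D₀) (ψ x) := by
  obtain ⟨D, hD⟩ := hφ.exists_base hR D₀
  obtain ⟨ψ, hψ⟩ := exists_factor hD hφ hR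
  exact ⟨ψ, ⟨continuous_factor hD hψ hφ, surjective_factor hD hψ hφ hR hfin,
    exists_disc_family_factor hD hψ hφ hR hfin⟩, fun x => (proj_factor hD hψ hφ x).symm⟩

end TransCover

end PolygonalSurface

/-! ### Uniqueness of the minimal covering -/

/-- A surjection that preserves each fibre of a map with finite fibres permutes the fibres. -/
theorem injective_of_finite_fibre {X Y : Type*} {p : X → Y} (hp : ∀ y, (p ⁻¹' {y}).Finite)
    {f : X → X} (hf : Function.Surjective f) (h : ∀ x, p (f x) = p x) : Function.Injective f := by
  intro x x' hxx
  have hmaps : MapsTo f (p ⁻¹' {p x}) (p ⁻¹' {p x}) := fun r hr => (h r).trans hr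
  have hsurj : SurjOn f (p ⁻¹' {p x}) (p ⁻¹' {p x}) := by
    intro r hr
    obtain ⟨r', rfl⟩ := hf r
    exact ⟨r', (h r').symm.trans hr, rfl⟩
  refine (((hp (p x)).surjOn_iff_bijOn_of_mapsTo hmaps).1 hsurj).injOn rfl ?_ hxx
  exact (h x').symm.trans ((congrArg p hxx).symm.trans (h x))

namespace PolygonalSurface

open FlatAtlas

variable {P R S : PolygonalSurface.{u}} {D₀ : P.FlatDisc}

/-- Coverings map discs of polar coordinates to such discs. -/
theorem IsCovering.isOpenMap {φ : R → S} (hφ : IsCovering φ) : IsOpenMap φ := by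
  refine isOpenMap_iff_nhds_le.2 fun x U hU => ?_
  obtain ⟨c, p, h1, h2⟩ := hφ.exists_push x
  obtain ⟨a, ha, haU⟩ := h1.1.2.2.2.mem_iff.1 hU
  refine mem_of_superset (h2.1.disc_mem ha) ?_
  rintro _ (rfl | ⟨ζ, hζ, rfl⟩)
  · exact haU (mem_insert _ _)
  · exact haU (mem_insert_of_mem _ ⟨ζ, hζ, rfl⟩)

/-- The inverse of a covering with one sheet is a covering. -/
theorem IsCovering.isIsomorphism {h : R ≃ₜ S} (hh : IsCovering (h : R → S)) :
    IsIsomorphism h := by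
  refine ⟨hh, h.symm.continuous, h.symm.surjective, fun x => ?_⟩
  obtain ⟨c, Q, q, t, hQ, hq, -, hpre⟩ := hh.2.2 (h x)
  have hx : (h : R → S) ⁻¹' {h x} = {x} := by ext; simp
  have hx' : (h.symm : S → R) ⁻¹' {x} = {h x} := by ext; simp [Homeomorph.symm_apply_eq]
  obtain ⟨h1, h2⟩ := hq x rfl
  rw [hx, biUnion_singleton] at hpre
  refine ⟨c, q x, fun _ => Q, fun _ => -t x, h1, ?_, ?_, ?_⟩
  · rw [hx']
    rintro _ rfl
    refine ⟨hQ, fun ζ hζ => h.injective ?_⟩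
    rw [h.apply_symm_apply, h2 _ (by simpa [leftHalf] using hζ)]
    exact congrArg Q (by push_cast; ring)
  · rw [hx']
    exact pairwiseDisjoint_singleton _ _
  · rw [hx', biUnion_singleton, ← hpre]
    ext y
    simp

end PolygonalSurface

theorem corollary4 (P : PolygonalSurface.{u}) (hP : P.IsRational) :
    ∃ (S : PolygonalSurface.{u}) (φt : S → P),
      PolygonalSurface.IsMinimalTranslationCovering φt ∧
      (∀ D : P.FlatDisc, PolygonalSurface.HasDegree φt (Nat.card D.rotHol)) ∧
      ∀ (S' : PolygonalSurface.{u}) (φ' : S' → P),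
        PolygonalSurface.IsMinimalTranslationCovering φ' →
        ∃ h : S ≃ₜ S', PolygonalSurface.IsIsomorphism h ∧ ∀ x, φ' (h x) = φt x := by
  obtain ⟨D₀⟩ := PolygonalSurface.nonempty_flatDisc (P := P)
  have hfin : Finite D₀.rotHol := hP D₀
  let S := PolygonalSurface.TransCover.surface D₀ hfin
  let φt : S → P := PolygonalSurface.TransCover.proj (D₀ := D₀)
  have hφt : PolygonalSurface.IsTameCovering φt :=
    (PolygonalSurface.TransCover.isCovering_proj hfin).isTameCovering hP
  have hS : S.IsTranslation := PolygonalSurface.TransCover.isTranslation_surface hfin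
  have htame : ∀ {R' : PolygonalSurface.{u}} {φ' : R' → P}, R'.IsTranslation →
      PolygonalSurface.IsTameCovering φ' →
      ∃ ψ : R' → S, PolygonalSurface.IsTameCovering ψ ∧ ∀ x, φ' x = φt (ψ x) := by
    intro R' φ' hR' hφ'
    obtain ⟨ψ, hψ, h⟩ :=
      PolygonalSurface.TransCover.exists_covering_factor (D₀ := D₀) hfin hφ'.1 hR'
    exact ⟨ψ, hψ.isTameCovering fun E => by rw [hS E]; infer_instance, h⟩
  refine ⟨S, φt, ⟨hS, hφt, fun _ _ => htame⟩, fun D => ?_, fun S' φ' hφ' => ?_⟩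
  · rw [PolygonalSurface.card_rotHol D₀ D]
    exact PolygonalSurface.TransCover.hasDegree_proj hfin
  · -- the two minimal coverings factor through each other
    obtain ⟨ψ, hψ, h⟩ := htame hφ'.1 hφ'.2.1
    obtain ⟨ψ', hψ', h'⟩ := hφ'.2.2 S φt hS hφt
    have hinj : Function.Injective (ψ ∘ ψ') :=
      injective_of_finite_fibre (p := φt) (PolygonalSurface.TransCover.finite_fibre hfin)
        (hψ.1.2.1.comp hψ'.1.2.1) fun s => (h (ψ' s)).symm.trans (h' s).symm
    let e : S ≃ S' := Equiv.ofBijective ψ' ⟨hinj.of_comp, hψ'.1.2.1⟩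
    refine ⟨e.toHomeomorphOfContinuousOpen hψ'.1.1 hψ'.1.isOpenMap,
      PolygonalSurface.IsCovering.isIsomorphism hψ'.1, fun x => (h' x).symm⟩
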